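/- Let $d\ge 1$, $T>0$, and call *polytope* a bounded connected open set $P\subset\mathbb R^d$, not necessarily convex, whose closure is a finite union of convex polytopes and with $P=\operatorname{int}\overline P$. Let $\Omega\subset\mathbb R^d$ be a polytope and $Q_T=\Omega\times(0,T)$. Let $\mathcal T_h$ be a finite nonoverlapping partition of $Q_T$ into open prisms $K=K_x\times K_t\subset Q_T$, with $K_x$ a polytope and $K_t$ a nonempty bounded open interval, whose closures cover $Q_T$ (hanging facets are allowed). Denote by $\mathcal F_h^{\rm space}$ the internal space-like facets (shared by an element before and an element after a fixed time), by $\mathcal F_h^0$ the facets on $\Omega\times\{0\}$, by $\mathcal F_h^{\rm time}$ the internal time-like facets (in $\partial K_1\cap\partial K_2$, with normal orthogonal to the time direction), and by $\mathcal F_h^{\rm D}$ the time-like facets on $\partial\Omega\times(0,T)$. Let $n_K$ be the spatial component of the outward unit normal to a time-like facet of $K$, and $n_\Omega$ the outward unit normal to $\partial\Omega$. Let $\kappa:Q_T\to\mathbb R^{d\times d}$ be measurable, symmetric, with $y^{T}\kappa y\ge\theta|y|^2$ for all $y\in\mathbb R^d$ almost everywhere, for some $\theta>0$. Let $f\in L^2(Q_T)$,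 $u_0\in L^2(\Omega)$, $g_{\rm D}\in L^2(\partial\Omega\times(0,T))$; let $\alpha$ be a measurable function on $\mathcal F_h^{\rm time}$ with values in $[0,1]$ (for instance a constant $\alpha_F$ on each facet $F$), and let $\eta\in L^\infty(\mathcal F_h^{\rm time}\cup\mathcal F_h^{\rm D})$ have positive essential infimum. On a facet in $\mathcal F_h^{\rm time}$ between $K_1$ and $K_2$ put $[\![w]\!]_N=w|_{K_1}n_{K_1}+w|_{K_2}n_{K_2}$ and $\{r\}_{\beta}=(1-\beta)r|_{K_1}+\beta\, r|_{K_2}$; on a facet in $\mathcal F_h^{\rm space}$ let $w^-$ and $w^+$ be the traces from the elements before and after it, and $[\![w]\!]_t=w^--w^+$. For every $K\in\mathcal T_h$ let $\mathcal V(K)\subset H^1(K)$ and $\mathcal M(K)\subset H^1(K)^d$ be finite-dimensional subspaces with $\nabla_x\mathcal V(K)\subset\mathcal M(K)$ (local compatibility condition). Set $\mathcal V_p(\mathcal T_h)=\prod_K\mathcal V(K)$, $\mathcal M_p(\mathcal T_h)=\prod_K\mathcal M(K)$, and, with all boundary values understood as traces, $$m_h(u,v)=\sum_K\int_K\partial_tu\,v-\int_{\mathcal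 F_h^{\rm space}}v^+[\![u]\!]_t+\int_{\mathcal F_h^0}uv,\qquad d_h(q,r)=\sum_K\int_K\kappa^{-1}q\cdot r,$$ $$b_h(u,r)=\sum_K\int_K\nabla_xu\cdot r-\int_{\mathcal F_h^{\rm time}}[\![u]\!]_N\cdot\{r\}_{1-\alpha}-\int_{\mathcal F_h^{\rm D}}u\,r\cdot n_\Omega,$$ $$s_h(u,v)=\int_{\mathcal F_h^{\rm time}}\eta\,[\![u]\!]_N\cdot[\![v]\!]_N+\int_{\mathcal F_h^{\rm D}}\eta\,uv,$$ $$\ell^q_h(r)=-\int_{\mathcal F_h^{\rm D}}g_{\rm D}\,r\cdot n_\Omega,\qquad \ell^u_h(v)=\int_{Q_T}fv+\int_{\mathcal F_h^{\rm D}}\eta\,g_{\rm D}v+\int_{\mathcal F_h^0}u_0v.$$ Then there is exactly one $(u_h,q_h)\in\mathcal V_p(\mathcal T_h)\times\mathcal M_p(\mathcal T_h)$ such that $$d_h(q_h,r)+b_h(u_h,r)=\ell^q_h(r)\quad\forall r\in\mathcal M_p(\mathcal T_h),$$ $$m_h(u_h,v)-b_h(v,q_h)+s_h(u_h,v)=\ell^u_h(v)\quad\forall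 v\in\mathcal V_p(\mathcal T_h).$$ -/

import Mathlib

open MeasureTheory Set Filter Topology
open scoped ENNReal ContDiff

noncomputable section

namespace SpaceTimeLDG

/-- The spatial Euclidean space `ℝ^d`. -/
abbrev Space (d : ℕ) : Type := EuclideanSpace ℝ (Fin d)

/-- Space-time `ℝ^d × ℝ`, with its product Lebesgue measure; points are pairs `(x, t)`. -/
abbrev SpaceTime (d : ℕ) : Type := Space d × ℝ

/-- An open `d`-dimensional polytope (not necessarily convex): a connected (hence nonempty) open set
whose closure is a finite union of convex polytopes, and which is the interior of its closure,
so that it has no slits. -/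
structure IsPolytope {d : ℕ} (P : Set (Space d)) : Prop where
  isConnected : IsConnected P
  interior_closure : interior (closure P) = P
  exists_hulls : ∃ 𝒮 : Finset (Finset (Space d)),
    closure P = ⋃ S ∈ 𝒮, convexHull ℝ (S : Set (Space d))

/-- The space-time cylinder `Q_T = Ω × (0, T)`. -/
def cylinder {d : ℕ} (Ω : Set (Space d)) (T : ℝ) : Set (SpaceTime d) := Ω ×ˢ Ioo 0 T

/-- A nonoverlapping prismatic partition of `Q_T = Ω × (0, T)` into `N` elements
`K_i = base i × (tbeg i, tend i)`. Nothing is required about how neighbouring elements match, so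
hanging facets and local time steps are allowed. -/
structure PrismaticMesh {d : ℕ} (Ω : Set (Space d)) (T : ℝ) (N : ℕ) where
  base : Fin N → Set (Space d)
  tbeg : Fin N → ℝ
  tend : Fin N → ℝ
  isPolytope_base : ∀ i, IsPolytope (base i)
  tbeg_lt_tend : ∀ i, tbeg i < tend i
  elem_subset : ∀ i, base i ×ˢ Ioo (tbeg i) (tend i) ⊆ cylinder Ω T
  disjoint_elem : ∀ i j, i ≠ j →
    Disjoint (base i ×ˢ Ioo (tbeg i) (tend i)) (base j ×ˢ Ioo (tbeg j) (tend j))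
  cover : cylinder Ω T ⊆ ⋃ i, closure (base i ×ˢ Ioo (tbeg i) (tend i))

/-! ### Sobolev functions on an open set of space-time -/

/-- `g` is the weak derivative of `u` on `K` in the direction `v`. -/
def IsWeakDeriv {d : ℕ} (K : Set (SpaceTime d)) (v : SpaceTime d) (u g : SpaceTime d → ℝ) : Prop :=
  ∀ φ : SpaceTime d → ℝ, ContDiff ℝ ∞ φ → HasCompactSupport φ → tsupport φ ⊆ K →
    ∫ p in K, u p * fderiv ℝ φ p v = - ∫ p in K, g p * φ p

/-- `G` is the weak spatial gradient of `u` on `K`. -/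
def IsWeakGradX {d : ℕ} (K : Set (SpaceTime d)) (u : SpaceTime d → ℝ)
    (G : SpaceTime d → Space d) : Prop :=
  ∀ k : Fin d, IsWeakDeriv K (EuclideanSpace.single k 1, 0) u (fun p => G p k)

/-- `g` is the weak time derivative of `u` on `K`. -/
def IsWeakDerivT {d : ℕ} (K : Set (SpaceTime d)) (u g : SpaceTime d → ℝ) : Prop :=
  IsWeakDeriv K (0, 1) u g

/-- Membership in the Sobolev space `H¹(K)`: `u`, its weak spatial gradient and its weak time
derivative are in `L²(K)`. -/
def MemH1 {d : ℕ} (K : Set (SpaceTime d)) (u : SpaceTime d → ℝ) : Prop :=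
  MemLp u 2 (volume.restrict K) ∧
  (∃ G : Lp (Space d) 2 (volume.restrict K), IsWeakGradX K u G) ∧
  (∃ g : Lp ℝ 2 (volume.restrict K), IsWeakDerivT K u g)

open Classical in
/-- The weak spatial gradient `∇ₓ u ∈ L²(K)^d` (zero if there is none, which is never the case on
`H¹(K)`). -/
def gradX {d : ℕ} (K : Set (SpaceTime d)) (u : SpaceTime d → ℝ) :
    Lp (Space d) 2 (volume.restrict K) :=
  if h : ∃ G : Lp (Space d) 2 (volume.restrict K), IsWeakGradX K u G then h.choose else 0

open Classical in
/-- The weak time derivative `∂ₜ u ∈ L²(K)` (zero if there is none, which is never the case on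
`H¹(K)`). -/
def derivT {d : ℕ} (K : Set (SpaceTime d)) (u : SpaceTime d → ℝ) :
    Lp ℝ 2 (volume.restrict K) :=
  if h : ∃ g : Lp ℝ 2 (volume.restrict K), IsWeakDerivT K u g then h.choose else 0

/-- The trace at a boundary point `p` of a function on `K`: the limit of its averages over
`K ∩ B(p, r)` as `r → 0`. It depends on the class of `w` in `L²(K)` only. For `w ∈ H¹(K)` on a
prism over a polytope the limit exists at almost every point of each facet, and is the usual
Sobolev trace. -/
def trace {d : ℕ} {F : Type*} [NormedAddCommGroup F] [NormedSpace ℝ F]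
    (K : Set (SpaceTime d)) (w : SpaceTime d → F) (p : SpaceTime d) : F :=
  limUnder (𝓝[>] (0 : ℝ)) (fun r => ⨍ z in K ∩ Metric.ball p r, w z)

/-! ### Normals -/

/-- `n` is the outward unit normal at `x` of a set that near `x` is a half-space with boundary
through `x`. -/
def IsOutwardNormal {d : ℕ} (P : Set (Space d)) (x n : Space d) : Prop :=
  ‖n‖ = 1 ∧ ∃ r > 0, ∀ y ∈ Metric.ball x r, y ∈ P ↔ inner ℝ (y - x) n < 0

open Classical in
/-- The outward unit normal of a polytope, defined at all boundary points except those on the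
lower-dimensional faces, a null set for the surface measure, where the value is `0`. -/
def outwardNormal {d : ℕ} (P : Set (Space d)) (x : Space d) : Space d :=
  if h : ∃ n, IsOutwardNormal P x n then h.choose else 0

namespace PrismaticMesh

variable {d N : ℕ} {Ω : Set (Space d)} {T : ℝ} (𝒯 : PrismaticMesh Ω T N)

/-- The (open) element `K_i`. -/
def elem (i : Fin N) : Set (SpaceTime d) := 𝒯.base i ×ˢ Ioo (𝒯.tbeg i) (𝒯.tend i)

/-- The spatial component of the outward unit normal of `K_i` at a point of a time-like facet. -/
def normal (i : Fin N) (p : SpaceTime d) : Space d := outwardNormal (𝒯.base i) p.1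

/-- Surface measure on the union of the internal time-like facets shared by `K_i` and `K_j`, which
is (up to null sets) `(∂(base i) ∩ ∂(base j)) × (I_i ∩ I_j)`, where `I_i` is the time interval
of `K_i`; `μHE[d - 1]` is the Hausdorff measure normalized as surface area. -/
def timeFacetMeasure (i j : Fin N) : Measure (SpaceTime d) :=
  ((μHE[d - 1] : Measure (Space d)).restrict (frontier (𝒯.base i) ∩ frontier (𝒯.base j))).prod
    (volume.restrict (Ioo (𝒯.tbeg i) (𝒯.tend i) ∩ Ioo (𝒯.tbeg j) (𝒯.tend j)))

/-- Surface measure on the union of the Dirichlet facets of `K_i`, the time-like ones on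
`∂Ω × (0, T)`. -/
def dirichletFacetMeasure (i : Fin N) : Measure (SpaceTime d) :=
  ((μHE[d - 1] : Measure (Space d)).restrict (frontier (𝒯.base i) ∩ frontier Ω)).prod
    (volume.restrict (Ioo (𝒯.tbeg i) (𝒯.tend i)))

/-- Surface measure on the internal time-like skeleton `F_h^time`, every pair of elements being
counted once. -/
def timeSkeletonMeasure : Measure (SpaceTime d) :=
  ∑ i, ∑ j ∈ Finset.Ioi i, 𝒯.timeFacetMeasure i j

/-- Surface measure on the Dirichlet part `F_h^D` of the skeleton. -/
def dirichletSkeletonMeasure : Measure (SpaceTime d) :=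
  ∑ i, 𝒯.dirichletFacetMeasure i

/-- Broken square-integrable scalar functions, `∏_K L²(K)`. -/
abbrev BrokenScalar : Type := ∀ i, Lp ℝ 2 (volume.restrict (𝒯.elem i))

/-- Broken square-integrable vector fields, `∏_K L²(K)^d`. -/
abbrev BrokenVector : Type := ∀ i, Lp (Space d) 2 (volume.restrict (𝒯.elem i))

variable {𝒯}

/-- Trace of a broken scalar function from the element `K_i`. -/
def trS (u : 𝒯.BrokenScalar) (i : Fin N) (p : SpaceTime d) : ℝ :=
  trace (𝒯.elem i) (u i) p

/-- Trace of a broken vector field from the element `K_i`. -/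
def trV (r : 𝒯.BrokenVector) (i : Fin N) (p : SpaceTime d) : Space d :=
  trace (𝒯.elem i) (r i) p

/-- The spatial normal jump `⟦u⟧_N = u|_{K_i} n_{K_i} + u|_{K_j} n_{K_j}`. -/
def jumpN (u : 𝒯.BrokenScalar) (i j : Fin N) (p : SpaceTime d) : Space d :=
  trS u i p • 𝒯.normal i p + trS u j p • 𝒯.normal j p

/-- The weighted average `(1 - a) r|_{K_i} + a r|_{K_j}` of a vector field. -/
def avgV (a : ℝ) (r : 𝒯.BrokenVector) (i j : Fin N) (p : SpaceTime d) : Space d :=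
  (1 - a) • trV r i p + a • trV r j p

/-! ### The forms of the method -/

/-- `m_h(u, v) = ∑_K ∫_K ∂ₜu v - ∫_{F_h^space} v⁺ ⟦u⟧_t + ∫_{F_h^0} u v`. An internal space-like
facet with `K_i` before and `K_j` after it has `tend i = tbeg j`, lies at that time, and is,
up to a null set, the product with it of `base i ∩ base j`; there `⟦u⟧_t = u⁻ - u⁺`. -/
def mForm (u v : 𝒯.BrokenScalar) : ℝ :=
  (∑ i, ∫ p in 𝒯.elem i, derivT (𝒯.elem i) (u i) p * v i p)
  - (∑ i, ∑ j with 𝒯.tend i = 𝒯.tbeg j, ∫ x in 𝒯.base i ∩ 𝒯.base j,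
      trS v j (x, 𝒯.tbeg j) * (trS u i (x, 𝒯.tbeg j) - trS u j (x, 𝒯.tbeg j)))
  + ∑ i with 𝒯.tbeg i = 0, ∫ x in 𝒯.base i, trS u i (x, 0) * trS v i (x, 0)

/-- `d_h(q, r) = ∑_K ∫_K κ⁻¹ q · r`. -/
def dForm (κ : SpaceTime d → Matrix (Fin d) (Fin d) ℝ) (q r : 𝒯.BrokenVector) : ℝ :=
  ∑ i, ∫ p in 𝒯.elem i, inner ℝ (Matrix.toEuclideanLin (κ p)⁻¹ (q i p)) (r i p)

/-- `b_h(u, r) = ∑_K ∫_K ∇ₓu · r - ∫_{F_h^time} ⟦u⟧_N · {r}_{1-α} - ∫_{F_h^D} u r · n_Ω`. -/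
def bForm (α : SpaceTime d → ℝ) (u : 𝒯.BrokenScalar) (r : 𝒯.BrokenVector) : ℝ :=
  (∑ i, ∫ p in 𝒯.elem i, inner ℝ (gradX (𝒯.elem i) (u i) p) (r i p))
  - (∑ i, ∑ j ∈ Finset.Ioi i,
      ∫ p, inner ℝ (jumpN u i j p) (avgV (1 - α p) r i j p) ∂(𝒯.timeFacetMeasure i j))
  - ∑ i, ∫ p, trS u i p * inner ℝ (trV r i p) (outwardNormal Ω p.1)
      ∂(𝒯.dirichletFacetMeasure i)

/-- `s_h(u, v) = ∫_{F_h^time} η ⟦u⟧_N · ⟦v⟧_N + ∫_{F_h^D} η u v`. -/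
def sForm (η : SpaceTime d → ℝ) (u v : 𝒯.BrokenScalar) : ℝ :=
  (∑ i, ∑ j ∈ Finset.Ioi i,
      ∫ p, η p * inner ℝ (jumpN u i j p) (jumpN v i j p) ∂(𝒯.timeFacetMeasure i j))
  + ∑ i, ∫ p, η p * (trS u i p * trS v i p) ∂(𝒯.dirichletFacetMeasure i)

/-- `ℓ_h^q(r) = -∫_{F_h^D} g_D r · n_Ω`. -/
def lqForm (gD : SpaceTime d → ℝ) (r : 𝒯.BrokenVector) : ℝ :=
  - ∑ i, ∫ p, gD p * inner ℝ (trV r i p) (outwardNormal Ω p.1) ∂(𝒯.dirichletFacetMeasure i)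

/-- `ℓ_h^u(v) = ∫_{Q_T} f v + ∫_{F_h^D} η g_D v + ∫_{F_h^0} u₀ v`. -/
def luForm (η f : SpaceTime d → ℝ) (u₀ : Space d → ℝ) (gD : SpaceTime d → ℝ)
    (v : 𝒯.BrokenScalar) : ℝ :=
  (∑ i, ∫ p in 𝒯.elem i, f p * v i p)
  + (∑ i, ∫ p, η p * (gD p * trS v i p) ∂(𝒯.dirichletFacetMeasure i))
  + ∑ i with 𝒯.tbeg i = 0, ∫ x in 𝒯.base i, u₀ x * trS v i (x, 0)

end PrismaticMesh

open PrismaticMesh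

/-- `(u, q)` solves the mixed space-time LDG formulation in `∏_K V(K) × ∏_K M(K)`:
`d_h(q, r) + b_h(u, r) = ℓ_h^q(r)` for all `r ∈ ∏_K M(K)`, and
`m_h(u, v) - b_h(v, q) + s_h(u, v) = ℓ_h^u(v)` for all `v ∈ ∏_K V(K)`. -/
def IsLDGSolution {d N : ℕ} {Ω : Set (Space d)} {T : ℝ} (𝒯 : PrismaticMesh Ω T N)
    (V : ∀ i, Submodule ℝ (Lp ℝ 2 (volume.restrict (𝒯.elem i))))
    (M : ∀ i, Submodule ℝ (Lp (Space d) 2 (volume.restrict (𝒯.elem i))))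
    (κ : SpaceTime d → Matrix (Fin d) (Fin d) ℝ) (α η f : SpaceTime d → ℝ)
    (u₀ : Space d → ℝ) (gD : SpaceTime d → ℝ)
    (u : ∀ i, V i) (q : ∀ i, M i) : Prop :=
  (∀ r : ∀ i, M i,
    dForm (𝒯 := 𝒯) κ (fun i => q i) (fun i => r i)
      + bForm (𝒯 := 𝒯) α (fun i => u i) (fun i => r i)
      = lqForm (𝒯 := 𝒯) gD (fun i => r i)) ∧
  (∀ v : ∀ i, V i,
    mForm (𝒯 := 𝒯) (fun i => u i) (fun i => v i)
      - bForm (𝒯 := 𝒯) α (fun i => v i) (fun i => q i)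
      + sForm (𝒯 := 𝒯) η (fun i => u i) (fun i => v i)
      = luForm (𝒯 := 𝒯) η f u₀ gD (fun i => v i))

end SpaceTimeLDG

end

/-! The discrete problem is a square linear system. The spaces `∏ V i` and `∏ M i` are
finite-dimensional, and all the forms are (bi)linear on them, so it is enough that the homogeneous
problem has only the zero solution (`existsUnique_mixed`, `eq_zero_of_homogeneous`).

*Energy argument.* Testing the homogeneous problem with its solution `(u, q)` gives
`d_h(q, q) + m_h(u, u) + s_h(u, u) = 0`. All three terms are nonnegative: the first by coercivity of
`κ` (`dForm_self`), the third because `η` is positive (`sForm_self`), and the second by integration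
by parts in time (`mForm_self_nonneg`), where the tops of the elements that end at a time `t` tile
the bottoms of the elements that start at `t`. Hence `q = 0`, the jumps of `u` across the time-like
facets vanish, and `u = 0` on the Dirichlet facets. The first equation then says that `b_h(u, ·) = 0`,
and with the test function `∇ₓu`, admissible by the local compatibility condition, it gives `∇ₓu = 0`
(`gradX_eq_zero_of_bForm_eq_zero`).

*Functions of time.* On each element, whose base is connected, `u` is then a function of time only
(`exists_ae_eq_snd_of_gradX_eq_zero`). Nothing need be known about how the elements meet in order to
conclude that it is zero. One arrangement of hyperplanes contains the boundaries of `Ω` and of all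
bases, so each of its cells lies inside or outside each of them. A generic segment from a cell
outside `Ω` to any other one crosses the hyperplanes one at a time, in relatively open facets of
positive surface measure (`Arrangement.cell_induction`); there the elements on the two sides, as far
as they are active at a given time, have the same trace, or the trace is zero if the other side is
outside `Ω`. So the value zero propagates to all cells (`ae_eq_zero_of_jumpN_eq_zero`).

*Traces.* The forms use the trace of `u` at a boundary point `p` of an element `K` as the limit of
the averages of `u` over `K ∩ B(p, r)`, and they are bilinear only because these limits exist almost
everywhere and are square-integrable. A function with a weak derivative in `L²` along a direction
transversal to a flat piece of the boundary is absolutely continuous on almost every transversal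
segment (`IsWeakDeriv.ae_sub_eq_integral`, `exists_trace_representative`). Its value at the foot of
the segment is square-integrable over that piece, and is the limit of the averages by Lebesgue's
differentiation theorem applied to the tails `∫₀^δ |D|` (`ae_hasTraceAt_chart`). A facet is covered
by finitely many balls, on each of which one transversal direction serves for all points
(`traceOn_facet_ball`, `traceOn_facet`). Up to a null set, the boundary of a polytope is the union of
such facets (`exists_arrangement`, `Arrangement.restrict_frontier_le`), which yields
`traceOn_lateral`. The bottom and the top of a prism are covered by vertical segments, and the
absolutely continuous representative there also gives the integration by parts (`time_traces`).

The discrete functions are classes in `L²`, on which traces and weak derivatives are linear only up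
to equality almost everywhere. `AELin` records exactly this, and is what makes the forms bilinear. -/

set_option linter.unusedSectionVars false

namespace SpaceTimeLDG

/-! ### Weak derivatives and translations -/

instance instIsAddHaarMeasureSpaceTime (d : ℕ) :
    (volume : Measure (SpaceTime d)).IsAddHaarMeasure :=
  inferInstanceAs (((volume : Measure (Space d)).prod (volume : Measure ℝ)).IsAddHaarMeasure)

theorem IsWeakDeriv.const_smul {d : ℕ} {K : Set (SpaceTime d)} {v : SpaceTime d}
    {u D : SpaceTime d → ℝ} (h : IsWeakDeriv K v u D) (c : ℝ) :
    IsWeakDeriv K (c • v) u (fun p => c * D p) := by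
  intro φ h1 h2 h3
  have := h φ h1 h2 h3
  simp only [map_smul, smul_eq_mul]
  have e1 : ∀ p, u p * (c * fderiv ℝ φ p v) = c * (u p * fderiv ℝ φ p v) := fun p => by ring
  have e2 : ∀ p, c * D p * φ p = c * (D p * φ p) := fun p => by ring
  simp_rw [e1, e2, integral_const_mul, this]
  ring

/-- The fundamental theorem of calculus for a weak derivative: along a vector `v` that does not
lead out of `K`, the increment of `u` is almost everywhere the integral of its weak derivative. -/
theorem IsWeakDeriv.ae_sub_eq_integral {d : ℕ} {K O : Set (SpaceTime d)} (hK : MeasurableSet K)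
    (hO : IsOpen O) {v : SpaceTime d} {u D : SpaceTime d → ℝ} (hu : IntegrableOn u K)
    (hD : IntegrableOn D K) (hDm : StronglyMeasurable D) (h : IsWeakDeriv K v u D)
    (hOK : ∀ p ∈ O, ∀ σ ∈ Icc (0 : ℝ) 1, p + σ • v ∈ K) :
    ∀ᵐ p : SpaceTime d, p ∈ O → u (p + v) - u p = ∫ σ in Ioc (0 : ℝ) 1, D (p + σ • v) := by
  set U : SpaceTime d → ℝ := K.indicator u with hU
  set E : SpaceTime d → ℝ := K.indicator D with hE
  have hUi : Integrable U := (integrable_indicator_iff hK).2 hu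
  have hEi : Integrable E := (integrable_indicator_iff hK).2 hD
  have hEm : StronglyMeasurable E := hDm.indicator hK
  set ν : Measure ℝ := volume.restrict (Ioc (0 : ℝ) 1) with hν
  have : IsFiniteMeasure ν := ⟨by simp [hν]⟩
  have hsec : Integrable (fun z : SpaceTime d × ℝ => E (z.1 + z.2 • v)) (volume.prod ν) := by
    have hm : StronglyMeasurable (fun z : SpaceTime d × ℝ => E (z.1 + z.2 • v)) :=
      hEm.comp_measurable (by fun_prop)
    rw [integrable_prod_iff' hm.aestronglyMeasurable]
    refine ⟨ae_of_all _ fun σ => hEi.comp_add_right (σ • v), ?_⟩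
    have : ∀ σ : ℝ, ∫ p, ‖E (p + σ • v)‖ = ∫ p, ‖E p‖ := fun σ =>
      integral_add_right_eq_self (fun p => ‖E p‖) (σ • v)
    simp only [this]
    exact integrable_const _
  have hcol : Integrable (fun p => ∫ σ, E (p + σ • v) ∂ν) := hsec.integral_prod_left
  have hUv : Integrable (fun p => U (p + v)) := hUi.comp_add_right v
  have key : ∀ᵐ p : SpaceTime d, p ∈ O → U (p + v) - U p - ∫ σ, E (p + σ • v) ∂ν = 0 := by
    refine hO.ae_eq_zero_of_integral_contDiff_smul_eq_zero
      (((hUv.sub hUi).sub hcol).locallyIntegrable.locallyIntegrableOn _) ?_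
    intro g hg hgc hgs
    have hgcont : Continuous g := hg.continuous
    obtain ⟨C, hC⟩ := hgcont.bounded_above_of_compact_support hgc
    have hg1 : ContDiff ℝ 1 g := hg.of_le (by exact_mod_cast le_top)
    have hg'cont : Continuous (fun p => fderiv ℝ g p v) :=
      (hg1.continuous_fderiv one_ne_zero).clm_apply continuous_const
    have hg'c : HasCompactSupport (fun p => fderiv ℝ g p v) := hgc.fderiv_apply ℝ v
    obtain ⟨C', hC'⟩ := hg'cont.bounded_above_of_compact_support hg'c
    -- the fundamental theorem of calculus for the test function
    have ftc : ∀ p, g (p - v) - g p = - ∫ σ, fderiv ℝ g (p - σ • v) v ∂ν := by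
      intro p
      have hd : ∀ σ : ℝ, HasDerivAt (fun σ : ℝ => g (p - σ • v))
          (-(fderiv ℝ g (p - σ • v) v)) σ := by
        intro σ
        have h1 : HasDerivAt (fun σ : ℝ => p - σ • v) (-v) σ := by
          simpa using ((hasDerivAt_id σ).smul_const v).const_sub p
        have h2 := ((hg1.differentiable one_ne_zero) (p - σ • v)).hasFDerivAt.comp_hasDerivAt σ h1
        simpa [Function.comp_def] using h2
      have := intervalIntegral.integral_eq_sub_of_hasDerivAt (a := 0) (b := 1)
        (fun σ _ => hd σ) (Continuous.intervalIntegrable (by fun_prop) _ _)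
      rw [intervalIntegral.integral_of_le zero_le_one, integral_neg] at this
      simpa using this.symm
    have weak : ∀ σ ∈ Ioc (0 : ℝ) 1, ∫ p, U p * fderiv ℝ g (p - σ • v) v
        = - ∫ p, E p * g (p - σ • v) := by
      intro σ hσ
      have hsupp : tsupport (fun p => g (p - σ • v)) ⊆ K := by
        have : (fun p => g (p - σ • v)) = g ∘ (Homeomorph.subRight (σ • v)) := rfl
        rw [this, tsupport_comp_eq_preimage]
        intro p hp
        have := hOK _ (hgs hp) σ ⟨hσ.1.le, hσ.2⟩
        simpa using this
      have := h (fun p => g (p - σ • v)) (hg.comp (contDiff_id.sub contDiff_const))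
        (hgc.comp_homeomorph (Homeomorph.subRight (σ • v))) hsupp
      have hfd : ∀ p, fderiv ℝ (fun p => g (p - σ • v)) p = fderiv ℝ g (p - σ • v) := fun p => by
        simpa [sub_eq_add_neg] using fderiv_comp_add_right (f := g) (x := p) (𝕜 := ℝ) (-(σ • v))
      simp only [hfd] at this
      rw [← integral_indicator hK, ← integral_indicator hK] at this
      simpa only [hU, hE, indicator_mul_left] using this
    have i1 : Integrable (fun p => g p * U (p + v)) :=
      hUv.bdd_mul hgcont.aestronglyMeasurable (ae_of_all _ hC)
    have i2 : Integrable (fun p => g p * U p) :=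
      hUi.bdd_mul hgcont.aestronglyMeasurable (ae_of_all _ hC)
    have i3 : Integrable (fun p => g p * ∫ σ, E (p + σ • v) ∂ν) :=
      hcol.bdd_mul hgcont.aestronglyMeasurable (ae_of_all _ hC)
    have i1' : Integrable (fun p => g (p - v) * U p) := by
      simpa using i1.comp_sub_right v
    have e1 : ∫ p, g p * U (p + v) = ∫ p, g (p - v) * U p := by
      have := integral_sub_right_eq_self (fun p => g p * U (p + v)) v (μ := volume)
      simpa using this.symm
    have iprod : Integrable (fun z : SpaceTime d × ℝ => U z.1 * fderiv ℝ g (z.1 - z.2 • v) v)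
        (volume.prod ν) := by
      have hU1 : Integrable (fun z : SpaceTime d × ℝ => U z.1) (volume.prod ν) := hUi.comp_fst ν
      refine hU1.mul_bdd (c := C') ?_ (ae_of_all _ fun z => hC' _)
      exact Continuous.aestronglyMeasurable (by fun_prop)
    have e2 : ∫ p, (g (p - v) * U p - g p * U p) = ∫ p, g p * ∫ σ, E (p + σ • v) ∂ν := by
      calc ∫ p, (g (p - v) * U p - g p * U p)
          = ∫ p, - ∫ σ, U p * fderiv ℝ g (p - σ • v) v ∂ν := by
            congr 1; ext p
            rw [integral_const_mul, ← sub_mul, ftc p]; ring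
        _ = - ∫ σ, (∫ p, U p * fderiv ℝ g (p - σ • v) v) ∂ν := by
            rw [integral_neg, integral_integral_swap iprod]
        _ = ∫ σ, (∫ p, g p * E (p + σ • v)) ∂ν := by
            rw [← integral_neg]
            refine setIntegral_congr_fun measurableSet_Ioc fun σ hσ => ?_
            rw [weak σ hσ, neg_neg,
              ← integral_add_right_eq_self (fun p => E p * g (p - σ • v)) (σ • v)]
            simp [mul_comm]
        _ = ∫ p, g p * ∫ σ, E (p + σ • v) ∂ν := by
            have : Integrable (fun z : SpaceTime d × ℝ => g z.1 * E (z.1 + z.2 • v))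
                (volume.prod ν) :=
              hsec.bdd_mul (Continuous.aestronglyMeasurable (by fun_prop))
                (ae_of_all _ fun z => hC _)
            rw [← integral_integral_swap this]
            simp_rw [integral_const_mul]
    simp only [smul_eq_mul, mul_sub]
    rw [integral_sub (by exact i1.sub i2) i3, integral_sub i1 i2, e1, ← integral_sub i1' i2, e2,
      sub_self]
  filter_upwards [key] with p hp hpO
  have h0 : p ∈ K := by simpa using hOK p hpO 0 (by simp)
  have h1 : p + v ∈ K := by simpa using hOK p hpO 1 (by simp)
  have h2 : ∫ σ, E (p + σ • v) ∂ν = ∫ σ in Ioc (0 : ℝ) 1, D (p + σ • v) :=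
    setIntegral_congr_fun measurableSet_Ioc fun σ hσ => by
      simp only [hE]
      rw [indicator_of_mem (hOK p hpO σ ⟨hσ.1.le, hσ.2⟩)]
  have := hp hpO
  rw [h2, hU, indicator_of_mem h0, indicator_of_mem h1] at this
  linarith

/-! ### Flat charts at a facet -/

section Chart

variable {d : ℕ} {Y : Type*} [NormedAddCommGroup Y] [NormedSpace ℝ Y]

/-- The affine chart `(y, s) ↦ p₀ + L (y, s)` of space-time; `y` runs over a parametrization of a
hyperplane through `p₀`, and `s` is the coordinate transversal to it. -/
def chart (L : (Y × ℝ) ≃L[ℝ] SpaceTime d) (p₀ : SpaceTime d) (z : Y × ℝ) : SpaceTime d :=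
  p₀ + L z

theorem chart_add_smul (L : (Y × ℝ) ≃L[ℝ] SpaceTime d) (p₀ : SpaceTime d) (y : Y) (s h : ℝ) :
    chart L p₀ (y, s) + h • L (0, 1) = chart L p₀ (y, s + h) := by
  rw [chart, chart, add_assoc, ← map_smul, ← map_add]
  simp

/-- A chart as a homeomorphism. -/
def chartHomeo (L : (Y × ℝ) ≃L[ℝ] SpaceTime d) (p₀ : SpaceTime d) : (Y × ℝ) ≃ₜ SpaceTime d :=
  L.toHomeomorph.trans (Homeomorph.addLeft p₀)

theorem continuous_chart (L : (Y × ℝ) ≃L[ℝ] SpaceTime d) (p₀ : SpaceTime d) :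
    Continuous (chart L p₀) := (chartHomeo L p₀).continuous

variable [FiniteDimensional ℝ Y] [MeasurableSpace Y] [BorelSpace Y]

theorem measurableEmbedding_chart (L : (Y × ℝ) ≃L[ℝ] SpaceTime d) (p₀ : SpaceTime d) :
    MeasurableEmbedding (chart L p₀) := (chartHomeo L p₀).measurableEmbedding

variable (μ : Measure Y) [μ.IsAddHaarMeasure]

/-- In a chart, Lebesgue measure is a constant multiple of a product Haar measure. -/
theorem exists_map_chart_eq_smul (L : (Y × ℝ) ≃L[ℝ] SpaceTime d) (p₀ : SpaceTime d) :
    ∃ c : ℝ≥0∞, c ≠ 0 ∧ c ≠ ⊤ ∧ (μ.prod volume).map (chart L p₀) = c • volume := by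
  have h1 : ((μ.prod (volume : Measure ℝ)).map L).IsAddHaarMeasure :=
    L.isAddHaarMeasure_map _
  obtain ⟨c, h0, ht, hc⟩ : ∃ c : ℝ≥0∞, c ≠ 0 ∧ c ≠ ⊤ ∧
      (μ.prod (volume : Measure ℝ)).map L = c • volume :=
    ⟨_, ENNReal.coe_ne_zero.2 (Measure.addHaarScalarFactor_pos_of_isAddHaarMeasure
      ((μ.prod (volume : Measure ℝ)).map L) (volume : Measure (SpaceTime d))).ne',
      ENNReal.coe_ne_top, Measure.isAddLeftInvariant_eq_smul
      ((μ.prod (volume : Measure ℝ)).map L) (volume : Measure (SpaceTime d))⟩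
  refine ⟨c, h0, ht, ?_⟩
  have : chart L p₀ = (fun q => p₀ + q) ∘ L := rfl
  rw [this, ← Measure.map_map (by fun_prop) (by fun_prop), hc, Measure.map_smul,
    map_add_left_eq_self]

theorem ae_chart (L : (Y × ℝ) ≃L[ℝ] SpaceTime d) (p₀ : SpaceTime d) {P : SpaceTime d → Prop}
    (h : ∀ᵐ p, P p) : ∀ᵐ z ∂μ.prod volume, P (chart L p₀ z) := by
  obtain ⟨c, h0, ht, hc⟩ := exists_map_chart_eq_smul μ L p₀
  refine (measurableEmbedding_chart L p₀).ae_map_iff.1 ?_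
  rw [hc]
  exact Measure.ae_smul_measure h c

theorem memLp_comp_chart (L : (Y × ℝ) ≃L[ℝ] SpaceTime d) (p₀ : SpaceTime d)
    {K : Set (SpaceTime d)} {u : SpaceTime d → ℝ}
    (hu : MemLp u 2 (volume.restrict K)) {Γ : Set Y} {J : Set ℝ}
    (hΓ : ∀ y ∈ Γ, ∀ s ∈ J, chart L p₀ (y, s) ∈ K) :
    MemLp (fun z => u (chart L p₀ z)) 2 ((μ.restrict Γ).prod (volume.restrict J)) := by
  obtain ⟨c, h0, ht, hc⟩ := exists_map_chart_eq_smul μ L p₀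
  have h1 : MemLp (u ∘ chart L p₀) 2 ((μ.prod volume).restrict (chart L p₀ ⁻¹' K)) := by
    rw [← (measurableEmbedding_chart L p₀).memLp_map_measure_iff,
      ← (measurableEmbedding_chart L p₀).restrict_map, hc, Measure.restrict_smul]
    exact hu.smul_measure ht
  rw [Measure.prod_restrict]
  refine h1.mono_measure (Measure.restrict_mono ?_ le_rfl)
  rintro ⟨y, s⟩ ⟨hy, hs⟩
  exact hΓ y hy s hs

/-- Averages do not depend on the constant in `exists_map_chart_eq_smul`. -/
theorem setAverage_chart (L : (Y × ℝ) ≃L[ℝ] SpaceTime d) (p₀ : SpaceTime d)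
    (A : Set (SpaceTime d)) (u : SpaceTime d → ℝ) :
    ⨍ p in A, u p = ⨍ z in chart L p₀ ⁻¹' A, u (chart L p₀ z) ∂(μ.prod volume) := by
  obtain ⟨c, h0, ht, hc⟩ := exists_map_chart_eq_smul μ L p₀
  have he := measurableEmbedding_chart L p₀
  have h1 : ∫ z in chart L p₀ ⁻¹' A, u (chart L p₀ z) ∂(μ.prod volume)
      = c.toReal * ∫ p in A, u p := by
    rw [← he.setIntegral_map, hc, Measure.restrict_smul, integral_smul_measure, smul_eq_mul]
  have h2 : (μ.prod volume).real (chart L p₀ ⁻¹' A) = c.toReal * volume.real A := by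
    rw [measureReal_def, ← he.map_apply, hc]
    simp [measureReal_def]
  have h3 : c.toReal ≠ 0 := ENNReal.toReal_ne_zero.2 ⟨h0, ht⟩
  rw [setAverage_eq, setAverage_eq, h1, h2, smul_eq_mul, smul_eq_mul]
  by_cases h : volume.real A = 0
  · simp [h]
  · field_simp

end Chart

/-! ### Absolutely continuous representatives -/

/-- The Cauchy–Schwarz inequality against the constant function `1`. -/
theorem sq_integral_abs_le {J : Set ℝ} (hJ : volume J ≠ ⊤) {f : ℝ → ℝ}
    (hf : MemLp f 2 (volume.restrict J)) :
    (∫ s in J, |f s|) ^ 2 ≤ volume.real J * ∫ s in J, f s ^ 2 := by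
  have : IsFiniteMeasure (volume.restrict J) := ⟨by simpa using hJ.lt_top⟩
  have h1 : IntegrableOn (fun s => |f s|) J := (hf.integrable one_le_two).abs
  have h2 : IntegrableOn (fun s => f s ^ 2) J := hf.integrable_sq
  set a := ∫ s in J, |f s|
  set b := ∫ s in J, f s ^ 2
  have hb : 0 ≤ b := integral_nonneg fun s => sq_nonneg _
  -- the variance of `|f|`, scaled by the length of `J`, is nonnegative
  have key : ∀ m : ℝ, 0 ≤ b - 2 * m * a + m ^ 2 * volume.real J := by
    intro m
    have : 0 ≤ ∫ s in J, (|f s| - m) ^ 2 := integral_nonneg fun s => sq_nonneg _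
    have e : ∀ s, (|f s| - m) ^ 2 = f s ^ 2 - 2 * m * |f s| + m ^ 2 := fun s => by
      rw [sub_sq, sq_abs]; ring
    simp_rw [e] at this
    rw [integral_add (by exact h2.sub (h1.const_mul _)) (integrable_const _),
      integral_sub h2 (h1.const_mul _), integral_const_mul, integral_const] at this
    simpa [mul_comm] using this
  rcases eq_or_lt_of_le (measureReal_nonneg (μ := volume) (s := J)) with h0 | h0
  · have h00 : volume J = 0 := by
      simpa [measureReal_def, ENNReal.toReal_eq_zero_iff, hJ] using h0.symm
    have : a = 0 := by simp [a, Measure.restrict_eq_zero.2 h00]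
    rw [this, ← h0]; simp
  · have := key (a / volume.real J)
    have e : b - 2 * (a / volume.real J) * a + (a / volume.real J) ^ 2 * volume.real J
        = b - a ^ 2 / volume.real J := by field_simp; ring
    rw [e, sub_nonneg, div_le_iff₀ h0] at this
    linarith

theorem stronglyMeasurable_setIntegral_Ioc {Y : Type*} [MeasurableSpace Y] {E : Y × ℝ → ℝ}
    (hE : StronglyMeasurable E) :
    StronglyMeasurable (fun z : Y × ℝ => ∫ σ in Ioc 0 z.2, E (z.1, σ)) := by
  have : (fun z : Y × ℝ => ∫ σ in Ioc 0 z.2, E (z.1, σ))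
      = fun z => ∫ σ, (if 0 < σ ∧ σ ≤ z.2 then E (z.1, σ) else 0) := by
    ext z
    rw [← integral_indicator measurableSet_Ioc]
    simp only [indicator_apply, mem_Ioc]
  rw [this]
  refine StronglyMeasurable.integral_prod_right
    (f := fun (z : Y × ℝ) (σ : ℝ) => if 0 < σ ∧ σ ≤ z.2 then E (z.1, σ) else 0) ?_
  refine StronglyMeasurable.ite ?_ (hE.comp_measurable (by fun_prop)) stronglyMeasurable_const
  exact (measurableSet_lt (f := fun _ : (Y × ℝ) × ℝ => (0 : ℝ)) (g := fun z => z.2)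
    (by fun_prop) (by fun_prop)).inter (measurableSet_le (f := fun z : (Y × ℝ) × ℝ => z.2)
    (g := fun z => z.1.2) (by fun_prop) (by fun_prop))

section Representative

variable {d : ℕ} {Y : Type*} [NormedAddCommGroup Y] [NormedSpace ℝ Y]
variable [FiniteDimensional ℝ Y] [MeasurableSpace Y] [BorelSpace Y]
variable (μ : Measure Y) [μ.IsAddHaarMeasure]

/-- The form that `IsWeakDeriv.ae_sub_eq_integral` takes in a chart: for a fixed shift `τ`, the
increment of `u` along almost every transversal segment is the integral of its weak derivative `D`.
-/
theorem ae_sub_eq_integral_chart {L : (Y × ℝ) ≃L[ℝ] SpaceTime d} {p₀ : SpaceTime d}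
    {K : Set (SpaceTime d)} (hK : MeasurableSet K) {u D : SpaceTime d → ℝ}
    (hu : IntegrableOn u K) (hD : IntegrableOn D K) (hDm : StronglyMeasurable D)
    (h : IsWeakDeriv K (L (0, 1)) u D) {Γ : Set Y} (hΓ : IsOpen Γ) {δ : ℝ}
    (hΓK : ∀ y ∈ Γ, ∀ s ∈ Ioo 0 δ, chart L p₀ (y, s) ∈ K) (τ : ℝ) :
    ∀ᵐ z ∂μ.prod volume, z.1 ∈ Γ → z.2 ∈ Ioo 0 δ → z.2 + τ ∈ Ioo 0 δ →
      u (chart L p₀ (z.1, z.2 + τ)) - u (chart L p₀ z)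
        = ∫ σ in z.2..(z.2 + τ), D (chart L p₀ (z.1, σ)) := by
  set S : Set (Y × ℝ) := Γ ×ˢ (Ioo 0 δ ∩ (fun s => s + τ) ⁻¹' Ioo 0 δ) with hS
  have hSo : IsOpen S := hΓ.prod (isOpen_Ioo.inter (isOpen_Ioo.preimage (by fun_prop)))
  have hO : IsOpen (chart L p₀ '' S) := (chartHomeo L p₀).isOpenMap _ hSo
  have := IsWeakDeriv.ae_sub_eq_integral hK hO hu (hD.const_mul τ) (hDm.const_mul τ)
    (h.const_smul τ) (by
      rintro _ ⟨⟨y, s⟩, ⟨hy, hs, hs'⟩, rfl⟩ σ hσ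
      rw [smul_smul, chart_add_smul]
      refine hΓK y hy _ ?_
      simp only [mem_preimage, mem_Ioo] at hs hs'
      -- `s + σ τ` lies between `s` and `s + τ`
      have e : s + σ * τ = (1 - σ) * s + σ * (s + τ) := by ring
      rw [e]
      exact (convex_Ioo 0 δ) hs hs' (by linarith [hσ.2]) hσ.1 (by ring))
  filter_upwards [ae_chart μ L p₀ this] with z hz h1 h2 h3
  have e := hz ⟨z, ⟨h1, h2, h3⟩, rfl⟩
  obtain ⟨y, s⟩ := z
  rw [chart_add_smul] at e
  simp only at e ⊢
  rw [e]
  simp_rw [smul_smul, chart_add_smul]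
  rw [integral_const_mul, ← intervalIntegral.integral_of_le zero_le_one]
  have := intervalIntegral.mul_integral_comp_add_mul (a := 0) (b := 1)
    (f := fun σ => D (chart L p₀ (y, σ))) τ s
  simp only [mul_zero, add_zero, mul_one] at this
  rw [← this]
  simp_rw [mul_comm τ]

/-- A function with a weak derivative in `L²` along the transversal direction of a chart has, on
almost every transversal segment, an absolutely continuous representative, whose value at the foot
of the segment is square-integrable. -/
theorem exists_trace_representative {L : (Y × ℝ) ≃L[ℝ] SpaceTime d} {p₀ : SpaceTime d}
    {K : Set (SpaceTime d)} (hK : MeasurableSet K) (hKf : volume K ≠ ⊤) {u D : SpaceTime d → ℝ}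
    (hum : StronglyMeasurable u) (hDm : StronglyMeasurable D)
    (hu : MemLp u 2 (volume.restrict K)) (hD : MemLp D 2 (volume.restrict K))
    (h : IsWeakDeriv K (L (0, 1)) u D) {Γ : Set Y} (hΓ : IsOpen Γ) {δ : ℝ} (hδ : 0 < δ)
    (hΓK : ∀ y ∈ Γ, ∀ s ∈ Ioo 0 δ, chart L p₀ (y, s) ∈ K) :
    ∃ G : Y → ℝ, MemLp G 2 (μ.restrict Γ) ∧ ∀ᵐ y ∂μ, y ∈ Γ →
      IntegrableOn (fun s => D (chart L p₀ (y, s))) (Ioo 0 δ) ∧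
      ∀ᵐ s, s ∈ Ioo 0 δ →
        u (chart L p₀ (y, s)) = G y + ∫ σ in Ioc 0 s, D (chart L p₀ (y, σ)) := by
  have : IsFiniteMeasure (volume.restrict K) := ⟨by simpa using hKf.lt_top⟩
  have hJf : volume (Ioo 0 δ) ≠ ⊤ := by simp
  have : IsFiniteMeasure (volume.restrict (Ioo 0 δ)) := ⟨by simp⟩
  set w : Y × ℝ → ℝ := fun z => u (chart L p₀ z) with hw
  set E : Y × ℝ → ℝ := fun z => D (chart L p₀ z) with hE
  have hwm : StronglyMeasurable w := hum.comp_measurable (continuous_chart L p₀).measurable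
  have hEm : StronglyMeasurable E := hDm.comp_measurable (continuous_chart L p₀).measurable
  have hw2 : MemLp w 2 ((μ.restrict Γ).prod (volume.restrict (Ioo 0 δ))) :=
    memLp_comp_chart μ L p₀ hu hΓK
  have hE2 : MemLp E 2 ((μ.restrict Γ).prod (volume.restrict (Ioo 0 δ))) :=
    memLp_comp_chart μ L p₀ hD hΓK
  have hsec : ∀ f : Y × ℝ → ℝ, StronglyMeasurable f →
      MemLp f 2 ((μ.restrict Γ).prod (volume.restrict (Ioo 0 δ))) →
      ∀ᵐ y ∂μ, y ∈ Γ → MemLp (fun s => f (y, s)) 2 (volume.restrict (Ioo 0 δ)) := by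
    intro f hfm hf
    have := hf.integrable_sq.prod_right_ae
    rw [ae_restrict_iff' hΓ.measurableSet] at this
    filter_upwards [this] with y hy hyΓ
    exact (memLp_two_iff_integrable_sq
      (hfm.comp_measurable measurable_prodMk_left).aestronglyMeasurable).2 (hy hyΓ)
  set I : Y × ℝ → ℝ := fun z => ∫ σ in Ioc 0 z.2, E (z.1, σ) with hI
  have hIm : StronglyMeasurable I := stronglyMeasurable_setIntegral_Ioc hEm
  set g : Y × ℝ → ℝ := fun z => w z - I z with hg
  have hgm : StronglyMeasurable g := hwm.sub hIm
  have hIv : ∀ y, IntegrableOn (fun s => E (y, s)) (Ioo 0 δ) → ∀ s ∈ Ioo 0 δ, ∀ s' ∈ Ioo 0 δ,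
      I (y, s') - I (y, s) = ∫ σ in s..s', E (y, σ) := by
    intro y hy s hs s' hs'
    have ii : ∀ t ∈ Ioo 0 δ, IntervalIntegrable (fun s => E (y, s)) volume 0 t := fun t ht => by
      rw [intervalIntegrable_iff_integrableOn_Ioc_of_le ht.1.le]
      exact hy.mono_set (fun σ hσ => ⟨hσ.1, hσ.2.trans_lt ht.2⟩)
    simp only [hI]
    rw [← intervalIntegral.integral_of_le hs.1.le, ← intervalIntegral.integral_of_le hs'.1.le,
      intervalIntegral.integral_interval_sub_left (ii _ hs') (ii _ hs)]
  -- invariance of `g` under translations in `s`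
  have hinv : ∀ᵐ q : ℝ × (Y × ℝ) ∂(volume.prod (μ.prod volume)), q.2.1 ∈ Γ → q.2.2 ∈ Ioo 0 δ →
      q.2.2 + q.1 ∈ Ioo 0 δ → g (q.2.1, q.2.2 + q.1) = g q.2 := by
    rw [Measure.ae_prod_iff_ae_ae]
    · refine ae_of_all _ fun τ => ?_
      have h1 := ae_sub_eq_integral_chart μ hK (hu.integrable one_le_two)
        (hD.integrable one_le_two) hDm h hΓ hΓK τ
      have h2 : ∀ᵐ z ∂μ.prod (volume : Measure ℝ), z.1 ∈ Γ →
          MemLp (fun s => E (z.1, s)) 2 (volume.restrict (Ioo 0 δ)) :=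
        Measure.quasiMeasurePreserving_fst.ae (hsec E hEm hE2)
      filter_upwards [h1, h2] with z h1 h2 a b c
      have := hIv z.1 ((h2 a).integrable one_le_two) _ b _ c
      have e := h1 a b c
      simp only [hg]
      simp only [hE] at this
      simp only [hw, Prod.mk.eta] at this ⊢
      linarith
    · have m1 : Measurable (fun q : ℝ × (Y × ℝ) => g (q.2.1, q.2.2 + q.1)) :=
        hgm.measurable.comp (by fun_prop)
      have m2 : Measurable (fun q : ℝ × (Y × ℝ) => g q.2) := hgm.measurable.comp (by fun_prop)
      refine MeasurableSet.imp ?_ (MeasurableSet.imp ?_ (MeasurableSet.imp ?_ ?_))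
      · exact hΓ.measurableSet.preimage (by fun_prop : Measurable fun q : ℝ × (Y × ℝ) => q.2.1)
      · exact measurableSet_Ioo.preimage (by fun_prop : Measurable fun q : ℝ × (Y × ℝ) => q.2.2)
      · exact measurableSet_Ioo.preimage
          (by fun_prop : Measurable fun q : ℝ × (Y × ℝ) => q.2.2 + q.1)
      · exact measurableSet_eq_fun m1 m2
  have hconst : ∀ᵐ y ∂μ, y ∈ Γ → ∃ c, ∀ᵐ s, s ∈ Ioo 0 δ → g (y, s) = c := by
    have h1 : ∀ᵐ z ∂(μ.prod (volume : Measure ℝ)), ∀ᵐ τ : ℝ, z.1 ∈ Γ → z.2 ∈ Ioo 0 δ →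
        z.2 + τ ∈ Ioo 0 δ → g (z.1, z.2 + τ) = g z :=
      Measure.ae_ae_of_ae_prod (Measure.measurePreserving_swap.quasiMeasurePreserving.ae hinv)
    filter_upwards [Measure.ae_ae_of_ae_prod h1] with y hy hyΓ
    have : ∃ s ∈ Ioo 0 δ, ∀ᵐ τ : ℝ, y ∈ Γ → s ∈ Ioo 0 δ →
        s + τ ∈ Ioo 0 δ → g (y, s + τ) = g (y, s) := by
      by_contra hcon
      have h0 : volume (Ioo 0 δ) = 0 :=
        measure_mono_null (fun s hs hs' => hcon ⟨s, hs, hs'⟩) hy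
      simp [hδ.not_ge] at h0
    obtain ⟨s, hs, hs'⟩ := this
    refine ⟨g (y, s), ?_⟩
    have := (measurePreserving_sub_right volume s).quasiMeasurePreserving.ae hs'
    filter_upwards [this] with t ht htδ
    simpa using ht hyΓ hs (by simpa using htδ)
  refine ⟨fun y => δ⁻¹ * ∫ s in Ioo 0 δ, g (y, s), ?_⟩
  have hG : ∀ᵐ y ∂μ, y ∈ Γ → ∀ᵐ s, s ∈ Ioo 0 δ → g (y, s) = δ⁻¹ * ∫ s in Ioo 0 δ, g (y, s) := by
    filter_upwards [hconst] with y hy hyΓ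
    obtain ⟨c, hc⟩ := hy hyΓ
    have : ∫ s in Ioo 0 δ, g (y, s) = δ * c := by
      rw [setIntegral_congr_ae (g := fun _ => c) measurableSet_Ioo hc]
      simp [hδ.le]
    filter_upwards [hc] with s hs hsδ
    rw [hs hsδ, this, inv_mul_cancel_left₀ hδ.ne']
  constructor
  · have hGm : StronglyMeasurable (fun y => δ⁻¹ * ∫ s in Ioo 0 δ, g (y, s)) :=
      (StronglyMeasurable.integral_prod_right (f := fun y s => g (y, s)) hgm).const_mul _
    rw [memLp_two_iff_integrable_sq hGm.aestronglyMeasurable]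
    have b1 := hw2.integrable_sq.integral_prod_left
    have b2 := hE2.integrable_sq.integral_prod_left
    refine ((b1.const_mul (2 * δ⁻¹)).add (b2.const_mul (2 * δ))).mono'
      (hGm.pow 2).aestronglyMeasurable ?_
    rw [ae_restrict_iff' hΓ.measurableSet]
    filter_upwards [hG, hsec E hEm hE2, hsec w hwm hw2] with y h1 h2 h3 hy
    specialize h1 hy
    specialize h2 hy
    specialize h3 hy
    set c := δ⁻¹ * ∫ s in Ioo 0 δ, g (y, s)
    have hb : ∀ s ∈ Ioo 0 δ, I (y, s) ^ 2 ≤ δ * ∫ σ in Ioo 0 δ, E (y, σ) ^ 2 := by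
      intro s hs
      have h4 := sq_integral_abs_le hJf h2
      have e : volume.real (Ioo 0 δ) = δ := by simp [hδ.le]
      rw [e] at h4
      refine le_trans ?_ h4
      rw [← sq_abs (I (y, s))]
      gcongr
      calc |I (y, s)| ≤ ∫ σ in Ioc 0 s, |E (y, σ)| := abs_integral_le_integral_abs
        _ ≤ ∫ σ in Ioo 0 δ, |E (y, σ)| :=
          setIntegral_mono_set (h2.integrable one_le_two).abs (ae_of_all _ fun σ => abs_nonneg _)
            (ae_of_all _ fun σ hσ => ⟨hσ.1, hσ.2.trans_lt hs.2⟩)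
    have hc2 : ∀ᵐ s, s ∈ Ioo 0 δ →
        c ^ 2 ≤ 2 * w (y, s) ^ 2 + 2 * (δ * ∫ σ in Ioo 0 δ, E (y, σ) ^ 2) := by
      filter_upwards [h1] with s hs hsδ
      have e : w (y, s) - I (y, s) = c := hs hsδ
      rw [← e]
      nlinarith [hb s hsδ, sq_nonneg (w (y, s) + I (y, s))]
    have hi : ∫ s in Ioo 0 δ, c ^ 2
        ≤ ∫ s in Ioo 0 δ, (2 * w (y, s) ^ 2 + 2 * (δ * ∫ σ in Ioo 0 δ, E (y, σ) ^ 2)) :=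
      setIntegral_mono_on_ae (integrable_const _)
        ((h3.integrable_sq.const_mul 2).add (integrable_const _)) measurableSet_Ioo hc2
    rw [integral_add (h3.integrable_sq.const_mul 2) (integrable_const _), integral_const_mul] at hi
    simp only [integral_const, MeasurableSet.univ, measureReal_restrict_apply, univ_inter,
      Real.volume_real_Ioo_of_le hδ.le, sub_zero, smul_eq_mul] at hi
    rw [Real.norm_of_nonneg (sq_nonneg _)]
    simp only [Pi.add_apply]
    have : c ^ 2 = δ⁻¹ * (δ * c ^ 2) := by field_simp
    rw [this]
    refine (mul_le_mul_of_nonneg_left hi (by positivity)).trans (le_of_eq ?_)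
    field_simp
  · filter_upwards [hG, hsec E hEm hE2] with y h1 h2 hy
    refine ⟨(h2 hy).integrable one_le_two, ?_⟩
    filter_upwards [h1 hy] with s hs hsδ
    have := hs hsδ
    rw [← this]
    simp [hg, hw, hI, hE]

end Representative

/-! ### Existence of traces -/

/-- The averages over `K ∩ B(p, r)` converge as `r → 0`, so that `trace K w p` is their limit. -/
def HasTraceAt {d : ℕ} {F : Type*} [NormedAddCommGroup F] [NormedSpace ℝ F]
    (K : Set (SpaceTime d)) (w : SpaceTime d → F) (p : SpaceTime d) (l : F) : Prop :=
  Tendsto (fun r => ⨍ z in K ∩ Metric.ball p r, w z) (𝓝[>] (0 : ℝ)) (𝓝 l)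

theorem HasTraceAt.trace_eq {d : ℕ} {F : Type*} [NormedAddCommGroup F] [NormedSpace ℝ F]
    {K : Set (SpaceTime d)} {w : SpaceTime d → F} {p : SpaceTime d} {l : F}
    (h : HasTraceAt K w p l) : trace K w p = l :=
  Tendsto.limUnder_eq h

theorem abs_setAverage_sub_le {X : Type*} [MeasurableSpace X] {μ : Measure X} {A : Set X}
    (h0 : μ A ≠ 0) (ht : μ A ≠ ⊤) {f : X → ℝ} (hf : IntegrableOn f A μ) (a : ℝ) :
    |⨍ x in A, f x ∂μ - a| ≤ (μ.real A)⁻¹ * ∫ x in A, |f x - a| ∂μ := by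
  have hA : μ.real A ≠ 0 := (measureReal_ne_zero_iff ht).2 h0
  have : IsFiniteMeasure (μ.restrict A) := ⟨by simpa using ht.lt_top⟩
  have e : ⨍ x in A, f x ∂μ - a = (μ.real A)⁻¹ * ∫ x in A, (f x - a) ∂μ := by
    rw [setAverage_eq, integral_sub hf (integrable_const _)]
    simp only [smul_eq_mul, integral_const, measureReal_restrict_apply_univ]
    field_simp
  rw [e, abs_mul, abs_of_nonneg (inv_nonneg.2 measureReal_nonneg)]
  gcongr
  exact abs_integral_le_integral_abs

section

variable {d : ℕ} {Y : Type*} [NormedAddCommGroup Y] [NormedSpace ℝ Y]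
variable [FiniteDimensional ℝ Y] [MeasurableSpace Y] [BorelSpace Y]
variable (μ : Measure Y) [μ.IsAddHaarMeasure]

/-- The averages of `u` over `K ∩ B(p, r)` at a boundary point `p = chart (y, 0)`, near which `K` is
the half-space `s > 0` of the chart, are controlled by averages over balls of `Y` of a function
`F` that dominates `u - a` on the transversal segments. -/
theorem exists_abs_setAverage_sub_le {L : (Y × ℝ) ≃L[ℝ] SpaceTime d} {p₀ : SpaceTime d}
    {K : Set (SpaceTime d)} {u : SpaceTime d → ℝ} (hu : IntegrableOn u K) {y : Y}
    (hloc : ∀ᶠ z in 𝓝 (y, (0 : ℝ)), chart L p₀ z ∈ K ↔ 0 < z.2) :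
    ∃ B > 0, ∃ C ≥ 0, ∀ a : ℝ, ∀ F : Y → ℝ, LocallyIntegrable F μ → (∀ z, 0 ≤ F z) →
      (∃ U ∈ 𝓝 y, ∃ δ > 0, ∀ᵐ z ∂μ.prod volume, z.1 ∈ U → z.2 ∈ Ioo 0 δ →
        |u (chart L p₀ z) - a| ≤ F z.1) →
      ∀ᶠ r in 𝓝[>] (0 : ℝ), |(⨍ p in K ∩ Metric.ball (chart L p₀ (y, 0)) r, u p) - a|
        ≤ C * ⨍ y' in Metric.closedBall y (B * r), F y' ∂μ := by
  set A : ℝ := ‖(L : (Y × ℝ) →L[ℝ] SpaceTime d)‖ + 1 with hA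
  set B : ℝ := ‖(L.symm : SpaceTime d →L[ℝ] (Y × ℝ))‖ + 1 with hB
  have hA0 : 0 < A := by positivity
  have hB0 : 0 < B := by positivity
  have hdA : ∀ z z', dist (chart L p₀ z) (chart L p₀ z') ≤ A * dist z z' := by
    intro z z'
    rw [dist_eq_norm, dist_eq_norm, chart, chart, add_sub_add_left_eq_sub, ← map_sub]
    refine ((L : (Y × ℝ) →L[ℝ] SpaceTime d).le_opNorm _).trans ?_
    gcongr; linarith
  have hdB : ∀ z z', dist z z' ≤ B * dist (chart L p₀ z) (chart L p₀ z') := by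
    intro z z'
    rw [dist_eq_norm, dist_eq_norm, chart, chart, add_sub_add_left_eq_sub, ← map_sub]
    have := (L.symm : SpaceTime d →L[ℝ] (Y × ℝ)).le_opNorm (L (z - z'))
    simp only [ContinuousLinearEquiv.coe_coe, ContinuousLinearEquiv.symm_apply_apply] at this
    refine this.trans ?_
    gcongr; linarith
  set n := Module.finrank ℝ Y with hn
  set m := μ.real (Metric.ball 0 1) with hm
  have hm0 : 0 < m := by
    rw [hm, measureReal_def]
    exact ENNReal.toReal_pos (Metric.measure_ball_pos μ _ one_pos).ne' measure_ball_lt_top.ne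
  refine ⟨B, hB0, (B * A) ^ (n + 1), by positivity, ?_⟩
  rintro a F hF hF0 ⟨U, hU, δ, hδ, hFu⟩
  obtain ⟨ε, hε, hεloc⟩ := Metric.eventually_nhds_iff.1 hloc
  obtain ⟨ε', hε', hεU⟩ := Metric.mem_nhds_iff.1 hU
  have hev : ∀ᶠ r in 𝓝[>] (0 : ℝ), 0 < r ∧ B * r < ε ∧ B * r < ε' ∧ B * r < δ ∧ r / A < ε := by
    have t1 : Tendsto (fun r : ℝ => B * r) (𝓝[>] 0) (𝓝 0) := by
      have : Continuous (fun r : ℝ => B * r) := by fun_prop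
      simpa using (this.tendsto 0).mono_left nhdsWithin_le_nhds
    have t2 : Tendsto (fun r : ℝ => r / A) (𝓝[>] 0) (𝓝 0) := by
      have : Continuous (fun r : ℝ => r / A) := by fun_prop
      simpa using (this.tendsto 0).mono_left nhdsWithin_le_nhds
    filter_upwards [self_mem_nhdsWithin, t1.eventually_lt_const hε, t1.eventually_lt_const hε',
      t1.eventually_lt_const hδ, t2.eventually_lt_const hε] with r h1 h2 h3 h4 h5
    exact ⟨h1, h2, h3, h4, h5⟩
  filter_upwards [hev] with r ⟨hr, hr1, hr2, hr3, hr4⟩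
  rw [setAverage_chart μ L p₀]
  set p := chart L p₀ (y, 0) with hp
  set S := chart L p₀ ⁻¹' (K ∩ Metric.ball p r) with hS
  -- the preimage of `K ∩ B(p, r)` lies between two cylinders of size comparable to `r`
  have hSsub : S ⊆ Metric.closedBall y (B * r) ×ˢ Ioc 0 (B * r) := by
    rintro z ⟨hzK, hzb⟩
    have h1 : dist z (y, 0) < B * r :=
      (hdB z (y, 0)).trans_lt (mul_lt_mul_of_pos_left hzb hB0)
    have h2 : 0 < z.2 := (hεloc (h1.trans hr1)).1 hzK
    rw [Prod.dist_eq, max_lt_iff] at h1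
    refine ⟨h1.1.le, h2, ?_⟩
    have := h1.2
    simp only [dist_zero_right, Real.norm_eq_abs] at this
    exact (le_abs_self _).trans this.le
  have hsub : Metric.ball y (r / A) ×ˢ Ioo 0 (r / A) ⊆ S := by
    rintro z ⟨hz1, hz2⟩
    have h1 : dist z (y, 0) < r / A := by
      rw [Prod.dist_eq, max_lt_iff]
      refine ⟨hz1, ?_⟩
      simp only [dist_zero_right, Real.norm_eq_abs]
      rw [abs_of_pos hz2.1]
      exact hz2.2
    refine ⟨(hεloc (h1.trans hr4)).2 hz2.1, ?_⟩
    refine (hdA z (y, 0)).trans_lt ?_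
    rw [mul_comm]
    exact (lt_div_iff₀ hA0).1 h1
  have hcyl : (μ.prod volume) (Metric.closedBall y (B * r) ×ˢ Ioc 0 (B * r)) ≠ ⊤ := by
    rw [Measure.prod_prod]
    exact ENNReal.mul_ne_top measure_closedBall_lt_top.ne (by simp)
  have hSt : (μ.prod volume) S ≠ ⊤ := ne_top_of_le_ne_top hcyl (measure_mono hSsub)
  have hvol : (r / A) ^ (n + 1) * m ≤ (μ.prod volume).real S := by
    have e : (μ.prod volume).real (Metric.ball y (r / A) ×ˢ Ioo 0 (r / A))
        = (r / A) ^ (n + 1) * m := by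
      rw [measureReal_prod_prod, measureReal_def μ, Measure.addHaar_ball_of_pos μ y (by positivity)]
      rw [ENNReal.toReal_mul, ENNReal.toReal_ofReal (by positivity), ← measureReal_def,
        Real.volume_real_Ioo_of_le (by positivity)]
      rw [← hn, ← hm]; ring
    rw [← e]
    exact measureReal_mono hsub hSt
  have hvpos : 0 < (μ.prod volume).real S := lt_of_lt_of_le (by positivity) hvol
  have hcb : μ.real (Metric.closedBall y (B * r)) = (B * r) ^ n * m := by
    rw [measureReal_def, Measure.addHaar_closedBall μ y (by positivity), ENNReal.toReal_mul,
      ENNReal.toReal_ofReal (by positivity), ← measureReal_def]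
  have hSi : IntegrableOn (fun z => u (chart L p₀ z)) S (μ.prod volume) := by
    obtain ⟨c, h0, ht, hc⟩ := exists_map_chart_eq_smul μ L p₀
    have := (measurableEmbedding_chart L p₀).integrableOn_map_iff (μ := μ.prod volume) (f := u)
      (s := K ∩ Metric.ball p r)
    rw [hc] at this
    refine this.1 ?_
    rw [IntegrableOn, Measure.restrict_smul]
    exact (hu.mono_set inter_subset_left).smul_measure ht
  have hFc : IntegrableOn F (Metric.closedBall y (B * r)) μ :=
    hF.integrableOn_isCompact (isCompact_closedBall _ _)
  have hFp : IntegrableOn (fun z : Y × ℝ => F z.1)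
      (Metric.closedBall y (B * r) ×ˢ Ioc 0 (B * r)) (μ.prod volume) := by
    have : IsFiniteMeasure (volume.restrict (Ioc 0 (B * r))) := ⟨by simp⟩
    rw [IntegrableOn, ← Measure.prod_restrict]
    exact Integrable.comp_fst hFc _
  have hSm : MeasurableSet (Metric.closedBall y (B * r) ×ˢ Ioc 0 (B * r)) :=
    Metric.isClosed_closedBall.measurableSet.prod measurableSet_Ioc
  have hint : ∫ z in S, |u (chart L p₀ z) - a| ∂(μ.prod volume)
      ≤ (B * r) * ∫ y' in Metric.closedBall y (B * r), F y' ∂μ := by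
    have hSi' : IntegrableOn (fun z => |u (chart L p₀ z) - a|) S (μ.prod volume) := by
      have : IsFiniteMeasure ((μ.prod volume).restrict S) := ⟨by simpa using hSt.lt_top⟩
      exact (Integrable.sub hSi (integrable_const a)).abs
    calc ∫ z in S, |u (chart L p₀ z) - a| ∂(μ.prod volume)
        ≤ ∫ z in S, F z.1 ∂(μ.prod volume) := by
          refine integral_mono_ae hSi' (hFp.mono_set hSsub) ?_
          refine ae_restrict_of_ae_restrict_of_subset hSsub ?_
          refine (ae_restrict_iff' hSm).2 ?_
          filter_upwards [hFu] with z hz hzm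
          exact hz (hεU (lt_of_le_of_lt hzm.1 hr2)) ⟨hzm.2.1, hzm.2.2.trans_lt hr3⟩
      _ ≤ ∫ z in Metric.closedBall y (B * r) ×ˢ Ioc 0 (B * r), F z.1 ∂(μ.prod volume) :=
          setIntegral_mono_set hFp (ae_of_all _ fun z => hF0 z.1) (ae_of_all _ hSsub)
      _ = (B * r) * ∫ y' in Metric.closedBall y (B * r), F y' ∂μ := by
          have := setIntegral_prod_mul (μ := μ) (ν := volume) F (fun _ : ℝ => (1 : ℝ))
            (Metric.closedBall y (B * r)) (Ioc 0 (B * r))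
          simp only [mul_one] at this
          have hBr : 0 ≤ B * r := by positivity
          have e : ∫ _ in Ioc 0 (B * r), (1 : ℝ) = B * r := by simp [hBr]
          rw [this, e, mul_comm]
  have h00 : (μ.prod volume) S ≠ 0 := fun h => hvpos.ne' (by simp [measureReal_def, h])
  refine (abs_setAverage_sub_le h00 hSt hSi a).trans ?_
  have hI0 : 0 ≤ ∫ y' in Metric.closedBall y (B * r), F y' ∂μ := integral_nonneg hF0
  calc ((μ.prod volume).real S)⁻¹ * ∫ z in S, |u (chart L p₀ z) - a| ∂(μ.prod volume)
      ≤ ((r / A) ^ (n + 1) * m)⁻¹ * ((B * r) * ∫ y' in Metric.closedBall y (B * r), F y' ∂μ) := by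
        gcongr
    _ = (B * A) ^ (n + 1) * ⨍ y' in Metric.closedBall y (B * r), F y' ∂μ := by
        rw [setAverage_eq, hcb, smul_eq_mul, div_pow, mul_pow, mul_pow]
        field_simp
        ring

/-- The value at the foot of the segments of an absolutely continuous representative is the limit
of the averages, at almost every point of the facet. -/
theorem ae_hasTraceAt_chart {L : (Y × ℝ) ≃L[ℝ] SpaceTime d} {p₀ : SpaceTime d}
    {K : Set (SpaceTime d)} (hKf : volume K ≠ ⊤) {u D : SpaceTime d → ℝ}
    (hum : StronglyMeasurable u) (hDm : StronglyMeasurable D)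
    (hu : MemLp u 2 (volume.restrict K)) (hD : MemLp D 2 (volume.restrict K))
    {Γ : Set Y} (hΓ : IsOpen Γ) (hΓf : μ Γ ≠ ⊤) {δ : ℝ} (hδ : 0 < δ)
    (hΓK : ∀ y ∈ Γ, ∀ s ∈ Ioo 0 δ, chart L p₀ (y, s) ∈ K)
    (hloc : ∀ y ∈ Γ, ∀ᶠ z in 𝓝 (y, (0 : ℝ)), chart L p₀ z ∈ K ↔ 0 < z.2)
    {G : Y → ℝ} (hG : MemLp G 2 (μ.restrict Γ))
    (hrep : ∀ᵐ y ∂μ, y ∈ Γ → IntegrableOn (fun s => D (chart L p₀ (y, s))) (Ioo 0 δ) ∧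
      ∀ᵐ s, s ∈ Ioo 0 δ →
        u (chart L p₀ (y, s)) = G y + ∫ σ in Ioc 0 s, D (chart L p₀ (y, σ))) :
    ∀ᵐ y ∂μ, y ∈ Γ → HasTraceAt K u (chart L p₀ (y, 0)) (G y) := by
  have : IsFiniteMeasure (volume.restrict K) := ⟨by simpa using hKf.lt_top⟩
  have : IsFiniteMeasure (μ.restrict Γ) := ⟨by simpa using hΓf.lt_top⟩
  have : IsFiniteMeasure (volume.restrict (Ioo 0 δ)) := ⟨by simp⟩
  set E : Y × ℝ → ℝ := fun z => D (chart L p₀ z) with hE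
  have hEm : StronglyMeasurable E := hDm.comp_measurable (continuous_chart L p₀).measurable
  have hE1 : Integrable E ((μ.restrict Γ).prod (volume.restrict (Ioo 0 δ))) :=
    (memLp_comp_chart μ L p₀ hD hΓK).integrable one_le_two
  set δn : ℕ → ℝ := fun n => δ / (n + 1) with hδn
  have hδn0 : ∀ n, 0 < δn n := fun n => by positivity
  have hδnle : ∀ n, δn n ≤ δ := fun n => div_le_self hδ.le (by linarith [n.cast_nonneg (α := ℝ)])
  set h : ℕ → Y → ℝ := fun n => Γ.indicator fun y => ∫ σ in Ioo 0 (δn n), |E (y, σ)| with hh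
  have hh0 : ∀ n y, 0 ≤ h n y := fun n y =>
    indicator_nonneg (fun _ _ => integral_nonneg fun _ => abs_nonneg _) _
  have hhi : ∀ n, Integrable (h n) μ := by
    intro n
    rw [hh, integrable_indicator_iff hΓ.measurableSet]
    have : Integrable E ((μ.restrict Γ).prod (volume.restrict (Ioo 0 (δn n)))) := by
      refine hE1.mono_measure ?_
      rw [Measure.prod_restrict, Measure.prod_restrict]
      exact Measure.restrict_mono (prod_mono le_rfl (Ioo_subset_Ioo_right (hδnle n))) le_rfl
    exact this.abs.integral_prod_left
  set G' := Γ.indicator G with hG'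
  have hG'l : LocallyIntegrable G' μ := by
    have : Integrable G' μ := (integrable_indicator_iff hΓ.measurableSet).2
      (hG.integrable one_le_two)
    exact this.locallyIntegrable
  have hrep' : ∀ n, ∀ᵐ z ∂μ.prod (volume : Measure ℝ), z.1 ∈ Γ → z.2 ∈ Ioo 0 (δn n) →
      |u (chart L p₀ z) - G' z.1| ≤ h n z.1 := by
    have hone : ∀ᵐ z ∂μ.prod (volume : Measure ℝ), z.1 ∈ Γ → z.2 ∈ Ioo 0 δ →
        u (chart L p₀ z) - G' z.1 = ∫ σ in Ioc 0 z.2, E (z.1, σ) := by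
      have hGae : ∃ H : Y → ℝ, StronglyMeasurable H ∧ ∀ᵐ y ∂μ, y ∈ Γ → G y = H y := by
        obtain ⟨H, hH, hGH⟩ := hG.1
        refine ⟨H, hH, ?_⟩
        rwa [EventuallyEq, ae_restrict_iff' hΓ.measurableSet] at hGH
      obtain ⟨H, hH, hGH⟩ := hGae
      have hIm := stronglyMeasurable_setIntegral_Ioc hEm
      have hmain : ∀ᵐ z ∂μ.prod (volume : Measure ℝ), z.1 ∈ Γ → z.2 ∈ Ioo 0 δ →
          u (chart L p₀ z) - H z.1 = ∫ σ in Ioc 0 z.2, E (z.1, σ) := by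
        rw [Measure.ae_prod_iff_ae_ae]
        · filter_upwards [hrep, hGH] with y hy hy'
          by_cases hyΓ : y ∈ Γ
          · filter_upwards [(hy hyΓ).2] with s hs _ hsδ
            rw [hs hsδ, ← hy' hyΓ]
            simp [hE]
          · exact ae_of_all _ fun s hs => absurd hs hyΓ
        · refine MeasurableSet.imp (hΓ.measurableSet.preimage measurable_fst)
            (MeasurableSet.imp (measurableSet_Ioo.preimage measurable_snd) ?_)
          exact measurableSet_eq_fun ((hum.measurable.comp (continuous_chart L p₀).measurable).sub
            (hH.measurable.comp measurable_fst)) hIm.measurable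
      have hGH' : ∀ᵐ z ∂μ.prod (volume : Measure ℝ), z.1 ∈ Γ → G z.1 = H z.1 :=
        Measure.quasiMeasurePreserving_fst.ae hGH
      filter_upwards [hmain, hGH'] with z h1 h2 h3 h4
      rw [hG', indicator_of_mem h3, h2 h3]
      exact h1 h3 h4
    have hsec : ∀ᵐ z ∂μ.prod (volume : Measure ℝ), z.1 ∈ Γ →
        IntegrableOn (fun s => E (z.1, s)) (Ioo 0 δ) := by
      have : ∀ᵐ y ∂μ, y ∈ Γ → IntegrableOn (fun s => E (y, s)) (Ioo 0 δ) := by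
        filter_upwards [hrep] with y hy hyΓ using (hy hyΓ).1
      exact Measure.quasiMeasurePreserving_fst.ae this
    intro n
    filter_upwards [hone, hsec] with z h1 h2 hz hzn
    rw [h1 hz ⟨hzn.1, hzn.2.trans_le (hδnle n)⟩, hh]
    simp only
    rw [indicator_of_mem hz]
    refine abs_integral_le_integral_abs.trans ?_
    exact setIntegral_mono_set
      ((h2 hz).mono_set (Ioo_subset_Ioo_right (hδnle n))).abs
      (ae_of_all _ fun σ => abs_nonneg _) (ae_of_all _ fun σ hσ => ⟨hσ.1, hσ.2.trans_lt hzn.2⟩)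
  have hlim : ∀ᵐ y ∂μ, y ∈ Γ → Tendsto (fun n => h n y) atTop (𝓝 0) := by
    filter_upwards [hrep] with y hy hyΓ
    have hyi : IntegrableOn (fun s => E (y, s)) (Ioo 0 δ) := (hy hyΓ).1
    have := tendsto_setIntegral_of_antitone (μ := volume) (f := fun s => |E (y, s)|)
      (s := fun n => Ioo 0 (δn n)) (fun n => measurableSet_Ioo)
      (by
        intro a b hab
        refine Ioo_subset_Ioo_right ?_
        simp only [hδn]
        gcongr)
      ⟨0, by
        have := hyi.abs
        simpa [hδn, IntegrableOn] using this⟩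
    have hempty : ⋂ n, Ioo 0 (δn n) = ∅ := by
      rw [eq_empty_iff_forall_notMem]
      intro s hs
      rw [mem_iInter] at hs
      obtain ⟨n, hn⟩ := exists_nat_gt (δ / s)
      have h1 := (hs n).2
      have h0 := (hs n).1
      rw [div_lt_iff₀ h0] at hn
      simp only [hδn] at h1
      rw [lt_div_iff₀ (by positivity)] at h1
      nlinarith
    rw [hempty] at this
    simpa [hh, hyΓ] using this
  have hG'a : ∀ c : ℝ, LocallyIntegrable (fun y => |G' y - c|) μ := fun c x =>
    ((hG'l.sub (locallyIntegrable_const c)) x).norm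
  have hLeb := IsUnifLocDoublingMeasure.ae_tendsto_average_norm_sub μ hG'l 1
  have hLebn : ∀ᵐ y ∂μ, ∀ n, ∀ {ι : Type} {l : Filter ι} (w : ι → Y) (ρ : ι → ℝ)
      (_ : Tendsto ρ l (𝓝[>] 0)) (_ : ∀ᶠ j in l, y ∈ Metric.closedBall (w j) (1 * ρ j)),
      Tendsto (fun j => ⨍ y' in Metric.closedBall (w j) (ρ j), h n y' ∂μ) l (𝓝 (h n y)) :=
    ae_all_iff.2 fun n =>
      IsUnifLocDoublingMeasure.ae_tendsto_average μ (hhi n).locallyIntegrable 1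
  filter_upwards [hlim, hLeb, hLebn] with y h1 h2 h3 hy
  obtain ⟨B, hB, C, hC, hBC⟩ := exists_abs_setAverage_sub_le μ (hu.integrable one_le_two)
    (hloc y hy)
  have hρ : Tendsto (fun r : ℝ => B * r) (𝓝[>] 0) (𝓝[>] 0) := by
    refine tendsto_nhdsWithin_iff.2 ⟨?_, ?_⟩
    · have : Continuous (fun r : ℝ => B * r) := by fun_prop
      simpa using (this.tendsto 0).mono_left nhdsWithin_le_nhds
    · filter_upwards [self_mem_nhdsWithin] with r hr using mul_pos hB hr
  have hself : ∀ᶠ r in 𝓝[>] (0 : ℝ), y ∈ Metric.closedBall y (1 * (B * r)) := by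
    filter_upwards [self_mem_nhdsWithin] with r hr
    exact Metric.mem_closedBall_self (by have := mul_pos hB hr; linarith)
  have hyG : G' y = G y := indicator_of_mem hy _
  rw [HasTraceAt, Metric.tendsto_nhds]
  intro ε hε
  obtain ⟨n, hn⟩ := ((h1 hy).const_mul C).eventually_lt_const
    (by simpa using hε : C * 0 < ε) |>.exists
  have h4 := h2 (fun _ => y) (fun r => B * r) hρ hself
  have h5 := h3 n (fun _ => y) (fun r => B * r) hρ hself
  have h6 := ((h4.add h5).const_mul C).eventually_lt_const (by simpa using hn)
  have h7 := hBC (G' y) (fun y' => |G' y' - G' y| + h n y')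
    (LocallyIntegrable.add (hG'a _) (hhi n).locallyIntegrable)
    (fun z => add_nonneg (abs_nonneg _) (hh0 n z))
    ⟨Γ, hΓ.mem_nhds hy, δn n, hδn0 n, by
      filter_upwards [hrep' n] with z hz a b
      have := hz a b
      have t := abs_sub_le (u (chart L p₀ z)) (G' z.1) (G' y)
      linarith⟩
  filter_upwards [h6, h7] with r h6 h7
  rw [Real.dist_eq, ← hyG]
  refine h7.trans_lt (lt_of_eq_of_lt ?_ h6)
  congr 1
  rw [setAverage_eq, setAverage_eq, setAverage_eq, integral_add]
  · simp [mul_add]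
  · exact (hG'a _).integrableOn_isCompact (isCompact_closedBall _ _)
  · exact (hhi n).integrableOn

end

/-! ### Hyperplane arrangements -/

/-- Here `{x | ⟪a, x⟫ = b}` is a hyperplane if `a ≠ 0`, and empty if `a = 0 ≠ b`. -/
theorem addHaar_hyperplane {E : Type*} [NormedAddCommGroup E] [InnerProductSpace ℝ E]
    [FiniteDimensional ℝ E] [MeasurableSpace E] [BorelSpace E] (μ : Measure E)
    [μ.IsAddHaarMeasure] {a : E} {b : ℝ} (h : a ≠ 0 ∨ b ≠ 0) :
    μ {x | inner ℝ a x = b} = 0 := by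
  by_cases ha : a = 0
  · have hb : b ≠ 0 := by tauto
    have : {x : E | inner ℝ a x = b} = ∅ := by
      ext x; simp [ha, hb.symm]
    rw [this, measure_empty]
  · set x₀ : E := (b / ‖a‖ ^ 2) • a with hx₀
    have hn : ‖a‖ ^ 2 ≠ 0 := by positivity
    have h0 : inner ℝ a x₀ = b := by
      rw [hx₀, inner_smul_right, real_inner_self_eq_norm_sq]; field_simp
    have e : {x | inner ℝ a x = b} = (AffineSubspace.mk' x₀ (Submodule.span ℝ {a})ᗮ : Set E) := by
      ext x
      rw [SetLike.mem_coe, AffineSubspace.mem_mk', Submodule.mem_orthogonal_singleton_iff_inner_right,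
        vsub_eq_sub, inner_sub_right, h0, mem_ofPred_eq, sub_eq_zero]
    rw [e]
    refine Measure.addHaar_affineSubspace μ _ fun htop => ?_
    have : x₀ + a ∈ AffineSubspace.mk' x₀ (Submodule.span ℝ {a})ᗮ := by rw [htop]; trivial
    rw [AffineSubspace.mem_mk', Submodule.mem_orthogonal_singleton_iff_inner_right, vsub_eq_sub,
      add_sub_cancel_left, real_inner_self_eq_norm_sq] at this
    exact hn this

/-- The sign encoded by a Boolean. -/
def sgn (b : Bool) : ℝ := if b then 1 else -1

theorem sgn_not (b : Bool) : sgn (!b) = -sgn b := by cases b <;> simp [sgn]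

theorem sgn_mul_self (b : Bool) : sgn b * sgn b = 1 := by cases b <;> simp [sgn]

theorem abs_sgn (b : Bool) : |sgn b| = 1 := by cases b <;> simp [sgn]

theorem exists_sgn_mul_pos {x : ℝ} (hx : x ≠ 0) : ∃ b, 0 < sgn b * x := by
  rcases lt_or_gt_of_ne hx with h | h
  · exact ⟨false, by simpa [sgn] using h⟩
  · exact ⟨true, by simpa [sgn] using h⟩

/-- A family of pairwise distinct affine hyperplanes `{x | ⟪normal k, x⟫ = offset k}`. -/
structure Arrangement (d : ℕ) (ι : Type) where
  normal : ι → Space d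
  offset : ι → ℝ
  norm_normal : ∀ k, ‖normal k‖ = 1
  injective : Function.Injective fun k => {x : Space d | inner ℝ (normal k) x - offset k = 0}

namespace Arrangement

variable {d : ℕ} {ι : Type} (A : Arrangement d ι)

/-- The affine form vanishing on the `k`-th hyperplane. -/
noncomputable def form (k : ι) (x : Space d) : ℝ := inner ℝ (A.normal k) x - A.offset k

/-- The `k`-th hyperplane. -/
def plane (k : ι) : Set (Space d) := {x | A.form k x = 0}

/-- The open cell of points with the signs `σ`. -/
def cell (σ : ι → Bool) : Set (Space d) := {x | ∀ k, 0 < sgn (σ k) * A.form k x}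

/-- The relatively open facet of `cell σ` in the `k`-th hyperplane; it does not depend on `σ k`. -/
def face (k : ι) (σ : ι → Bool) : Set (Space d) :=
  {x | A.form k x = 0 ∧ ∀ j, j ≠ k → 0 < sgn (σ j) * A.form j x}

theorem continuous_form (k : ι) : Continuous (A.form k) := by
  unfold form; fun_prop

theorem form_add (k : ι) (x y : Space d) :
    A.form k (x + y) = A.form k x + inner ℝ (A.normal k) y := by
  simp only [form, inner_add_right]; ring

theorem form_add_smul_sub (k : ι) (x y : Space d) (s : ℝ) :
    A.form k (x + s • (y - x)) = (1 - s) * A.form k x + s * A.form k y := by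
  simp only [form, inner_add_right, inner_smul_right, inner_sub_right]; ring

theorem isClosed_plane (k : ι) : IsClosed (A.plane k) :=
  isClosed_eq (A.continuous_form k) continuous_const

theorem isOpen_cell [Finite ι] (σ : ι → Bool) : IsOpen (A.cell σ) := by
  have : A.cell σ = ⋂ k, {x | 0 < sgn (σ k) * A.form k x} := by ext; simp [cell]
  rw [this]
  exact isOpen_iInter_of_finite fun k =>
    isOpen_lt continuous_const (continuous_const.mul (A.continuous_form k))

theorem convex_cell (σ : ι → Bool) : Convex ℝ (A.cell σ) := by
  rw [convex_iff_add_mem]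
  intro x hx y hy a b ha hb hab k
  have e : A.form k (a • x + b • y) = a * A.form k x + b * A.form k y := by
    simp only [form, inner_add_right, inner_smul_right]
    linear_combination (A.offset k) * hab
  have h1 := hx k
  have h2 := hy k
  have e2 : sgn (σ k) * A.form k (a • x + b • y)
      = a * (sgn (σ k) * A.form k x) + b * (sgn (σ k) * A.form k y) := by rw [e]; ring
  rw [e2]
  rcases eq_or_lt_of_le ha with h | h
  · have : b = 1 := by linarith
    subst this; rw [← h]; simpa using h2
  · have := mul_pos h h1
    have := mul_nonneg hb h2.le
    linarith

theorem exists_mem_cell {x : Space d} (hx : ∀ k, x ∉ A.plane k) : ∃ σ, x ∈ A.cell σ := by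
  choose σ hσ using fun k => exists_sgn_mul_pos (hx k)
  exact ⟨σ, hσ⟩

theorem notMem_plane_of_mem_cell {x : Space d} {σ : ι → Bool} (hx : x ∈ A.cell σ) (k : ι) :
    x ∉ A.plane k := fun h => by
  have := hx k
  rw [show A.form k x = 0 from h] at this
  simp at this

theorem exists_mem_face {x : Space d} {k : ι} (hk : x ∈ A.plane k)
    (hx : ∀ j, j ≠ k → x ∉ A.plane j) : ∃ σ, x ∈ A.face k σ := by
  classical
  have : ∀ j, ∃ b, j ≠ k → 0 < sgn b * A.form j x := fun j => by
    by_cases hj : j = k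
    · exact ⟨true, fun h => absurd hj h⟩
    · obtain ⟨b, hb⟩ := exists_sgn_mul_pos (hx j hj)
      exact ⟨b, fun _ => hb⟩
  choose σ hσ using this
  exact ⟨σ, hk, hσ⟩

theorem volume_plane (k : ι) : volume (A.plane k) = 0 := by
  have : A.plane k = {x | inner ℝ (A.normal k) x = A.offset k} := by
    ext x; simp [plane, form, sub_eq_zero]
  rw [this]
  refine addHaar_hyperplane _ (Or.inl fun h => ?_)
  have := A.norm_normal k
  simp [h] at this

section flip

variable [DecidableEq ι]

/-- The sign vector of the cell on the other side of the `k`-th hyperplane. -/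
def flip (σ : ι → Bool) (k : ι) : ι → Bool := Function.update σ k (!σ k)

theorem flip_self (σ : ι → Bool) (k : ι) : flip σ k k = !σ k := by simp [flip]

theorem flip_of_ne (σ : ι → Bool) {j k : ι} (h : j ≠ k) : flip σ k j = σ j := by simp [flip, h]

theorem flip_flip (σ : ι → Bool) (k : ι) : flip (flip σ k) k = σ := by simp [flip]

theorem face_flip (k : ι) (σ : ι → Bool) : A.face k (flip σ k) = A.face k σ := by
  ext x
  simp only [face, mem_ofPred_eq]
  refine and_congr_right fun _ => forall_congr' fun j => ?_
  refine forall_congr' fun hj => ?_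
  rw [flip_of_ne σ hj]

/-- Near a point of a facet, membership in the two adjacent cells is decided by the sign of the
form of the hyperplane. -/
theorem eventually_mem_cell_of_mem_face [Finite ι] {k : ι} {σ : ι → Bool} {x : Space d}
    (hx : x ∈ A.face k σ) : ∀ᶠ y in 𝓝 x, (0 < sgn (σ k) * A.form k y → y ∈ A.cell σ) ∧
      (sgn (σ k) * A.form k y < 0 → y ∈ A.cell (flip σ k)) := by
  have h1 : ∀ᶠ y in 𝓝 x, ∀ j, j ≠ k → 0 < sgn (σ j) * A.form j y := by
    rw [eventually_all]
    intro j
    by_cases hj : j = k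
    · exact Eventually.of_forall fun y h => absurd hj h
    · have : Continuous fun y => sgn (σ j) * A.form j y :=
        continuous_const.mul (A.continuous_form j)
      filter_upwards [this.continuousAt.eventually_const_lt (hx.2 j hj)] with y hy _ using hy
  filter_upwards [h1] with y hy
  refine ⟨fun h j => ?_, fun h j => ?_⟩
  · by_cases hj : j = k
    · rw [hj]; exact h
    · exact hy j hj
  · by_cases hj : j = k
    · rw [hj, flip_self, sgn_not]; linarith
    · rw [flip_of_ne σ hj]; exact hy j hj

theorem mem_closure_of_mem_face [Finite ι] {k : ι} {σ : ι → Bool} {x : Space d}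
    (hx : x ∈ A.face k σ) : x ∈ closure (A.cell σ) := by
  rw [mem_closure_iff_frequently]
  have ht : Tendsto (fun t : ℝ => x + (t * sgn (σ k)) • A.normal k) (𝓝[>] 0) (𝓝 x) := by
    have : Continuous fun t : ℝ => x + (t * sgn (σ k)) • A.normal k := by fun_prop
    simpa using (this.tendsto 0).mono_left nhdsWithin_le_nhds
  refine ht.frequently (Eventually.frequently ?_)
  filter_upwards [ht.eventually (A.eventually_mem_cell_of_mem_face hx), self_mem_nhdsWithin]
    with t h ht0
  refine h.1 ?_
  rw [form_add, hx.1, inner_smul_right, real_inner_self_eq_norm_sq, A.norm_normal]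
  have := sgn_mul_self (σ k)
  have e : sgn (σ k) * (0 + t * sgn (σ k) * 1 ^ 2) = t := by linear_combination t * this
  rw [e]; exact ht0

/-- The facet `face k σ` bounds `P`, which lies on the side of `cell σ`. -/
def IsFacet (P : Set (Space d)) (k : ι) (σ : ι → Bool) : Prop :=
  A.cell σ ⊆ P ∧ Disjoint (A.cell (flip σ k)) P

/-- Near a point of one of its facets, an open set is an open half-space. -/
theorem eventually_mem_iff_of_isFacet [Finite ι] {P : Set (Space d)} (hP : IsOpen P) {k : ι}
    {σ : ι → Bool} (h : A.IsFacet P k σ) {x : Space d} (hx : x ∈ A.face k σ) :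
    ∀ᶠ y in 𝓝 x, y ∈ P ↔ 0 < sgn (σ k) * A.form k y := by
  have hev := A.eventually_mem_cell_of_mem_face hx
  filter_upwards [eventually_eventually_nhds.2 hev] with y hy
  constructor
  · intro hyP
    by_contra hneg
    -- points slightly further on the other side would be both in `P` and in the opposite cell
    have ht : Tendsto (fun t : ℝ => y + (-(t * sgn (σ k))) • A.normal k) (𝓝[>] 0) (𝓝 y) := by
      have : Continuous fun t : ℝ => y + (-(t * sgn (σ k))) • A.normal k := by fun_prop
      simpa using (this.tendsto 0).mono_left nhdsWithin_le_nhds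
    obtain ⟨t, ⟨h1, h2⟩, ht0⟩ := ((ht.eventually hy).and (ht.eventually (hP.mem_nhds hyP))
      |>.and self_mem_nhdsWithin).exists
    refine disjoint_left.1 h.2 (h1.2 ?_) h2
    rw [form_add, inner_smul_right, real_inner_self_eq_norm_sq, A.norm_normal]
    have := sgn_mul_self (σ k)
    have e : sgn (σ k) * (A.form k y + -(t * sgn (σ k)) * 1 ^ 2) = sgn (σ k) * A.form k y - t := by
      linear_combination (-t) * this
    rw [e]
    have : 0 < t := ht0
    linarith [not_lt.1 hneg]
  · exact fun hpos => h.1 (hy.self_of_nhds.1 hpos)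

/-- The sign encoded by `σ k` tells on which side of the hyperplane `P` lies, so the opposite
direction points outward. -/
theorem isOutwardNormal_of_isFacet [Finite ι] {P : Set (Space d)} (hP : IsOpen P) {k : ι}
    {σ : ι → Bool} (h : A.IsFacet P k σ) {x : Space d} (hx : x ∈ A.face k σ) :
    IsOutwardNormal P x (-(sgn (σ k)) • A.normal k) := by
  refine ⟨by rw [norm_smul, A.norm_normal, norm_neg, Real.norm_eq_abs, abs_sgn, one_mul], ?_⟩
  obtain ⟨r, hr, hrP⟩ := Metric.eventually_nhds_iff.1 (A.eventually_mem_iff_of_isFacet hP h hx)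
  refine ⟨r, hr, fun y hy => ?_⟩
  rw [hrP hy]
  have : A.form k y = inner ℝ (y - x) (A.normal k) := by
    have := A.form_add k x (y - x)
    rw [add_sub_cancel, hx.1, zero_add] at this
    rw [this, real_inner_comm]
  rw [this, inner_smul_right]
  constructor <;> intro h <;> linarith

theorem face_subset_frontier [Finite ι] {P : Set (Space d)} (hP : IsOpen P) {k : ι}
    {σ : ι → Bool} (h : A.IsFacet P k σ) : A.face k σ ⊆ frontier P := by
  intro x hx
  rw [hP.frontier_eq]
  refine ⟨closure_mono h.1 (A.mem_closure_of_mem_face hx), fun hxP => ?_⟩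
  have := (A.eventually_mem_iff_of_isFacet hP h hx).self_of_nhds.1 hxP
  rw [hx.1] at this
  simp at this

end flip

end Arrangement

/-- Two outward normals cut out the same half-space near `x`, hence are equal; so `outwardNormal`,
which is a choice, has the expected value. -/
theorem IsOutwardNormal.unique {d : ℕ} {P : Set (Space d)} {x n n' : Space d}
    (h : IsOutwardNormal P x n) (h' : IsOutwardNormal P x n') : n = n' := by
  obtain ⟨hn, r, hr, hrP⟩ := h
  obtain ⟨hn', r', hr', hrP'⟩ := h'
  -- both half-spaces agree near `x`, so `n - n'` tested on small vectors gives `⟪n, n'⟫ = 1`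
  by_contra hne
  have hlt : inner ℝ n n' < 1 := by
    refine lt_of_le_of_ne ?_ fun h1 => hne ((inner_eq_one_iff_of_norm_eq_one hn hn').1 h1)
    simpa [hn, hn'] using real_inner_le_norm n n'
  set t : ℝ := min r r' / 4 with ht
  have ht0 : 0 < t := by positivity
  have hmem : ∀ ρ, min r r' ≤ ρ → x + t • (n - n') ∈ Metric.ball x ρ := by
    intro ρ hρ
    rw [Metric.mem_ball, dist_eq_norm, add_sub_cancel_left, norm_smul, Real.norm_of_nonneg ht0.le]
    have : ‖n - n'‖ ≤ 2 := (norm_sub_le _ _).trans (by linarith)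
    have h0 : 0 < min r r' := by positivity
    nlinarith
  have h1 := hrP _ (hmem r (min_le_left _ _))
  have h2 := hrP' _ (hmem r' (min_le_right _ _))
  rw [h1] at h2
  have e1 : inner ℝ (x + t • (n - n') - x) n = t * (1 - inner ℝ n n') := by
    rw [add_sub_cancel_left, inner_smul_left, inner_sub_left, real_inner_self_eq_norm_sq, hn,
      real_inner_comm]
    simp
  have e2 : inner ℝ (x + t • (n - n') - x) n' = -(t * (1 - inner ℝ n n')) := by
    rw [add_sub_cancel_left, inner_smul_left, inner_sub_left, real_inner_self_eq_norm_sq, hn']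
    simp only [conj_trivial]; ring
  rw [e1, e2] at h2
  have : 0 < t * (1 - inner ℝ n n') := mul_pos ht0 (by linarith)
  have := h2.2 (by linarith)
  linarith

theorem IsOutwardNormal.outwardNormal_eq {d : ℕ} {P : Set (Space d)} {x n : Space d}
    (h : IsOutwardNormal P x n) : outwardNormal P x = n := by
  have hex : ∃ n, IsOutwardNormal P x n := ⟨n, h⟩
  rw [outwardNormal, dif_pos hex]
  exact hex.choose_spec.unique h

/-! ### The boundary of a polytope -/

theorem IsPolytope.isOpen {d : ℕ} {P : Set (Space d)} (hP : IsPolytope P) : IsOpen P := by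
  rw [← hP.interior_closure]; exact isOpen_interior

theorem IsPolytope.isCompact_closure {d : ℕ} {P : Set (Space d)} (hP : IsPolytope P) :
    IsCompact (closure P) := by
  obtain ⟨𝒮, h⟩ := hP.exists_hulls
  rw [h]
  exact 𝒮.isCompact_biUnion fun S _ => S.finite_toSet.isCompact_convexHull ℝ

theorem IsPolytope.isBounded {d : ℕ} {P : Set (Space d)} (hP : IsPolytope P) :
    Bornology.IsBounded P := hP.isCompact_closure.isBounded.subset subset_closure

/-- A supporting hyperplane at a boundary point of the convex hull of a finite set. -/
theorem exists_supporting {d : ℕ} (S : Finset (Space d)) {x : Space d}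
    (hx : x ∈ convexHull ℝ (S : Set (Space d)))
    (hx' : x ∉ interior (convexHull ℝ (S : Set (Space d)))) :
    ∃ n : Space d, ‖n‖ = 1 ∧ ∀ s ∈ S, inner ℝ n s ≤ inner ℝ n x := by
  suffices h : ∃ n : Space d, n ≠ 0 ∧ ∀ s ∈ S, inner ℝ n s ≤ inner ℝ n x by
    obtain ⟨n, hn, h⟩ := h
    refine ⟨‖n‖⁻¹ • n, norm_smul_inv_norm (𝕜 := ℝ) hn, fun s hs => ?_⟩
    simp only [inner_smul_left, conj_trivial]
    exact mul_le_mul_of_nonneg_left (h s hs) (by positivity)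
  have hconv : Convex ℝ (convexHull ℝ (S : Set (Space d))) := convex_convexHull _ _
  rcases (interior (convexHull ℝ (S : Set (Space d)))).eq_empty_or_nonempty with he | hne
  · have hspan : affineSpan ℝ (S : Set (Space d)) ≠ ⊤ := fun h => by
      have := interior_convexHull_nonempty_iff_affineSpan_eq_top.2 h
      simp [he] at this
    have hxs : x ∈ affineSpan ℝ (S : Set (Space d)) := convexHull_subset_affineSpan _ hx
    have hdir : (affineSpan ℝ (S : Set (Space d))).direction ≠ ⊤ := fun h => hspan
      ((AffineSubspace.direction_eq_top_iff_of_nonempty ⟨x, hxs⟩).1 h)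
    obtain ⟨n, hn, hn0⟩ := Submodule.exists_mem_ne_zero_of_ne_bot
      (fun h => hdir (Submodule.orthogonal_eq_bot_iff.1 h))
    refine ⟨n, hn0, fun s hs => ?_⟩
    have := (Submodule.mem_orthogonal' _ _).1 hn _
      (AffineSubspace.vsub_mem_direction (subset_affineSpan ℝ _ hs) hxs)
    rw [vsub_eq_sub, inner_sub_right] at this
    linarith
  · obtain ⟨f, hf⟩ := geometric_hahn_banach_open_point hconv.interior isOpen_interior hx'
    obtain ⟨n, hn⟩ := (InnerProductSpace.toDual ℝ (Space d)).surjective f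
    have hfn : ∀ y, f y = inner ℝ n y := fun y => by
      rw [← hn, InnerProductSpace.toDual_apply_apply]
    refine ⟨n, fun h0 => ?_, fun s hs => ?_⟩
    · obtain ⟨a, ha⟩ := hne
      have := hf a ha
      simp [hfn, h0] at this
    · have hs' : s ∈ closure (interior (convexHull ℝ (S : Set (Space d)))) := by
        rw [hconv.closure_interior_eq_closure_of_nonempty_interior hne]
        exact subset_closure (subset_convexHull ℝ _ hs)
      have hcl : IsClosed {y | inner ℝ n y ≤ inner ℝ n x} :=
        isClosed_le (by fun_prop) continuous_const
      refine closure_minimal (fun y hy => ?_) hcl hs'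
      have := (hf y hy).le
      rwa [hfn, hfn] at this

/-- The boundary of the convex hull of a finite set is contained in finitely many hyperplanes, one
for each subset that is contained in a hyperplane. -/
theorem exists_planes_convexHull {d : ℕ} (S : Finset (Space d)) :
    ∃ H : Finset (Space d × ℝ), (∀ h ∈ H, ‖h.1‖ = 1) ∧
      ∀ x ∈ convexHull ℝ (S : Set (Space d)), x ∉ interior (convexHull ℝ (S : Set (Space d))) →
        ∃ h ∈ H, inner ℝ h.1 x - h.2 = 0 := by
  classical
  have hch : ∀ S' : Finset (Space d), ∃ h : Space d × ℝ,
      (∃ h : Space d × ℝ, ‖h.1‖ = 1 ∧ ∀ s ∈ S', inner ℝ h.1 s = h.2) →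
        ‖h.1‖ = 1 ∧ ∀ s ∈ S', inner ℝ h.1 s = h.2 := by
    intro S'
    by_cases hex : ∃ h : Space d × ℝ, ‖h.1‖ = 1 ∧ ∀ s ∈ S', inner ℝ h.1 s = h.2
    · obtain ⟨h, hh⟩ := hex
      exact ⟨h, fun _ => hh⟩
    · exact ⟨0, fun h => absurd h hex⟩
  choose pl hpl using hch
  refine ⟨(S.powerset.image pl).filter (fun h => ‖h.1‖ = 1),
    fun h hh => (Finset.mem_filter.1 hh).2, fun x hx hx' => ?_⟩
  obtain ⟨n, hn, hns⟩ := exists_supporting S hx hx'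
  set S' := S.filter (fun s => inner ℝ n s = inner ℝ n x) with hS'
  have hp := hpl S' ⟨(n, inner ℝ n x), hn, fun s hs => (Finset.mem_filter.1 hs).2⟩
  refine ⟨pl S', Finset.mem_filter.2 ⟨Finset.mem_image_of_mem _
    (Finset.mem_powerset.2 (Finset.filter_subset _ _)), hp.1⟩, ?_⟩
  obtain ⟨w, hw0, hw1, hwx⟩ := Finset.mem_convexHull'.1 hx
  have hsum : ∑ s ∈ S, w s * (inner ℝ n x - inner ℝ n s) = 0 := by
    have : inner ℝ n x = ∑ s ∈ S, w s * inner ℝ n s := by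
      conv_lhs => rw [← hwx]
      rw [inner_sum]
      simp_rw [inner_smul_right]
    simp_rw [mul_sub]
    rw [Finset.sum_sub_distrib, ← Finset.sum_mul, hw1, one_mul, ← this, sub_self]
  -- the convex combination only involves points of the supporting hyperplane
  have hz := (Finset.sum_eq_zero_iff_of_nonneg fun s hs =>
    mul_nonneg (hw0 s hs) (sub_nonneg.2 (hns s hs))).1 hsum
  have e : inner ℝ (pl S').1 x = ∑ s ∈ S, w s * inner ℝ (pl S').1 s := by
    conv_lhs => rw [← hwx]
    rw [inner_sum]
    simp_rw [inner_smul_right]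
  rw [e, sub_eq_zero]
  calc ∑ s ∈ S, w s * inner ℝ (pl S').1 s = ∑ s ∈ S, w s * (pl S').2 := by
        refine Finset.sum_congr rfl fun s hs => ?_
        rcases mul_eq_zero.1 (hz s hs) with h | h
        · rw [h, zero_mul, zero_mul]
        · rw [hp.2 s (Finset.mem_filter.2 ⟨hs, (sub_eq_zero.1 h).symm⟩)]
    _ = (pl S').2 := by rw [← Finset.sum_mul, hw1, one_mul]

theorem IsPolytope.exists_planes {d : ℕ} {P : Set (Space d)} (hP : IsPolytope P) :
    ∃ H : Finset (Space d × ℝ), (∀ h ∈ H, ‖h.1‖ = 1) ∧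
      ∀ x ∈ frontier P, ∃ h ∈ H, inner ℝ h.1 x - h.2 = 0 := by
  classical
  obtain ⟨𝒮, h𝒮⟩ := hP.exists_hulls
  choose H hH1 hH2 using fun S : Finset (Space d) => exists_planes_convexHull S
  refine ⟨𝒮.biUnion H, fun h hh => ?_, fun x hx => ?_⟩
  · obtain ⟨S, _, hS⟩ := Finset.mem_biUnion.1 hh
    exact hH1 S h hS
  · rw [hP.isOpen.frontier_eq] at hx
    have hx1 := hx.1
    rw [h𝒮] at hx1
    obtain ⟨S, hS, hxS⟩ := mem_iUnion₂.1 hx1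
    obtain ⟨h, hh, e⟩ := hH2 S x hxS fun hint => hx.2 (by
      rw [← hP.interior_closure, h𝒮]
      exact interior_mono (subset_biUnion_of_mem (u := fun S : Finset (Space d) =>
        convexHull ℝ (S : Set (Space d))) hS) hint)
    exact ⟨h, Finset.mem_biUnion.2 ⟨S, hS, hh⟩, e⟩

/-- The boundaries of finitely many polytopes are contained in one hyperplane arrangement. -/
theorem exists_arrangement {d : ℕ} {J : Type*} [Finite J] (P : J → Set (Space d))
    (hP : ∀ j, IsPolytope (P j)) : ∃ (ι : Type) (_ : Finite ι) (A : Arrangement d ι),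
      ∀ j, frontier (P j) ⊆ ⋃ k, A.plane k := by
  classical
  have := Fintype.ofFinite J
  choose H hH1 hH2 using fun j => (hP j).exists_planes
  let pl : Space d × ℝ → Set (Space d) := fun h => {x | inner ℝ h.1 x - h.2 = 0}
  let T : Finset (Set (Space d)) := (Finset.univ.biUnion H).image pl
  have hT : ∀ t ∈ T, ∃ h ∈ Finset.univ.biUnion H, pl h = t := fun t ht => Finset.mem_image.1 ht
  choose! rep hrep1 hrep2 using hT
  let e := T.equivFin
  have hmem : ∀ k, ((e.symm k : T) : Set (Space d)) ∈ T := fun k => (e.symm k).2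
  refine ⟨Fin T.card, inferInstance, ⟨fun k => (rep (e.symm k)).1, fun k => (rep (e.symm k)).2,
    fun k => ?_, fun k k' hkk' => ?_⟩, fun j x hx => ?_⟩
  · obtain ⟨j, _, hj⟩ := Finset.mem_biUnion.1 (hrep1 _ (hmem k))
    exact hH1 j _ hj
  · have h1 : pl (rep (e.symm k)) = pl (rep (e.symm k')) := hkk'
    rw [hrep2 _ (hmem k), hrep2 _ (hmem k')] at h1
    exact e.symm.injective (Subtype.ext h1)
  · obtain ⟨h, hh, hx0⟩ := hH2 j x hx
    have ht : pl h ∈ T := Finset.mem_image_of_mem _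
      (Finset.mem_biUnion.2 ⟨j, Finset.mem_univ _, hh⟩)
    refine mem_iUnion.2 ⟨e ⟨pl h, ht⟩, ?_⟩
    have : x ∈ pl (rep (pl h)) := by rw [hrep2 _ ht]; exact hx0
    simpa [Arrangement.plane, Arrangement.form, pl] using this

namespace Arrangement

variable {d : ℕ} {ι : Type} (A : Arrangement d ι)

/-- A cell is connected and does not meet the boundary of `P`, so it lies inside or outside. -/
theorem cell_subset_or_disjoint {P : Set (Space d)} (hPA : frontier P ⊆ ⋃ k, A.plane k)
    (σ : ι → Bool) : A.cell σ ⊆ P ∨ Disjoint (A.cell σ) (closure P) := by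
  have hfr : ∀ x ∈ A.cell σ, x ∉ frontier P := fun x hx hxf => by
    obtain ⟨k, hk⟩ := mem_iUnion.1 (hPA hxf)
    exact A.notMem_plane_of_mem_cell hx k hk
  by_cases h1 : A.cell σ ⊆ P
  · exact Or.inl h1
  · by_cases h2 : (A.cell σ ∩ P).Nonempty
    · obtain ⟨x, hx, hxP⟩ := not_subset.1 h1
      -- otherwise `P` and the complement of its closure would disconnect the cell
      exfalso
      obtain ⟨y, hy, hy'⟩ := (A.convex_cell σ).isPreconnected (interior P) (closure P)ᶜ
        isOpen_interior isClosed_closure.isOpen_compl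
        (fun z hz => by
          by_cases hzc : z ∈ closure P
          · by_contra hcon
            exact hfr z hz ⟨hzc, fun hi => hcon (Or.inl hi)⟩
          · exact Or.inr hzc)
        (by
          obtain ⟨z, hz, hzP⟩ := h2
          refine ⟨z, hz, ?_⟩
          by_contra hcon
          exact hfr z hz ⟨subset_closure hzP, hcon⟩)
        ⟨x, hx, fun hc => hfr x hx ⟨hc, fun hi => hxP (interior_subset hi)⟩⟩
      exact hy'.2 (interior_subset_closure hy'.1)
    · refine Or.inr (disjoint_left.2 fun x hx hxc => ?_)
      rw [closure_eq_self_union_frontier] at hxc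
      rcases hxc with h | h
      · exact h2 ⟨x, hx, h⟩
      · exact hfr x hx h

/-- Of the two cells adjacent to a boundary point on a facet of the arrangement, exactly one lies
in `P`: both cannot lie outside since the point is in the closure of `P`, nor both inside since `P`
is the interior of its closure. -/
theorem exists_isFacet [Finite ι] [DecidableEq ι] {P : Set (Space d)} (hP : IsPolytope P)
    (hPA : frontier P ⊆ ⋃ k, A.plane k) {x : Space d} (hx : x ∈ frontier P) {k : ι}
    {σ : ι → Bool} (hxk : x ∈ A.face k σ) : A.IsFacet P k σ ∨ A.IsFacet P k (flip σ k) := by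
  have hev := A.eventually_mem_cell_of_mem_face hxk
  rw [hP.isOpen.frontier_eq] at hx
  rcases A.cell_subset_or_disjoint hPA σ with h1 | h1 <;>
    rcases A.cell_subset_or_disjoint hPA (flip σ k) with h2 | h2
  · -- with both cells in `P` the point would be interior
    exfalso
    refine hx.2 ?_
    rw [← hP.interior_closure, mem_interior_iff_mem_nhds]
    filter_upwards [eventually_eventually_nhds.2 hev] with y hy
    rcases lt_trichotomy (sgn (σ k) * A.form k y) 0 with h | h | h
    · exact subset_closure (h2 (hy.self_of_nhds.2 h))
    · have h0 : A.form k y = 0 := by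
        rcases mul_eq_zero.1 h with h | h
        · have := abs_sgn (σ k); simp [h] at this
        · exact h
      rw [mem_closure_iff_frequently]
      have ht : Tendsto (fun t : ℝ => y + (t * sgn (σ k)) • A.normal k) (𝓝[>] 0) (𝓝 y) := by
        have : Continuous fun t : ℝ => y + (t * sgn (σ k)) • A.normal k := by fun_prop
        simpa using (this.tendsto 0).mono_left nhdsWithin_le_nhds
      refine ht.frequently (Eventually.frequently ?_)
      filter_upwards [ht.eventually hy, self_mem_nhdsWithin] with t h ht0
      refine h1 (h.1 ?_)
      rw [form_add, h0, inner_smul_right, real_inner_self_eq_norm_sq, A.norm_normal]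
      have := sgn_mul_self (σ k)
      have e : sgn (σ k) * (0 + t * sgn (σ k) * 1 ^ 2) = t := by linear_combination t * this
      rw [e]; exact ht0
    · exact subset_closure (h1 (hy.self_of_nhds.1 h))
  · exact Or.inl ⟨h1, h2.mono_right subset_closure⟩
  · exact Or.inr ⟨h2, by rw [flip_flip]; exact h1.mono_right subset_closure⟩
  · -- with both cells outside `P`, the open set `P` would be contained in the hyperplane near `x`
    exfalso
    obtain ⟨y, hyP, hy⟩ : ∃ y ∈ P, ∀ᶠ y' in 𝓝 y,
        (0 < sgn (σ k) * A.form k y' → y' ∈ A.cell σ) ∧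
        (sgn (σ k) * A.form k y' < 0 → y' ∈ A.cell (flip σ k)) := by
      have := (mem_closure_iff_frequently.1 hx.1).and_eventually (eventually_eventually_nhds.2 hev)
      exact this.exists
    have ht : Tendsto (fun t : ℝ => y + t • A.normal k) (𝓝[>] 0) (𝓝 y) := by
      have : Continuous fun t : ℝ => y + t • A.normal k := by fun_prop
      simpa using (this.tendsto 0).mono_left nhdsWithin_le_nhds
    have hne : ∀ᶠ t in 𝓝[>] (0 : ℝ), A.form k (y + t • A.normal k) ≠ 0 := by
      have e : ∀ t, A.form k (y + t • A.normal k) = A.form k y + t := fun t => by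
        rw [form_add, inner_smul_right, real_inner_self_eq_norm_sq, A.norm_normal]; ring
      simp_rw [e]
      by_cases h0 : A.form k y = 0
      · filter_upwards [self_mem_nhdsWithin] with t ht
        rw [h0, zero_add]; exact (ne_of_gt ht)
      · have : Continuous fun t : ℝ => A.form k y + t := by fun_prop
        have h3 : Tendsto (fun t : ℝ => A.form k y + t) (𝓝[>] 0) (𝓝 (A.form k y)) := by
          simpa using (this.tendsto 0).mono_left nhdsWithin_le_nhds
        exact h3.eventually_ne h0
    obtain ⟨t, ⟨h3, h4⟩, h5⟩ := ((ht.eventually hy).and (ht.eventually (hP.isOpen.mem_nhds hyP))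
      |>.and hne).exists
    rcases lt_or_gt_of_ne (mul_ne_zero (fun h : sgn (σ k) = 0 => by
      have := abs_sgn (σ k); simp [h] at this) h5) with h | h
    · exact disjoint_left.1 h2 (h3.2 h) (subset_closure h4)
    · exact disjoint_left.1 h1 (h3.1 h) (subset_closure h4)

end Arrangement

/-! ### Surface measure on the facets -/

namespace Arrangement

variable {d : ℕ} {ι : Type} (A : Arrangement d ι)

/-- The direction of the `k`-th hyperplane. -/
noncomputable abbrev dir (k : ι) : Submodule ℝ (Space d) := (Submodule.span ℝ {A.normal k})ᗮ

/-- The isometric parametrization of the `k`-th hyperplane by its direction. -/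
noncomputable def param (k : ι) (w : A.dir k) : Space d := A.offset k • A.normal k + w

theorem isometry_param (k : ι) : Isometry (A.param k) := by
  refine Isometry.of_dist_eq fun w w' => ?_
  rw [param, param, dist_add_left]
  rfl

theorem inner_normal_dir (k : ι) (w : A.dir k) : inner ℝ (A.normal k) (w : Space d) = 0 :=
  Submodule.mem_orthogonal_singleton_iff_inner_right.1 w.2

theorem form_param (k : ι) (w : A.dir k) : A.form k (A.param k w) = 0 := by
  simp only [form, param, inner_add_right, inner_smul_right, real_inner_self_eq_norm_sq,
    A.norm_normal, inner_normal_dir]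
  ring

theorem range_param (k : ι) : range (A.param k) = A.plane k := by
  ext x
  constructor
  · rintro ⟨w, rfl⟩
    exact A.form_param k w
  · intro hx
    refine ⟨⟨x - A.offset k • A.normal k, ?_⟩, by simp [param]⟩
    rw [Submodule.mem_orthogonal_singleton_iff_inner_right, inner_sub_right, inner_smul_right,
      real_inner_self_eq_norm_sq, A.norm_normal]
    have : inner ℝ (A.normal k) x - A.offset k = 0 := hx
    linarith

theorem finrank_dir (k : ι) : Module.finrank ℝ (A.dir k) = d - 1 := by
  have h0 : A.normal k ≠ 0 := fun h => by
    have := A.norm_normal k; simp [h] at this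
  have h1 := (Submodule.span ℝ {A.normal k}).finrank_add_finrank_orthogonal
  rw [finrank_span_singleton h0, finrank_euclideanSpace_fin] at h1
  exact Nat.eq_sub_of_add_eq' h1

/-- Surface measure on the direction of the `k`-th hyperplane. -/
noncomputable def dirMeasure (k : ι) : Measure (A.dir k) := μHE[Module.finrank ℝ (A.dir k)]

instance (k : ι) : (A.dirMeasure k).IsAddHaarMeasure :=
  inferInstanceAs ((μHE[Module.finrank ℝ (A.dir k)] : Measure (A.dir k)).IsAddHaarMeasure)

theorem map_param (k : ι) :
    (A.dirMeasure k).map (A.param k) = (μHE[d - 1] : Measure (Space d)).restrict (A.plane k) := by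
  rw [dirMeasure, (A.isometry_param k).map_euclideanHausdorffMeasure, range_param, finrank_dir]

theorem map_param_restrict (k : ι) {B : Set (Space d)} (hB : MeasurableSet B)
    (hBk : B ⊆ A.plane k) : ((A.dirMeasure k).restrict (A.param k ⁻¹' B)).map (A.param k)
      = (μHE[d - 1] : Measure (Space d)).restrict B := by
  rw [← Measure.restrict_map (A.isometry_param k).continuous.measurable hB, map_param,
    Measure.restrict_restrict hB, inter_eq_left.2 hBk]

/-- Two distinct hyperplanes meet in a set of surface measure zero, so that surface measure on a
hyperplane is carried by the relatively open facets of the arrangement. -/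
theorem hausdorff_plane_inter_plane {j k : ι} (hjk : j ≠ k) :
    (μHE[d - 1] : Measure (Space d)) (A.plane j ∩ A.plane k) = 0 := by
  have hm : MeasurableSet (A.plane j) := (A.isClosed_plane j).measurableSet
  rw [← Measure.restrict_apply hm, ← map_param,
    Measure.map_apply (A.isometry_param k).continuous.measurable hm]
  set a := (A.dir k).orthogonalProjectionOnto (A.normal j) with ha
  have hin : ∀ w : A.dir k, inner ℝ a w = inner ℝ (A.normal j) (w : Space d) := fun w => by
    rw [ha]
    exact Submodule.inner_orthogonalProjectionOnto_eq_of_mem_right w (A.normal j)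
  have hset : A.param k ⁻¹' A.plane j
      = {w | inner ℝ a w = -(A.form j (A.offset k • A.normal k))} := by
    ext w
    simp only [mem_preimage, plane, mem_ofPred_eq, param, form_add, hin]
    constructor <;> intro h <;> linarith
  rw [hset]
  refine addHaar_hyperplane _ ?_
  -- otherwise the two hyperplanes would coincide
  by_contra! hcon
  obtain ⟨h1, h2⟩ := hcon
  rw [neg_eq_zero] at h2
  have hperp : A.normal j ∈ (A.dir k)ᗮ :=
    Submodule.orthogonalProjectionOnto_eq_zero_iff.1 (by rw [← ha, h1])
  rw [Submodule.orthogonal_orthogonal, Submodule.mem_span_singleton] at hperp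
  obtain ⟨c, hc⟩ := hperp
  have hc0 : c ≠ 0 := fun h => by
    have := A.norm_normal j
    rw [← hc, h] at this; simp at this
  have hform : ∀ x, A.form j x = c * A.form k x := by
    intro x
    have e1 := A.form_add j (A.offset k • A.normal k) (x - A.offset k • A.normal k)
    have e2 := A.form_add k (A.offset k • A.normal k) (x - A.offset k • A.normal k)
    have e3 : A.form k (A.offset k • A.normal k) = 0 := by
      simpa [param] using A.form_param k 0
    rw [add_sub_cancel, h2, zero_add, ← hc, inner_smul_left, conj_trivial] at e1
    rw [add_sub_cancel, e3, zero_add] at e2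
    rw [e1, e2]
  refine hjk (A.injective ?_)
  ext x
  have := hform x
  simp only [form] at this
  simp only [mem_ofPred_eq]
  rw [this]
  simp [hc0]

variable [Finite ι] [DecidableEq ι]

theorem measurableSet_face (k : ι) (σ : ι → Bool) : MeasurableSet (A.face k σ) := by
  have : A.face k σ = A.plane k ∩ ⋂ j, {x | j ≠ k → 0 < sgn (σ j) * A.form j x} := by
    ext x; simp [face, plane]
  rw [this]
  refine (A.isClosed_plane k).measurableSet.inter (MeasurableSet.iInter fun j => ?_)
  by_cases hj : j = k
  · simp [hj]
  · simp only [ne_eq, hj, not_false_eq_true, forall_const]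
    exact (isOpen_lt continuous_const (continuous_const.mul (A.continuous_form j))).measurableSet

theorem face_subset_plane (k : ι) (σ : ι → Bool) : A.face k σ ⊆ A.plane k := fun _ hx => hx.1

theorem isOpen_preimage_face (k : ι) (σ : ι → Bool) : IsOpen (A.param k ⁻¹' A.face k σ) := by
  have : A.param k ⁻¹' A.face k σ
      = ⋂ j, {w | j ≠ k → 0 < sgn (σ j) * A.form j (A.param k w)} := by
    ext w; simp [face, form_param]
  rw [this]
  refine isOpen_iInter_of_finite fun j => ?_
  by_cases hj : j = k
  · simp [hj]
  · simp only [ne_eq, hj, not_false_eq_true, forall_const]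
    exact isOpen_lt continuous_const (continuous_const.mul
      ((A.continuous_form j).comp (A.isometry_param k).continuous))

/-- Up to a null set, the boundary of a polytope is the union of its facets. -/
theorem restrict_frontier_le {P : Set (Space d)} (hP : IsPolytope P)
    (hPA : frontier P ⊆ ⋃ k, A.plane k) :
    (μHE[d - 1] : Measure (Space d)).restrict (frontier P) ≤
      Measure.sum fun f : {f : ι × (ι → Bool) // A.IsFacet P f.1 f.2} =>
        (μHE[d - 1] : Measure (Space d)).restrict (A.face f.1.1 f.1.2) := by
  refine le_trans (Measure.restrict_mono' ?_ le_rfl) Measure.restrict_iUnion_le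
  have hnull : ∀ᵐ x ∂(μHE[d - 1] : Measure (Space d)), ∀ j k, j ≠ k →
      x ∉ A.plane j ∩ A.plane k := by
    refine ae_all_iff.2 fun j => ae_all_iff.2 fun k => ?_
    by_cases hjk : j = k
    · exact ae_of_all _ fun x h => absurd hjk h
    · have := measure_eq_zero_iff_ae_notMem.1 (A.hausdorff_plane_inter_plane hjk)
      filter_upwards [this] with x hx _ using hx
  filter_upwards [hnull] with x hx hxP
  obtain ⟨k, hk⟩ := mem_iUnion.1 (hPA hxP)
  obtain ⟨σ, hσ⟩ := A.exists_mem_face hk fun j hj hxj => hx j k hj ⟨hxj, hk⟩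
  rcases A.exists_isFacet hP hPA hxP hσ with h | h
  · exact mem_iUnion.2 ⟨⟨(k, σ), h⟩, hσ⟩
  · exact mem_iUnion.2 ⟨⟨(k, flip σ k), h⟩, by rw [face_flip]; exact hσ⟩

end Arrangement

/-! ### Traces of Sobolev functions on the facets of a prism -/

/-- `w` has a square-integrable trace with respect to the measure `ν` on the boundary of `K`. -/
structure TraceOn {d : ℕ} {F : Type*} [NormedAddCommGroup F] [NormedSpace ℝ F]
    (K : Set (SpaceTime d)) (w : SpaceTime d → F) (ν : Measure (SpaceTime d)) : Prop where
  exists_hasTraceAt : ∀ᵐ p ∂ν, ∃ l, HasTraceAt K w p l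
  memLp : MemLp (trace K w) 2 ν

theorem TraceOn.of_le_sum {d : ℕ} {F : Type*} [NormedAddCommGroup F] [NormedSpace ℝ F]
    {K : Set (SpaceTime d)} {w : SpaceTime d → F} {J : Type*} [Finite J]
    {ν : J → Measure (SpaceTime d)} (h : ∀ j, TraceOn K w (ν j)) {ν' : Measure (SpaceTime d)}
    (hle : ν' ≤ Measure.sum ν) : TraceOn K w ν' := by
  refine ⟨ae_mono hle ?_, MemLp.mono_measure hle ?_⟩
  · exact Measure.ae_sum_iff.2 fun j => (h j).exists_hasTraceAt
  · have := Fintype.ofFinite J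
    have hm : AEStronglyMeasurable (trace K w) (Measure.sum ν) :=
      aestronglyMeasurable_sum_measure_iff.2 fun j => (h j).memLp.1
    rw [memLp_two_iff_integrable_sq_norm hm, Measure.sum_fintype, integrable_finsetSum_measure]
    exact fun j _ => (memLp_two_iff_integrable_sq_norm (h j).memLp.1).1 (h j).memLp

section

variable {d : ℕ} {Y : Type*} [NormedAddCommGroup Y] [NormedSpace ℝ Y]
variable [FiniteDimensional ℝ Y] [MeasurableSpace Y] [BorelSpace Y]
variable (μ : Measure Y) [μ.IsAddHaarMeasure]

theorem measurableEmbedding_chart_zero (L : (Y × ℝ) ≃L[ℝ] SpaceTime d) (p₀ : SpaceTime d) :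
    MeasurableEmbedding (fun y : Y => chart L p₀ (y, 0)) :=
  (measurableEmbedding_chart L p₀).comp
    (MeasurableEmbedding.prodMk_right MeasurableEmbedding.id (0 : ℝ))

/-- Traces exist and are square-integrable on the part `s = 0` of a chart, if near it `K` is the
half-space `s > 0` and `u` has a weak derivative in `L²(K)` in the transversal direction. -/
theorem traceOn_chart {L : (Y × ℝ) ≃L[ℝ] SpaceTime d} {p₀ : SpaceTime d}
    {K : Set (SpaceTime d)} (hK : MeasurableSet K) (hKf : volume K ≠ ⊤) {u D : SpaceTime d → ℝ}
    (hum : StronglyMeasurable u) (hDm : StronglyMeasurable D)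
    (hu : MemLp u 2 (volume.restrict K)) (hD : MemLp D 2 (volume.restrict K))
    (h : IsWeakDeriv K (L (0, 1)) u D)
    {Γ : Set Y} (hΓ : IsOpen Γ) (hΓf : μ Γ ≠ ⊤) {δ : ℝ} (hδ : 0 < δ)
    (hΓK : ∀ y ∈ Γ, ∀ s ∈ Ioo 0 δ, chart L p₀ (y, s) ∈ K)
    (hloc : ∀ y ∈ Γ, ∀ᶠ z in 𝓝 (y, (0 : ℝ)), chart L p₀ z ∈ K ↔ 0 < z.2) :
    TraceOn K u ((μ.restrict Γ).map fun y => chart L p₀ (y, 0)) := by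
  obtain ⟨G, hG, hrep⟩ := exists_trace_representative μ hK hKf hum hDm hu hD h hΓ hδ hΓK
  have hT := ae_hasTraceAt_chart μ hKf hum hDm hu hD hΓ hΓf hδ hΓK hloc hG hrep
  have hT' : ∀ᵐ y ∂μ.restrict Γ, HasTraceAt K u (chart L p₀ (y, 0)) (G y) :=
    (ae_restrict_iff' hΓ.measurableSet).2 hT
  have hme := measurableEmbedding_chart_zero L p₀
  constructor
  · rw [hme.ae_map_iff]
    filter_upwards [hT'] with y hy using ⟨_, hy⟩
  · rw [hme.memLp_map_measure_iff]
    refine hG.ae_eq ?_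
    filter_upwards [hT'] with y hy using hy.trace_eq.symm

end

/-- Additivity of the weak derivative in the direction. -/
theorem IsWeakDeriv.add {d : ℕ} {K : Set (SpaceTime d)} {v v' : SpaceTime d}
    {u D D' : SpaceTime d → ℝ} (hu : IntegrableOn u K) (hD : IntegrableOn D K)
    (hD' : IntegrableOn D' K) (h : IsWeakDeriv K v u D) (h' : IsWeakDeriv K v' u D') :
    IsWeakDeriv K (v + v') u (fun p => D p + D' p) := by
  intro φ h1 h2 h3
  have hφ1 : ContDiff ℝ 1 φ := h1.of_le (by exact_mod_cast le_top)
  have hint : ∀ v : SpaceTime d, IntegrableOn (fun p => u p * fderiv ℝ φ p v) K := by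
    intro v
    have hc : Continuous (fun p => fderiv ℝ φ p v) :=
      (hφ1.continuous_fderiv one_ne_zero).clm_apply continuous_const
    obtain ⟨C, hC⟩ := hc.bounded_above_of_compact_support (h2.fderiv_apply ℝ v)
    exact hu.mul_bdd hc.aestronglyMeasurable (ae_of_all _ hC)
  obtain ⟨C, hC⟩ := hφ1.continuous.bounded_above_of_compact_support h2
  have hint' : ∀ f : SpaceTime d → ℝ, IntegrableOn f K → IntegrableOn (fun p => f p * φ p) K :=
    fun f hf => hf.mul_bdd hφ1.continuous.aestronglyMeasurable (ae_of_all _ hC)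
  simp only [map_add, mul_add, add_mul]
  rw [integral_add (hint v) (hint v'), integral_add (hint' D hD) (hint' D' hD'), h φ h1 h2 h3,
    h' φ h1 h2 h3]
  ring

/-- A function in `H¹(K)` has weak derivatives in `L²(K)` in all directions. -/
theorem MemH1.exists_isWeakDeriv {d : ℕ} {K : Set (SpaceTime d)} (hKf : volume K ≠ ⊤)
    {u : SpaceTime d → ℝ} (hu : MemH1 K u) (v : SpaceTime d) :
    ∃ D, StronglyMeasurable D ∧ MemLp D 2 (volume.restrict K) ∧ IsWeakDeriv K v u D := by
  have : IsFiniteMeasure (volume.restrict K) := ⟨by simpa using hKf.lt_top⟩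
  obtain ⟨hu2, ⟨G, hG⟩, ⟨g, hg⟩⟩ := hu
  have hu1 : IntegrableOn u K := hu2.integrable one_le_two
  have key : ∀ s : Finset (Fin d), ∃ D, StronglyMeasurable D ∧ MemLp D 2 (volume.restrict K) ∧
      IsWeakDeriv K (∑ k ∈ s, v.1 k • ((EuclideanSpace.single k 1, 0) : SpaceTime d)
        + v.2 • ((0, 1) : SpaceTime d)) u D := by
    intro s
    induction s using Finset.induction_on with
    | empty =>
      refine ⟨fun p => v.2 * g p, (Lp.stronglyMeasurable g).const_mul _, (Lp.memLp g).const_mul _,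
        ?_⟩
      simpa using IsWeakDeriv.const_smul hg v.2
    | insert k s hk ih =>
      obtain ⟨D, h1, h2, h3⟩ := ih
      have m1 : StronglyMeasurable (fun p => v.1 k * G p k) :=
        ((EuclideanSpace.proj (𝕜 := ℝ) k).continuous.comp_stronglyMeasurable
          (Lp.stronglyMeasurable G)).const_mul _
      have m2 : MemLp (fun p => v.1 k * G p k) 2 (volume.restrict K) :=
        ((EuclideanSpace.proj (𝕜 := ℝ) k).comp_memLp' (Lp.memLp G)).const_mul _
      refine ⟨fun p => v.1 k * G p k + D p, m1.add h1, m2.add h2, ?_⟩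
      rw [Finset.sum_insert hk, add_assoc]
      exact IsWeakDeriv.add hu1 (m2.integrable one_le_two) (h2.integrable one_le_two)
        (IsWeakDeriv.const_smul (hG k) (v.1 k)) h3
  obtain ⟨D, h1, h2, h3⟩ := key Finset.univ
  refine ⟨D, h1, h2, ?_⟩
  convert h3 using 1
  refine Prod.ext ?_ ?_
  · ext k
    simp [Prod.fst_sum, Finset.sum_apply, Pi.single_apply]
  · simp [Prod.snd_sum]

section Facet

variable {d : ℕ} {ι : Type} [Finite ι] [DecidableEq ι] (A : Arrangement d ι)

/-- Decomposition of `ℝ^d × ℝ` along a hyperplane, the time axis and a transversal direction. -/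
noncomputable def facetEquiv (k : ι) (v : Space d) (hv : inner ℝ (A.normal k) v ≠ 0) :
    ((A.dir k × ℝ) × ℝ) ≃L[ℝ] SpaceTime d :=
  LinearEquiv.toContinuousLinearEquiv
    { toFun := fun z => ((z.1.1 : Space d) + z.2 • v, z.1.2)
      map_add' := fun z z' => by
        ext1
        · simp only [Prod.fst_add, Prod.snd_add, Submodule.coe_add, add_smul]; abel
        · rfl
      map_smul' := fun c z => by
        ext1
        · simp [smul_smul]
        · rfl
      invFun := fun p => ((⟨p.1 - (inner ℝ (A.normal k) p.1 / inner ℝ (A.normal k) v) • v, by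
          rw [Submodule.mem_orthogonal_singleton_iff_inner_right, inner_sub_right, inner_smul_right]
          field_simp
          ring⟩, p.2), inner ℝ (A.normal k) p.1 / inner ℝ (A.normal k) v)
      left_inv := fun z => by
        have h : inner ℝ (A.normal k) ((z.1.1 : Space d) + z.2 • v) / inner ℝ (A.normal k) v
            = z.2 := by
          rw [inner_add_right, A.inner_normal_dir, inner_smul_right]
          field_simp
          ring
        refine Prod.ext (Prod.ext (Subtype.ext ?_) rfl) h
        simp only [h]
        abel
      right_inv := fun p => by
        ext1
        · simp
        · rfl }

theorem facetEquiv_apply (k : ι) (v : Space d) (hv : inner ℝ (A.normal k) v ≠ 0)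
    (z : (A.dir k × ℝ) × ℝ) :
    facetEquiv A k v hv z = ((z.1.1 : Space d) + z.2 • v, z.1.2) := rfl

/-- Near a point `x₀` of the closure of the cell of a facet, the segments in the direction `z - x₀`,
with `z` inside the cell, lead into the cell; the trace exists on this part of the facet. -/
theorem traceOn_facet_ball {P : Set (Space d)} (hP : IsOpen P) {a b : ℝ} {k : ι}
    {σ : ι → Bool} (hf : A.IsFacet P k σ) (hKf : volume (P ×ˢ Ioo a b) ≠ ⊤)
    {u : SpaceTime d → ℝ} (hum : StronglyMeasurable u) (hu : MemH1 (P ×ˢ Ioo a b) u)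
    {z x₀ : Space d} {ρ : ℝ} (hz : Metric.ball z ρ ⊆ A.cell σ) (hρ : 0 < ρ)
    (hx₀ : x₀ ∈ A.plane k) :
    TraceOn (P ×ˢ Ioo a b) u
      (((μHE[d - 1] : Measure (Space d)).restrict (A.face k σ ∩ Metric.ball x₀ ρ)).prod
        (volume.restrict (Ioo a b))) := by
  set v := z - x₀ with hv
  have hzc : z ∈ A.cell σ := hz (Metric.mem_ball_self hρ)
  have hnv : inner ℝ (A.normal k) v = A.form k z := by
    have h1 : A.form k x₀ = 0 := hx₀
    have := A.form_add k x₀ v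
    rw [hv, add_sub_cancel, h1, zero_add] at this
    rw [this]
  have hpos : 0 < sgn (σ k) * inner ℝ (A.normal k) v := by rw [hnv]; exact hzc k
  have hnv0 : inner ℝ (A.normal k) v ≠ 0 := fun h => by
    rw [h, mul_zero] at hpos
    exact lt_irrefl _ hpos
  set L := facetEquiv A k v hnv0 with hL
  set p₀ : SpaceTime d := (A.offset k • A.normal k, 0) with hp₀
  have hchart : ∀ w t s, chart L p₀ ((w, t), s) = (A.param k w + s • v, t) := by
    intro w t s
    rw [chart, hL, facetEquiv_apply, hp₀, Prod.mk_add_mk, zero_add, Arrangement.param, add_assoc]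
  have hBm : MeasurableSet (A.face k σ ∩ Metric.ball x₀ ρ) :=
    (A.measurableSet_face k σ).inter measurableSet_ball
  set B := A.face k σ ∩ Metric.ball x₀ ρ with hB
  have hBo : IsOpen (A.param k ⁻¹' B) :=
    (A.isOpen_preimage_face k σ).inter (Metric.isOpen_ball.preimage (A.isometry_param k).continuous)
  obtain ⟨D, hDm, hD, hwd⟩ := hu.exists_isWeakDeriv hKf (v, 0)
  have hL1 : L (0, 1) = (v, 0) := by rw [hL, facetEquiv_apply]; simp
  have hseg : ∀ x ∈ B, ∀ s ∈ Ioo (0 : ℝ) 1, x + s • v ∈ A.cell σ := by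
    intro x hx s hs j
    have hball : z + (x - x₀) ∈ A.cell σ := hz (by
      rw [Metric.mem_ball, dist_eq_norm, add_sub_cancel_left, ← dist_eq_norm]; exact hx.2)
    have e : x + s • v = x + s • ((z + (x - x₀)) - x) := by
      congr 2; rw [hv]; abel
    rw [e, A.form_add_smul_sub]
    have h1 := hball j
    have h2 : 0 ≤ sgn (σ j) * A.form j x := by
      by_cases hj : j = k
      · rw [hj, hx.1.1, mul_zero]
      · exact (hx.1.2 j hj).le
    have := mul_pos hs.1 h1
    have := mul_nonneg (sub_nonneg.2 hs.2.le) h2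
    nlinarith
  have hT := traceOn_chart ((A.dirMeasure k).prod (volume : Measure ℝ)) (L := L) (p₀ := p₀)
    (hP.measurableSet.prod measurableSet_Ioo) hKf hum hDm hu.1 hD (by rw [hL1]; exact hwd)
    (Γ := (A.param k ⁻¹' B) ×ˢ Ioo a b) (hBo.prod isOpen_Ioo) ?_ one_pos ?_ ?_
  · have e : (fun y : A.dir k × ℝ => chart L p₀ (y, 0)) = Prod.map (A.param k) id := by
      ext1 y
      obtain ⟨w, t⟩ := y
      rw [hchart]; simp
    rw [e, ← Measure.prod_restrict, ← Measure.map_prod_map _ _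
      (A.isometry_param k).continuous.measurable measurable_id, Measure.map_id,
      A.map_param_restrict k hBm (inter_subset_left.trans (A.face_subset_plane k σ))] at hT
    exact hT
  · rw [Measure.prod_prod]
    refine ENNReal.mul_ne_top ?_ (by simp)
    have hbd : Bornology.IsBounded (A.param k ⁻¹' B) := by
      have : Bornology.IsBounded (A.param k ⁻¹' Metric.ball x₀ ρ) :=
        (A.isometry_param k).antilipschitz.isBounded_preimage Metric.isBounded_ball
      exact this.subset (preimage_mono inter_subset_right)
    exact hbd.measure_lt_top.ne
  · rintro ⟨w, t⟩ ⟨hw, ht⟩ s hs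
    rw [hchart]
    exact ⟨hf.1 (hseg _ hw s hs), ht⟩
  · rintro ⟨w, t⟩ ⟨hw, ht⟩
    have hev := A.eventually_mem_iff_of_isFacet hP hf hw.1
    have hc : Continuous fun q : (A.dir k × ℝ) × ℝ => A.param k q.1.1 + q.2 • v := by
      have := (A.isometry_param k).continuous
      fun_prop
    have h0 : A.param k w + (0 : ℝ) • v = A.param k w := by simp
    have hev' : ∀ᶠ q in 𝓝 (((w, t), 0) : (A.dir k × ℝ) × ℝ), A.param k q.1.1 + q.2 • v ∈ P ↔
        0 < sgn (σ k) * A.form k (A.param k q.1.1 + q.2 • v) := by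
      have := hc.tendsto ((w, t), 0)
      simp only [h0] at this
      exact this.eventually hev
    have hevt : ∀ᶠ q in 𝓝 (((w, t), 0) : (A.dir k × ℝ) × ℝ), q.1.2 ∈ Ioo a b :=
      (continuous_snd.comp continuous_fst).continuousAt.eventually_mem (isOpen_Ioo.mem_nhds ht)
    filter_upwards [hev', hevt] with q h1 h2
    obtain ⟨⟨w', t'⟩, s'⟩ := q
    rw [hchart, mem_prod]
    simp only at h1 h2 ⊢
    rw [h1, A.form_add, A.form_param, inner_smul_right, zero_add]
    have e : sgn (σ k) * (s' * inner ℝ (A.normal k) v)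
        = s' * (sgn (σ k) * inner ℝ (A.normal k) v) := by ring
    rw [e, mul_pos_iff_of_pos_right hpos]
    exact ⟨fun h => h.1, fun h => ⟨h, h2⟩⟩

/-- The closed cell meets the hyperplane in a compact set, so finitely many of the balls of
`traceOn_facet_ball` cover it. -/
theorem traceOn_facet {P : Set (Space d)} (hP : IsPolytope P) {a b : ℝ} {k : ι}
    {σ : ι → Bool} (hf : A.IsFacet P k σ) {u : SpaceTime d → ℝ} (hum : StronglyMeasurable u)
    (hu : MemH1 (P ×ˢ Ioo a b) u) :
    TraceOn (P ×ˢ Ioo a b) u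
      (((μHE[d - 1] : Measure (Space d)).restrict (A.face k σ)).prod
        (volume.restrict (Ioo a b))) := by
  have hKf : volume (P ×ˢ Ioo a b) ≠ ⊤ := by
    rw [Measure.volume_eq_prod, Measure.prod_prod]
    exact ENNReal.mul_ne_top hP.isBounded.measure_lt_top.ne (by simp)
  rcases (A.face k σ).eq_empty_or_nonempty with he | ⟨x, hx⟩
  · rw [he, Measure.restrict_empty, Measure.zero_prod]
    exact ⟨by simp, by simp⟩
  obtain ⟨z, hz⟩ : (A.cell σ).Nonempty := closure_nonempty_iff.1 ⟨x, A.mem_closure_of_mem_face hx⟩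
  obtain ⟨ρ, hρ, hzρ⟩ := Metric.isOpen_iff.1 (A.isOpen_cell σ) z hz
  have hcpt : IsCompact (closure (A.cell σ) ∩ A.plane k) := by
    refine IsCompact.inter_right ?_ (A.isClosed_plane k)
    exact hP.isCompact_closure.of_isClosed_subset isClosed_closure (closure_mono hf.1)
  obtain ⟨t, ht, htf, htc⟩ := hcpt.finite_cover_balls hρ
  have := htf.to_subtype
  refine TraceOn.of_le_sum (J := t) (ν := fun x₀ => ((μHE[d - 1] : Measure (Space d)).restrict
    (A.face k σ ∩ Metric.ball (x₀ : Space d) ρ)).prod (volume.restrict (Ioo a b)))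
    (fun x₀ => traceOn_facet_ball A hP.isOpen hf hKf hum hu hzρ hρ (ht x₀.2).2) ?_
  rw [← Measure.prod_sum_left]
  refine Measure.prod_mono (le_trans (Measure.restrict_mono ?_ le_rfl)
    Measure.restrict_iUnion_le) le_rfl
  intro y hy
  obtain ⟨x₀, hx₀, hy'⟩ := mem_iUnion₂.1 (htc ⟨A.mem_closure_of_mem_face hy, hy.1⟩)
  exact mem_iUnion.2 ⟨⟨x₀, hx₀⟩, hy, hy'⟩

end Facet

/-- Functions in `H¹` of a prism have square-integrable traces on its lateral boundary. -/
theorem traceOn_lateral {d : ℕ} {P : Set (Space d)} (hP : IsPolytope P) {a b : ℝ}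
    {u : SpaceTime d → ℝ} (hum : StronglyMeasurable u) (hu : MemH1 (P ×ˢ Ioo a b) u) :
    TraceOn (P ×ˢ Ioo a b) u
      (((μHE[d - 1] : Measure (Space d)).restrict (frontier P)).prod
        (volume.restrict (Ioo a b))) := by
  classical
  obtain ⟨ι, hι, A, hA⟩ := exists_arrangement (fun _ : Unit => P) fun _ => hP
  refine TraceOn.of_le_sum (fun f : {f : ι × (ι → Bool) // A.IsFacet P f.1 f.2} =>
    traceOn_facet A hP f.2 hum hu) ?_
  rw [← Measure.prod_sum_left]
  exact Measure.prod_mono (A.restrict_frontier_le hP (hA ())) le_rfl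

theorem aestronglyMeasurable_outwardNormal {d : ℕ} {P : Set (Space d)} (hP : IsPolytope P) :
    AEStronglyMeasurable (outwardNormal P)
      ((μHE[d - 1] : Measure (Space d)).restrict (frontier P)) := by
  classical
  obtain ⟨ι, hι, A, hA⟩ := exists_arrangement (fun _ : Unit => P) fun _ => hP
  refine AEStronglyMeasurable.mono_measure ?_ (A.restrict_frontier_le hP (hA ()))
  refine aestronglyMeasurable_sum_measure_iff.2 fun f => ?_
  refine (aestronglyMeasurable_const (b := -(sgn (f.1.2 f.1.1)) • A.normal f.1.1)).congr ?_
  refine (ae_restrict_iff' (A.measurableSet_face _ _)).2 (ae_of_all _ fun x hx => ?_)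
  exact (A.isOutwardNormal_of_isFacet hP.isOpen f.2 hx).outwardNormal_eq.symm

theorem norm_outwardNormal_le {d : ℕ} (P : Set (Space d)) (x : Space d) :
    ‖outwardNormal P x‖ ≤ 1 := by
  by_cases h : ∃ n, IsOutwardNormal P x n
  · obtain ⟨n, hn⟩ := h
    rw [hn.outwardNormal_eq, hn.1]
  · rw [outwardNormal, dif_neg h]; simp

/-! ### Integration by parts in time -/

/-- `∫ E U = (U(δ)² - U(0)²) / 2` for the absolutely continuous function `U` with derivative `E`. -/
theorem integral_mul_add_integral {E : ℝ → ℝ} {δ : ℝ} (hδ : 0 ≤ δ)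
    (hE : IntervalIntegrable E volume 0 δ) (c : ℝ) :
    ∫ s in (0 : ℝ)..δ, E s * (c + ∫ σ in (0 : ℝ)..s, E σ)
      = ((c + ∫ σ in (0 : ℝ)..δ, E σ) ^ 2 - c ^ 2) / 2 := by
  set U : ℝ → ℝ := fun s => c + ∫ σ in (0 : ℝ)..s, E σ with hU
  have hac : AbsolutelyContinuousOnInterval U 0 δ := by
    have h1 : AbsolutelyContinuousOnInterval (fun _ : ℝ => c) 0 δ :=
      ((LipschitzWith.const c).lipschitzOnWith (s := uIcc 0 δ)).absolutelyContinuousOnInterval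
    exact h1.add (hE.absolutelyContinuousOnInterval_intervalIntegral (by simp [hδ]))
  have hd : ∀ᵐ s, s ∈ uIoc 0 δ → deriv U s = E s := by
    filter_upwards [hE.ae_hasDerivAt_integral] with s hs hsδ
    exact ((hs (uIoc_subset_uIcc hsδ) 0 (by simp)).const_add c).deriv
  have h1 := hac.integral_deriv_mul_eq_sub hac
  have h2 : ∫ s in (0 : ℝ)..δ, deriv U s * U s + U s * deriv U s
      = ∫ s in (0 : ℝ)..δ, 2 * (E s * U s) := by
    refine intervalIntegral.integral_congr_ae ?_
    filter_upwards [hd] with s hs hsδ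
    rw [hs hsδ]; ring
  rw [h2, intervalIntegral.integral_const_mul] at h1
  have h3 : U 0 = c := by simp [hU]
  have h4 : U δ = c + ∫ σ in (0 : ℝ)..δ, E σ := rfl
  rw [h3, h4] at h1
  linarith

section Time

variable {d : ℕ}

/-- Upward vertical chart. -/
noncomputable def upEquiv (d : ℕ) : (Space d × ℝ) ≃L[ℝ] SpaceTime d :=
  ContinuousLinearEquiv.refl ℝ (Space d × ℝ)

/-- Downward vertical chart. -/
noncomputable def downEquiv (d : ℕ) : (Space d × ℝ) ≃L[ℝ] SpaceTime d :=
  (ContinuousLinearEquiv.refl ℝ (Space d)).prodCongr (ContinuousLinearEquiv.neg ℝ)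

theorem chart_up (a : ℝ) (x : Space d) (s : ℝ) :
    chart (upEquiv d) (0, a) (x, s) = (x, a + s) := by
  simp [chart, upEquiv]

theorem chart_down (b : ℝ) (x : Space d) (s : ℝ) :
    chart (downEquiv d) (0, b) (x, s) = (x, b - s) := by
  simp [chart, downEquiv, sub_eq_add_neg]

/-- The traces of an `H¹` function on the bottom and the top of a prism, and the absolutely
continuous representatives on the vertical segments that join them. -/
theorem exists_time_traces {P : Set (Space d)} (hP : IsOpen P) (hPb : Bornology.IsBounded P)
    {a b : ℝ} (hab : a < b) {u D : SpaceTime d → ℝ} (hum : StronglyMeasurable u)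
    (hDm : StronglyMeasurable D) (hu : MemLp u 2 (volume.restrict (P ×ˢ Ioo a b)))
    (hD : MemLp D 2 (volume.restrict (P ×ˢ Ioo a b)))
    (h : IsWeakDeriv (P ×ˢ Ioo a b) (0, 1) u D) :
    ∃ Ga Gb : Space d → ℝ, MemLp Ga 2 (volume.restrict P) ∧ MemLp Gb 2 (volume.restrict P) ∧
      ∀ᵐ x, x ∈ P → HasTraceAt (P ×ˢ Ioo a b) u (x, a) (Ga x) ∧
        HasTraceAt (P ×ˢ Ioo a b) u (x, b) (Gb x) ∧
        ∫ t in Ioo a b, D (x, t) * u (x, t) = (Gb x ^ 2 - Ga x ^ 2) / 2 := by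
  have hKm : MeasurableSet (P ×ˢ Ioo a b) := hP.measurableSet.prod measurableSet_Ioo
  have hKf : volume (P ×ˢ Ioo a b) ≠ ⊤ := by
    rw [Measure.volume_eq_prod, Measure.prod_prod]
    exact ENNReal.mul_ne_top hPb.measure_lt_top.ne (by simp)
  have hPf : (volume : Measure (Space d)) P ≠ ⊤ := hPb.measure_lt_top.ne
  set δ := b - a with hδ
  have hδ0 : 0 < δ := sub_pos.2 hab
  have hup : ∀ x ∈ P, ∀ s ∈ Ioo 0 δ, chart (upEquiv d) (0, a) (x, s) ∈ P ×ˢ Ioo a b := by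
    intro x hx s hs
    rw [chart_up]
    exact ⟨hx, by simp only [mem_Ioo] at hs ⊢; constructor <;> linarith [hs.1, hs.2]⟩
  have hdn : ∀ x ∈ P, ∀ s ∈ Ioo 0 δ, chart (downEquiv d) (0, b) (x, s) ∈ P ×ˢ Ioo a b := by
    intro x hx s hs
    rw [chart_down]
    exact ⟨hx, by simp only [mem_Ioo] at hs ⊢; constructor <;> linarith [hs.1, hs.2]⟩
  have hDn : IsWeakDeriv (P ×ˢ Ioo a b) (downEquiv d (0, 1)) u (fun p => -1 * D p) := by
    have e : downEquiv d (0, 1) = (-1 : ℝ) • ((0, 1) : SpaceTime d) := by simp [downEquiv]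
    rw [e]
    exact h.const_smul (-1)
  obtain ⟨Ga, hGa, hra⟩ := exists_trace_representative volume hKm hKf hum hDm hu hD
    (L := upEquiv d) (p₀ := (0, a)) (by simpa [upEquiv] using h) hP hδ0 hup
  obtain ⟨Gb, hGb, hrb⟩ := exists_trace_representative volume hKm hKf hum (hDm.const_mul (-1)) hu
    (hD.const_mul (-1)) (L := downEquiv d) (p₀ := (0, b)) hDn hP hδ0 hdn
  have near : ∀ x ∈ P, ∀ᶠ z in 𝓝 (x, (0 : ℝ)), z.1 ∈ P ∧ |z.2| < δ := by
    intro x hx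
    have h1 : ∀ᶠ z in 𝓝 (x, (0 : ℝ)), z.1 ∈ P :=
      continuous_fst.continuousAt.eventually_mem (hP.mem_nhds hx)
    have h2 : ∀ᶠ z in 𝓝 (x, (0 : ℝ)), |z.2| < δ := by
      have : Continuous fun z : Space d × ℝ => |z.2| := by fun_prop
      exact this.continuousAt.eventually_lt_const (by simpa using hδ0)
    exact h1.and h2
  have hTa := ae_hasTraceAt_chart volume hKf hum hDm hu hD hP hPf hδ0 hup (fun x hx => by
    filter_upwards [near x hx] with z hz
    obtain ⟨x', s⟩ := z
    rw [chart_up, mem_prod, mem_Ioo]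
    have := abs_lt.1 hz.2
    simp only at this ⊢
    constructor
    · intro h; linarith [h.2.1]
    · intro h; exact ⟨hz.1, by linarith, by linarith⟩) hGa hra
  have hTb := ae_hasTraceAt_chart volume hKf hum (hDm.const_mul (-1)) hu (hD.const_mul (-1)) hP hPf
    hδ0 hdn (fun x hx => by
    filter_upwards [near x hx] with z hz
    obtain ⟨x', s⟩ := z
    rw [chart_down, mem_prod, mem_Ioo]
    have := abs_lt.1 hz.2
    simp only at this ⊢
    constructor
    · intro h; linarith [h.2.2]
    · intro h; exact ⟨hz.1, by linarith, by linarith⟩) hGb hrb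
  refine ⟨Ga, Gb, hGa, hGb, ?_⟩
  filter_upwards [hTa, hTb, hra, hrb] with x h1 h2 h3 h4 hx
  have h1 := h1 hx
  have h2 := h2 hx
  rw [chart_up, add_zero] at h1
  rw [chart_down, sub_zero] at h2
  refine ⟨h1, h2, ?_⟩
  obtain ⟨h3i, h3⟩ := h3 hx
  obtain ⟨h4i, h4⟩ := h4 hx
  simp only [chart_up, chart_down] at h3i h3 h4
  set E : ℝ → ℝ := fun s => D (x, a + s) with hE
  have hEi : IntervalIntegrable E volume 0 δ := by
    rw [intervalIntegrable_iff_integrableOn_Ioo_of_le hδ0.le]; exact h3i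
  have hEs : ∀ s ∈ Ioo 0 δ, IntervalIntegrable E volume 0 s ∧ IntervalIntegrable E volume s δ :=
    fun s hs => ⟨hEi.mono_set (by
      rw [uIcc_of_le hs.1.le, uIcc_of_le hδ0.le]; exact Icc_subset_Icc_right hs.2.le),
      hEi.mono_set (by
      rw [uIcc_of_le hs.2.le, uIcc_of_le hδ0.le]; exact Icc_subset_Icc_left hs.1.le)⟩
  -- the two representatives are compared on one horizontal slice
  have hGab : Gb x = Ga x + ∫ σ in (0 : ℝ)..δ, E σ := by
    have h4' := (Measure.measurePreserving_sub_left volume δ).quasiMeasurePreserving.ae h4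
    obtain ⟨s, hs, e1, e2⟩ : ∃ s ∈ Ioo 0 δ, (s ∈ Ioo 0 δ → u (x, a + s) = Ga x
        + ∫ σ in Ioc 0 s, D (x, a + σ)) ∧ (δ - s ∈ Ioo 0 δ → u (x, b - (δ - s)) = Gb x
        + ∫ σ in Ioc 0 (δ - s), -1 * D (x, b - σ)) := by
      by_contra hcon
      push Not at hcon
      have hz : volume (Ioo 0 δ) = 0 := by
        refine measure_mono_null (fun s hs => ?_) (h3.and h4')
        intro hc
        obtain ⟨h5, h6⟩ := hcon s hs hc.1
        exact h6 (hc.2 h5)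
      simp [hδ0.not_ge] at hz
    have e1 := e1 hs
    have e2 := e2 ⟨by linarith [hs.2], by linarith [hs.1]⟩
    rw [show b - (δ - s) = a + s by rw [hδ]; ring, e1] at e2
    rw [← intervalIntegral.integral_of_le hs.1.le,
      ← intervalIntegral.integral_of_le (by linarith [hs.2] : (0 : ℝ) ≤ δ - s),
      intervalIntegral.integral_const_mul] at e2
    have e3 : ∫ σ in (0 : ℝ)..(δ - s), D (x, b - σ) = ∫ σ in s..δ, E σ := by
      have := intervalIntegral.integral_comp_sub_left (a := 0) (b := δ - s) E δ
      rw [sub_sub_cancel, sub_zero] at this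
      rw [← this]
      refine intervalIntegral.integral_congr fun σ _ => ?_
      simp only [hE, hδ]
      congr 2; ring
    rw [e3] at e2
    have e4 := intervalIntegral.integral_add_adjacent_intervals (hEs s hs).1 (hEs s hs).2
    have e5 : ∫ σ in (0 : ℝ)..s, D (x, a + σ) = ∫ σ in (0 : ℝ)..s, E σ := rfl
    linarith
  have hsub : ∫ t in Ioo a b, D (x, t) * u (x, t)
      = ∫ s in (0 : ℝ)..δ, E s * u (x, a + s) := by
    rw [← integral_Ioc_eq_integral_Ioo, ← intervalIntegral.integral_of_le hab.le]
    have := intervalIntegral.integral_comp_add_left (a := 0) (b := δ)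
      (fun t => D (x, t) * u (x, t)) a
    rw [add_zero, show a + δ = b by rw [hδ]; ring] at this
    rw [← this]
  rw [hsub, hGab, ← integral_mul_add_integral hδ0.le hEi (Ga x)]
  refine intervalIntegral.integral_congr_ae ?_
  have hne : ∀ᵐ s : ℝ, s ≠ δ := by simp [ae_iff]
  filter_upwards [h3, hne] with s hs hsne hsδ
  rw [uIoc_of_le hδ0.le] at hsδ
  have hs' : s ∈ Ioo 0 δ := ⟨hsδ.1, lt_of_le_of_ne hsδ.2 hsne⟩
  rw [hs hs', ← intervalIntegral.integral_of_le hs'.1.le]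

theorem MemH1.exists_derivT {K : Set (SpaceTime d)} {u : SpaceTime d → ℝ} (hu : MemH1 K u) :
    IsWeakDerivT K u (derivT K u) := by
  rw [derivT, dif_pos hu.2.2]
  exact hu.2.2.choose_spec

theorem MemH1.exists_gradX {K : Set (SpaceTime d)} {u : SpaceTime d → ℝ} (hu : MemH1 K u) :
    IsWeakGradX K u (gradX K u) := by
  rw [gradX, dif_pos hu.2.1]
  exact hu.2.1.choose_spec

/-- Integration by parts in time on a prism, with the traces on its bottom and top. -/
theorem time_traces {P : Set (Space d)} (hP : IsPolytope P) {a b : ℝ} (hab : a < b)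
    {u : SpaceTime d → ℝ} (hum : StronglyMeasurable u) (hu : MemH1 (P ×ˢ Ioo a b) u) :
    TraceOn (P ×ˢ Ioo a b) u ((volume.restrict P).map fun x => (x, a)) ∧
    TraceOn (P ×ˢ Ioo a b) u ((volume.restrict P).map fun x => (x, b)) ∧
    ∫ p in P ×ˢ Ioo a b, derivT (P ×ˢ Ioo a b) u p * u p
      = (∫ x in P, trace (P ×ˢ Ioo a b) u (x, b) ^ 2) / 2
        - (∫ x in P, trace (P ×ˢ Ioo a b) u (x, a) ^ 2) / 2 := by
  set K := P ×ˢ Ioo a b with hK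
  obtain ⟨Ga, Gb, hGa, hGb, hae⟩ := exists_time_traces hP.isOpen hP.isBounded hab hum
    (Lp.stronglyMeasurable (derivT K u)) hu.1 (Lp.memLp _) hu.exists_derivT
  have hae' := (ae_restrict_iff' hP.isOpen.measurableSet).2 hae
  have hme : ∀ c : ℝ, MeasurableEmbedding (fun x : Space d => (x, c)) := fun c =>
    MeasurableEmbedding.prodMk_right MeasurableEmbedding.id c
  have ta : (fun x => trace K u (x, a)) =ᵐ[volume.restrict P] Ga := by
    filter_upwards [hae'] with x hx using hx.1.trace_eq
  have tb : (fun x => trace K u (x, b)) =ᵐ[volume.restrict P] Gb := by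
    filter_upwards [hae'] with x hx using hx.2.1.trace_eq
  refine ⟨⟨?_, ?_⟩, ⟨?_, ?_⟩, ?_⟩
  · rw [(hme a).ae_map_iff]
    filter_upwards [hae'] with x hx using ⟨_, hx.1⟩
  · rw [(hme a).memLp_map_measure_iff]
    exact hGa.ae_eq ta.symm
  · rw [(hme b).ae_map_iff]
    filter_upwards [hae'] with x hx using ⟨_, hx.2.1⟩
  · rw [(hme b).memLp_map_measure_iff]
    exact hGb.ae_eq tb.symm
  · have hint : Integrable (fun p => derivT K u p * u p) (volume.restrict K) :=
      (Lp.memLp (derivT K u)).integrable_mul hu.1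
    have e : volume.restrict K = (volume.restrict P).prod (volume.restrict (Ioo a b)) := by
      rw [Measure.prod_restrict]; rfl
    have e1 : ∫ p in K, derivT K u p * u p
        = ∫ x in P, ∫ t in Ioo a b, derivT K u (x, t) * u (x, t) := by
      have := integral_prod (μ := volume.restrict P) (ν := volume.restrict (Ioo a b))
        (fun p => derivT K u p * u p) (by rw [← e]; exact hint)
      rw [← this, ← e]
    rw [e1, integral_congr_ae (g := fun x => Gb x ^ 2 / 2 - Ga x ^ 2 / 2)]
    · rw [integral_sub (hGb.integrable_sq.div_const 2) (hGa.integrable_sq.div_const 2),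
        integral_div, integral_div]
      congr 2
      · exact integral_congr_ae (by filter_upwards [tb] with x hx; rw [hx])
      · exact integral_congr_ae (by filter_upwards [ta] with x hx; rw [hx])
    · filter_upwards [hae'] with x hx
      rw [hx.2.2]; ring

end Time

/-! ### Linear operators and bilinear forms defined almost everywhere -/

section AELin

variable {X Y : Type*} [AddCommGroup X] [Module ℝ X] [AddCommGroup Y] [Module ℝ Y]
variable {α β : Type*} [MeasurableSpace α] [MeasurableSpace β] {ν : Measure α}
variable {E E' : Type*} [NormedAddCommGroup E] [NormedAddCommGroup E']

/-- `T` sends the vectors of `X` to square-integrable functions, and is linear up to equality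
almost everywhere. -/
structure AELin [NormedSpace ℝ E] (ν : Measure α) (T : X → α → E) : Prop where
  memLp : ∀ x, MemLp (T x) 2 ν
  map_add : ∀ x y, T (x + y) =ᵐ[ν] fun p => T x p + T y p
  map_smul : ∀ (c : ℝ) x, T (c • x) =ᵐ[ν] fun p => c • T x p

namespace AELin

variable [NormedSpace ℝ E] [NormedSpace ℝ E'] {T S : X → α → E}

/-- The linear map into `L²` that underlies an almost everywhere linear operator. -/
noncomputable def toLin (h : AELin ν T) : X →ₗ[ℝ] Lp E 2 ν where
  toFun x := (h.memLp x).toLp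
  map_add' x y := by
    rw [← MemLp.toLp_add]
    exact (MemLp.toLp_eq_toLp_iff _ _).2 (h.map_add x y)
  map_smul' c x := by
    rw [RingHom.id_apply, ← MemLp.toLp_const_smul]
    exact (MemLp.toLp_eq_toLp_iff _ _).2 (h.map_smul c x)

theorem coe_toLin (h : AELin ν T) (x : X) : (h.toLin x : α → E) =ᵐ[ν] T x :=
  (h.memLp x).coeFn_toLp

theorem mono_measure (h : AELin ν T) {ν' : Measure α} (hle : ν' ≤ ν) : AELin ν' T :=
  ⟨fun x => (h.memLp x).mono_measure hle, fun x y => ae_mono hle (h.map_add x y),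
    fun c x => ae_mono hle (h.map_smul c x)⟩

theorem comp_linear (h : AELin ν T) (l : Y →ₗ[ℝ] X) : AELin ν fun y => T (l y) :=
  ⟨fun x => h.memLp _, fun x y => by simpa using h.map_add (l x) (l y),
    fun c x => by simpa using h.map_smul c (l x)⟩

theorem of_map {e : β → α} (he : MeasurableEmbedding e) {ν : Measure β}
    (h : AELin (ν.map e) T) : AELin ν fun x p => T x (e p) :=
  ⟨fun x => (he.memLp_map_measure_iff).1 (h.memLp x), fun x y => he.ae_map_iff.1 (h.map_add x y),
    fun c x => he.ae_map_iff.1 (h.map_smul c x)⟩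

theorem add (h : AELin ν T) (h' : AELin ν S) : AELin ν fun x p => T x p + S x p := by
  refine ⟨fun x => (h.memLp x).add (h'.memLp x), fun x y => ?_, fun c x => ?_⟩
  · filter_upwards [h.map_add x y, h'.map_add x y] with p h1 h2
    rw [h1, h2]; abel
  · filter_upwards [h.map_smul c x, h'.map_smul c x] with p h1 h2
    rw [h1, h2, smul_add]

/-- Composition with a measurable and essentially bounded field of linear maps. -/
theorem apply (h : AELin ν T) (Φ : α → E →ₗ[ℝ] E') (C : ℝ)
    (hm : ∀ x, AEStronglyMeasurable (fun p => Φ p (T x p)) ν)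
    (hC : ∀ᵐ p ∂ν, ∀ y, ‖Φ p y‖ ≤ C * ‖y‖) : AELin ν fun x p => Φ p (T x p) := by
  refine ⟨fun x => (h.memLp x).of_le_mul (c := C) (hm x) ?_, fun x y => ?_, fun c x => ?_⟩
  · filter_upwards [hC] with p hp using hp _
  · filter_upwards [h.map_add x y] with p h1
    rw [h1, _root_.map_add]
  · filter_upwards [h.map_smul c x] with p h1
    rw [h1, _root_.map_smul]

theorem mul_left (h : AELin ν T) {a : α → ℝ} (ha : AEStronglyMeasurable a ν) (C : ℝ)
    (hC : ∀ᵐ p ∂ν, |a p| ≤ C) : AELin ν fun x p => a p • T x p := by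
  refine h.apply (fun p => a p • LinearMap.id) C (fun x => ha.smul (h.memLp x).1) ?_
  filter_upwards [hC] with p hp y
  simp only [LinearMap.smul_apply, LinearMap.id_apply, norm_smul, Real.norm_eq_abs]
  gcongr

theorem smul_vec {T : X → α → ℝ} (h : AELin ν T) {n : α → E} (hn : AEStronglyMeasurable n ν)
    (hC : ∀ p, ‖n p‖ ≤ 1) : AELin ν fun x p => T x p • n p := by
  refine h.apply (fun p => LinearMap.toSpanSingleton ℝ E (n p)) 1
    (fun x => (h.memLp x).1.smul hn) (ae_of_all _ fun p y => ?_)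
  simp only [LinearMap.toSpanSingleton_apply, norm_smul, one_mul]
  exact mul_le_of_le_one_right (norm_nonneg _) (hC p)

end AELin

theorem AELin.inner_vec {F : Type*} [NormedAddCommGroup F] [InnerProductSpace ℝ F]
    {T : X → α → F} (h : AELin ν T) {n : α → F} (hn : AEStronglyMeasurable n ν)
    (hC : ∀ p, ‖n p‖ ≤ 1) : AELin ν fun x p => (inner ℝ (T x p) (n p) : ℝ) := by
  have := h.apply (fun p => innerₗ F (n p)) 1 (fun x => hn.inner (h.memLp x).1)
    (ae_of_all _ fun p y => (norm_inner_le_norm _ _).trans (by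
      gcongr; exact hC p))
  simpa only [innerₗ_apply_apply, real_inner_comm] using this

/-- `B` is a bilinear form. -/
def IsBilin (B : X → Y → ℝ) : Prop := ∃ b : X →ₗ[ℝ] Y →ₗ[ℝ] ℝ, ∀ x y, b x y = B x y

/-- `l` is a linear form. -/
def IsLin (l : X → ℝ) : Prop := ∃ b : X →ₗ[ℝ] ℝ, ∀ x, b x = l x

theorem IsBilin.add {B B' : X → Y → ℝ} (h : IsBilin B) (h' : IsBilin B') :
    IsBilin fun x y => B x y + B' x y := by
  obtain ⟨b, hb⟩ := h
  obtain ⟨b', hb'⟩ := h'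
  exact ⟨b + b', fun x y => by simp [hb, hb']⟩

theorem IsBilin.sub {B B' : X → Y → ℝ} (h : IsBilin B) (h' : IsBilin B') :
    IsBilin fun x y => B x y - B' x y := by
  obtain ⟨b, hb⟩ := h
  obtain ⟨b', hb'⟩ := h'
  exact ⟨b - b', fun x y => by simp [hb, hb']⟩

theorem IsBilin.sum {ι : Type*} {s : Finset ι} {B : ι → X → Y → ℝ} (h : ∀ i ∈ s, IsBilin (B i)) :
    IsBilin fun x y => ∑ i ∈ s, B i x y := by
  classical
  choose! b hb using h
  exact ⟨∑ i ∈ s, b i, fun x y => by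
    simp only [LinearMap.sum_apply]
    exact Finset.sum_congr rfl fun i hi => hb i hi x y⟩

theorem IsBilin.flip {B : X → Y → ℝ} (h : IsBilin B) : IsBilin fun y x => B x y := by
  obtain ⟨b, hb⟩ := h
  exact ⟨b.flip, fun x y => by simp [hb]⟩

theorem IsLin.add {l l' : X → ℝ} (h : IsLin l) (h' : IsLin l') : IsLin fun x => l x + l' x := by
  obtain ⟨b, hb⟩ := h
  obtain ⟨b', hb'⟩ := h'
  exact ⟨b + b', fun x => by simp [hb, hb']⟩

theorem IsLin.neg {l : X → ℝ} (h : IsLin l) : IsLin fun x => - l x := by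
  obtain ⟨b, hb⟩ := h
  exact ⟨-b, fun x => by simp [hb]⟩

theorem IsLin.sum {ι : Type*} {s : Finset ι} {B : ι → X → ℝ} (h : ∀ i ∈ s, IsLin (B i)) :
    IsLin fun x => ∑ i ∈ s, B i x := by
  classical
  choose! b hb using h
  exact ⟨∑ i ∈ s, b i, fun x => by
    simp only [LinearMap.sum_apply]
    exact Finset.sum_congr rfl fun i hi => hb i hi x⟩

theorem AELin.isBilin_inner {F : Type*} [NormedAddCommGroup F] [InnerProductSpace ℝ F]
    {T : X → α → F} {S : Y → α → F} (hT : AELin ν T) (hS : AELin ν S) :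
    IsBilin fun x y => ∫ p, (inner ℝ (T x p) (S y p) : ℝ) ∂ν := by
  refine ⟨(innerₗ (Lp F 2 ν)).compl₁₂ hT.toLin hS.toLin, fun x y => ?_⟩
  rw [LinearMap.compl₁₂_apply, innerₗ_apply_apply, L2.inner_def]
  refine integral_congr_ae ?_
  filter_upwards [hT.coe_toLin x, hS.coe_toLin y] with p h1 h2
  rw [h1, h2]

theorem AELin.isBilin_mul {T : X → α → ℝ} {S : Y → α → ℝ} (hT : AELin ν T) (hS : AELin ν S) :
    IsBilin fun x y => ∫ p, T x p * S y p ∂ν := by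
  simpa [mul_comm] using hT.isBilin_inner hS

theorem AELin.isLin_mul {T : X → α → ℝ} (hT : AELin ν T) {g : α → ℝ} (hg : MemLp g 2 ν) :
    IsLin fun x => ∫ p, g p * T x p ∂ν := by
  refine ⟨(innerₗ (Lp ℝ 2 ν) hg.toLp) ∘ₗ hT.toLin, fun x => ?_⟩
  rw [LinearMap.comp_apply, innerₗ_apply_apply, L2.inner_def]
  refine integral_congr_ae ?_
  filter_upwards [hT.coe_toLin x, hg.coeFn_toLp] with p h1 h2
  rw [h1, h2]
  simp [mul_comm]

end AELin

/-! ### Linearity of traces and weak derivatives -/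

section

variable {d : ℕ} {F : Type*} [NormedAddCommGroup F] [NormedSpace ℝ F]
variable {K : Set (SpaceTime d)} {p : SpaceTime d} {w w' : SpaceTime d → F} {l l' : F}

theorem HasTraceAt.congr_ae (h : HasTraceAt K w p l) (hw : w =ᵐ[volume.restrict K] w') :
    HasTraceAt K w' p l := by
  refine Tendsto.congr (fun r => ?_) h
  exact average_congr (ae_restrict_of_ae_restrict_of_subset inter_subset_left hw)

theorem HasTraceAt.add (h : HasTraceAt K w p l) (h' : HasTraceAt K w' p l')
    (hw : IntegrableOn w K) (hw' : IntegrableOn w' K) :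
    HasTraceAt K (fun z => w z + w' z) p (l + l') := by
  refine Tendsto.congr (fun r => ?_) (Tendsto.add h h')
  rw [setAverage_eq, setAverage_eq, setAverage_eq, ← smul_add, integral_add]
  · exact hw.mono_set inter_subset_left
  · exact hw'.mono_set inter_subset_left

theorem HasTraceAt.const_smul (h : HasTraceAt K w p l) (c : ℝ) :
    HasTraceAt K (fun z => c • w z) p (c • l) := by
  refine Tendsto.congr (fun r => ?_) (Tendsto.const_smul h c)
  rw [setAverage_eq, setAverage_eq, smul_comm, integral_smul]

/-- Traces are linear on the functions that have them. -/
theorem AELin.trace (hK : volume K ≠ ⊤) {W : Submodule ℝ (Lp F 2 (volume.restrict K))}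
    {ν : Measure (SpaceTime d)} (h : ∀ w ∈ W, TraceOn K w ν) :
    AELin ν fun w : W => trace K ((w : Lp F 2 (volume.restrict K)) : SpaceTime d → F) := by
  have : IsFiniteMeasure (volume.restrict K) := ⟨by simpa using hK.lt_top⟩
  have hi : ∀ w : Lp F 2 (volume.restrict K), IntegrableOn w K := fun w =>
    (Lp.memLp w).integrable one_le_two
  refine ⟨fun w => (h w w.2).memLp, fun x y => ?_, fun c x => ?_⟩
  · filter_upwards [(h x x.2).1, (h y y.2).1] with p ⟨l, hl⟩ ⟨l', hl'⟩
    rw [hl.trace_eq, hl'.trace_eq]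
    refine HasTraceAt.trace_eq ((hl.add hl' (hi _) (hi _)).congr_ae ?_)
    filter_upwards [Lp.coeFn_add (x : Lp F 2 (volume.restrict K)) y] with z hz
    simp only [Submodule.coe_add]
    rw [hz]; rfl
  · filter_upwards [(h x x.2).1] with p ⟨l, hl⟩
    rw [hl.trace_eq]
    refine HasTraceAt.trace_eq ((hl.const_smul c).congr_ae ?_)
    filter_upwards [Lp.coeFn_smul c (x : Lp F 2 (volume.restrict K))] with z hz
    simp only [Submodule.coe_smul]
    rw [hz]; rfl

/-- The trace of a vector field is taken componentwise. -/
theorem TraceOn.of_components {r : SpaceTime d → Space d} (hr : IntegrableOn r K)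
    {ν : Measure (SpaceTime d)} (h : ∀ k, TraceOn K (fun p => r p k) ν) : TraceOn K r ν := by
  have key : ∀ p, ∀ l : Fin d → ℝ, (∀ k, HasTraceAt K (fun p => r p k) p (l k)) →
      HasTraceAt K r p (WithLp.toLp 2 l) := by
    intro p l hl
    have h1 : Tendsto (fun ρ => WithLp.toLp 2 fun k => ⨍ z in K ∩ Metric.ball p ρ, r z k)
        (𝓝[>] (0 : ℝ)) (𝓝 (WithLp.toLp 2 l)) :=
      ((PiLp.continuous_toLp 2 fun _ : Fin d => ℝ).tendsto l).comp (tendsto_pi_nhds.2 hl)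
    refine Tendsto.congr (fun ρ => ?_) h1
    ext k
    have h2 := (EuclideanSpace.proj k : Space d →L[ℝ] ℝ).integral_comp_comm
      (hr.mono_set (inter_subset_left (t := Metric.ball p ρ)))
    simp only [setAverage_eq, PiLp.smul_apply]
    congr 1
  have hae : ∀ᵐ p ∂ν, ∀ k, ∃ l, HasTraceAt K (fun p => r p k) p l :=
    ae_all_iff.2 fun k => (h k).1
  refine ⟨?_, ?_⟩
  · filter_upwards [hae] with p hp
    choose l hl using hp
    exact ⟨_, key p l hl⟩
  · refine MemLp.of_eval_piLp fun k => (h k).2.ae_eq ?_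
    filter_upwards [hae] with p hp
    choose l hl using hp
    rw [(key p l hl).trace_eq, (hl k).trace_eq]

theorem IsWeakDeriv.congr_ae {v : SpaceTime d} {u u' D : SpaceTime d → ℝ}
    (h : IsWeakDeriv K v u D) (hu : u =ᵐ[volume.restrict K] u') : IsWeakDeriv K v u' D := by
  intro φ h1 h2 h3
  rw [← h φ h1 h2 h3]
  refine integral_congr_ae ?_
  filter_upwards [hu] with p hp
  rw [hp]

/-- Uniqueness of the weak derivative. -/
theorem IsWeakDeriv.ae_eq {v : SpaceTime d} {u D D' : SpaceTime d → ℝ} (hK : IsOpen K)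
    (h : IsWeakDeriv K v u D) (h' : IsWeakDeriv K v u D') (hD : IntegrableOn D K)
    (hD' : IntegrableOn D' K) : D =ᵐ[volume.restrict K] D' := by
  have hz : ∀ᵐ p, p ∈ K → D p - D' p = 0 := by
    refine hK.ae_eq_zero_of_integral_contDiff_smul_eq_zero
      (hD.sub hD').locallyIntegrableOn fun φ h1 h2 h3 => ?_
    have hb : ∃ C, ∀ p, ‖φ p‖ ≤ C := h2.exists_bound_of_continuous h1.continuous
    obtain ⟨C, hC⟩ := hb
    have hi : ∀ g : SpaceTime d → ℝ, IntegrableOn g K → IntegrableOn (fun p => g p * φ p) K :=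
      fun g hg => Integrable.mul_bdd (c := C) hg h1.continuous.aestronglyMeasurable
        (ae_of_all _ hC)
    rw [← setIntegral_eq_integral_of_forall_compl_eq_zero (s := K)]
    · have e : ∫ p in K, φ p • (D p - D' p) = ∫ p in K, D p * φ p - D' p * φ p :=
        integral_congr_ae (ae_of_all _ fun p => by simp only [smul_eq_mul]; ring)
      rw [e, integral_sub (hi _ hD) (hi _ hD')]
      have e1 := h φ h1 h2 h3
      have e2 := h' φ h1 h2 h3
      linarith
    · intro p hp
      rw [image_eq_zero_of_notMem_tsupport fun hh => hp (h3 hh), zero_smul]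
  filter_upwards [(ae_restrict_iff' hK.measurableSet).2 hz] with p hp
  linarith

/-- Additivity of the weak derivative in the function. -/
theorem IsWeakDeriv.add_fun {v : SpaceTime d} {u u' D D' : SpaceTime d → ℝ}
    (hu : IntegrableOn u K) (hu' : IntegrableOn u' K)
    (hD : IntegrableOn D K) (hD' : IntegrableOn D' K) (h : IsWeakDeriv K v u D)
    (h' : IsWeakDeriv K v u' D') :
    IsWeakDeriv K v (fun p => u p + u' p) fun p => D p + D' p := by
  intro φ h1 h2 h3
  have hd1 : Continuous fun p => fderiv ℝ φ p v :=
    (h1.continuous_fderiv (by simp)).clm_apply continuous_const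
  have hd2 : HasCompactSupport fun p => fderiv ℝ φ p v := h2.fderiv_apply (𝕜 := ℝ) v
  obtain ⟨C, hC⟩ := h2.exists_bound_of_continuous h1.continuous
  obtain ⟨C', hC'⟩ := hd2.exists_bound_of_continuous hd1
  have hi : ∀ g : SpaceTime d → ℝ, IntegrableOn g K → IntegrableOn (fun p => g p * φ p) K :=
    fun g hg => Integrable.mul_bdd (c := C) hg h1.continuous.aestronglyMeasurable
      (ae_of_all _ hC)
  have hi' : ∀ g : SpaceTime d → ℝ, IntegrableOn g K →
      IntegrableOn (fun p => g p * fderiv ℝ φ p v) K :=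
    fun g hg => Integrable.mul_bdd (c := C') hg hd1.aestronglyMeasurable (ae_of_all _ hC')
  simp only [add_mul]
  rw [integral_add (hi' _ hu) (hi' _ hu'), integral_add (hi _ hD) (hi _ hD'), h φ h1 h2 h3,
    h' φ h1 h2 h3]
  ring

theorem IsWeakDeriv.const_smul_fun {v : SpaceTime d} {u D : SpaceTime d → ℝ}
    (h : IsWeakDeriv K v u D) (c : ℝ) :
    IsWeakDeriv K v (fun p => c * u p) fun p => c * D p := by
  intro φ h1 h2 h3
  simp only [mul_assoc, integral_const_mul]
  rw [h φ h1 h2 h3]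
  ring

/-- The weak time derivative is linear on `H¹(K)`. -/
theorem AELin.derivT (hKo : IsOpen K) (hK : volume K ≠ ⊤)
    {W : Submodule ℝ (Lp ℝ 2 (volume.restrict K))} (h : ∀ w ∈ W, MemH1 K w) :
    AELin (volume.restrict K) fun w : W =>
      (derivT K ((w : Lp ℝ 2 (volume.restrict K)) : SpaceTime d → ℝ) : SpaceTime d → ℝ) := by
  have : IsFiniteMeasure (volume.restrict K) := ⟨by simpa using hK.lt_top⟩
  have hi : ∀ w : Lp ℝ 2 (volume.restrict K), IntegrableOn w K := fun w =>
    (Lp.memLp w).integrable one_le_two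
  refine ⟨fun w => Lp.memLp _, fun x y => ?_, fun c x => ?_⟩
  · refine IsWeakDeriv.ae_eq hKo (h _ (x + y).2).exists_derivT (IsWeakDeriv.congr_ae
      (IsWeakDeriv.add_fun (hi x) (hi y) (hi _) (hi _) (h _ x.2).exists_derivT
        (h _ y.2).exists_derivT) ?_) (hi _) ((hi _).add (hi _))
    filter_upwards [Lp.coeFn_add (x : Lp ℝ 2 (volume.restrict K)) y] with z hz
    simp only [Submodule.coe_add]
    rw [hz]; rfl
  · refine IsWeakDeriv.ae_eq hKo (h _ (c • x).2).exists_derivT (IsWeakDeriv.congr_ae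
      (IsWeakDeriv.const_smul_fun (h _ x.2).exists_derivT c) ?_) (hi _) ((hi _).const_mul c)
    filter_upwards [Lp.coeFn_smul c (x : Lp ℝ 2 (volume.restrict K))] with z hz
    simp only [Submodule.coe_smul]
    rw [hz]; rfl

/-- The weak spatial gradient is linear on `H¹(K)`. -/
theorem AELin.gradX (hKo : IsOpen K) (hK : volume K ≠ ⊤)
    {W : Submodule ℝ (Lp ℝ 2 (volume.restrict K))} (h : ∀ w ∈ W, MemH1 K w) :
    AELin (volume.restrict K) fun w : W =>
      (gradX K ((w : Lp ℝ 2 (volume.restrict K)) : SpaceTime d → ℝ) : SpaceTime d → Space d) := by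
  have : IsFiniteMeasure (volume.restrict K) := ⟨by simpa using hK.lt_top⟩
  have hi : ∀ w : Lp ℝ 2 (volume.restrict K), IntegrableOn w K := fun w =>
    (Lp.memLp w).integrable one_le_two
  have hi' : ∀ (w : Lp (Space d) 2 (volume.restrict K)) (k : Fin d),
      IntegrableOn (fun p => w p k) K := fun w k =>
    ((Lp.memLp w).integrable one_le_two).eval_piLp k
  refine ⟨fun w => Lp.memLp _, fun x y => ?_, fun c x => ?_⟩
  · have hk : ∀ k, (fun p => (SpaceTimeLDG.gradX K (x + y : W) : SpaceTime d → Space d) p k)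
        =ᵐ[volume.restrict K] fun p => SpaceTimeLDG.gradX K x p k + SpaceTimeLDG.gradX K y p k := by
      intro k
      refine IsWeakDeriv.ae_eq hKo ((h _ (x + y).2).exists_gradX k) (IsWeakDeriv.congr_ae
        (IsWeakDeriv.add_fun (hi x) (hi y) (hi' _ k) (hi' _ k) ((h _ x.2).exists_gradX k)
          ((h _ y.2).exists_gradX k)) ?_) (hi' _ k) ((hi' _ k).add (hi' _ k))
      filter_upwards [Lp.coeFn_add (x : Lp ℝ 2 (volume.restrict K)) y] with z hz
      simp only [Submodule.coe_add]
      rw [hz]; rfl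
    filter_upwards [ae_all_iff.2 hk] with p hp
    ext k
    exact hp k
  · have hk : ∀ k, (fun p => (SpaceTimeLDG.gradX K (c • x : W) : SpaceTime d → Space d) p k)
        =ᵐ[volume.restrict K] fun p => c * SpaceTimeLDG.gradX K x p k := by
      intro k
      refine IsWeakDeriv.ae_eq hKo ((h _ (c • x).2).exists_gradX k) (IsWeakDeriv.congr_ae
        (IsWeakDeriv.const_smul_fun ((h _ x.2).exists_gradX k) c) ?_) (hi' _ k)
        ((hi' _ k).const_mul c)
      filter_upwards [Lp.coeFn_smul c (x : Lp ℝ 2 (volume.restrict K))] with z hz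
      simp only [Submodule.coe_smul]
      rw [hz]; rfl
    filter_upwards [ae_all_iff.2 hk] with p hp
    ext k
    simpa using hp k

theorem AELin.coe {μ : Measure (SpaceTime d)} (W : Submodule ℝ (Lp F 2 μ)) :
    AELin μ fun w : W => ((w : Lp F 2 μ) : SpaceTime d → F) :=
  ⟨fun _ => Lp.memLp _, fun x y => Lp.coeFn_add (x : Lp F 2 μ) y,
    fun c x => Lp.coeFn_smul c (x : Lp F 2 μ)⟩

end

/-! ### Inverses of coercive matrices -/

section Matrix

variable {d : ℕ} {A : Matrix (Fin d) (Fin d) ℝ} {θ : ℝ}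

/-- A coercive matrix is invertible, so that `A⁻¹` is not the junk value of the matrix inverse. -/
theorem toEuclideanLin_mul_inv_of_coercive (hθ : 0 < θ)
    (hA : ∀ y : Space d, θ * ‖y‖ ^ 2 ≤ inner ℝ y (Matrix.toEuclideanLin A y)) (z : Space d) :
    Matrix.toEuclideanLin A (Matrix.toEuclideanLin A⁻¹ z) = z := by
  have hinj : Function.Injective A.mulVec := by
    rw [← Matrix.coe_mulVecLin, ← LinearMap.ker_eq_bot, LinearMap.ker_eq_bot']
    intro w hw
    have h1 := hA (WithLp.toLp 2 w)
    have h2 : Matrix.toEuclideanLin A (WithLp.toLp 2 w) = 0 := by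
      rw [Matrix.mulVecLin_apply] at hw
      ext k
      simp [Matrix.toLpLin_toLp, hw]
    rw [h2, inner_zero_right] at h1
    have h3 : ‖WithLp.toLp 2 w‖ = 0 := by
      have : ‖WithLp.toLp 2 w‖ ^ 2 ≤ 0 := nonpos_of_mul_nonpos_right h1 hθ
      exact pow_eq_zero_iff two_ne_zero |>.1 (le_antisymm this (by positivity))
    have h4 := norm_eq_zero.1 h3
    simpa using congrArg WithLp.ofLp h4
  have hu : IsUnit A := Matrix.mulVec_injective_iff_isUnit.1 hinj
  have hd : IsUnit A.det := (Matrix.isUnit_iff_isUnit_det A).1 hu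
  ext k
  simp [Matrix.toLpLin_apply, Matrix.mul_nonsing_inv A hd]

theorem coercive_inv (hθ : 0 < θ)
    (hA : ∀ y : Space d, θ * ‖y‖ ^ 2 ≤ inner ℝ y (Matrix.toEuclideanLin A y)) (z : Space d) :
    θ * ‖Matrix.toEuclideanLin A⁻¹ z‖ ^ 2 ≤ inner ℝ (Matrix.toEuclideanLin A⁻¹ z) z := by
  have := hA (Matrix.toEuclideanLin A⁻¹ z)
  rwa [toEuclideanLin_mul_inv_of_coercive hθ hA] at this

theorem norm_inv_le_of_coercive (hθ : 0 < θ)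
    (hA : ∀ y : Space d, θ * ‖y‖ ^ 2 ≤ inner ℝ y (Matrix.toEuclideanLin A y)) (z : Space d) :
    ‖Matrix.toEuclideanLin A⁻¹ z‖ ≤ θ⁻¹ * ‖z‖ := by
  have h1 := (coercive_inv hθ hA z).trans (real_inner_le_norm _ _)
  rcases (norm_nonneg (Matrix.toEuclideanLin A⁻¹ z)).eq_or_lt with h | h
  · rw [← h]; positivity
  · rw [inv_mul_eq_div, le_div_iff₀ hθ]
    nlinarith

/-- The entries of the inverse are rational functions of the entries of the matrix. -/
theorem aestronglyMeasurable_inv_apply {α : Type*} [MeasurableSpace α] {ν : Measure α}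
    {κ : α → Matrix (Fin d) (Fin d) ℝ} (hκ : ∀ k l, AEMeasurable (fun p => κ p k l) ν)
    {q : α → Space d} (hq : AEStronglyMeasurable q ν) :
    AEStronglyMeasurable (fun p => Matrix.toEuclideanLin (κ p)⁻¹ (q p)) ν := by
  have h0 : AEMeasurable (fun p => (fun k l => κ p k l : Fin d → Fin d → ℝ)) ν :=
    aemeasurable_pi_lambda _ fun k => aemeasurable_pi_lambda _ fun l => hκ k l
  have hdet : AEMeasurable (fun p => (κ p).det) ν := by
    have : Continuous fun B : Fin d → Fin d → ℝ => Matrix.det (Matrix.of B) :=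
      Continuous.matrix_det continuous_id
    exact this.measurable.comp_aemeasurable h0
  have hadj : ∀ k l, AEMeasurable (fun p => (κ p).adjugate k l) ν := by
    intro k l
    have : Continuous fun B : Fin d → Fin d → ℝ => Matrix.adjugate (Matrix.of B) k l :=
      (Continuous.matrix_adjugate continuous_id).matrix_elem k l
    exact this.measurable.comp_aemeasurable h0
  have hent : ∀ k l, AEMeasurable (fun p => (κ p)⁻¹ k l) ν := by
    intro k l
    have := hdet.inv.mul (hadj k l)
    refine this.congr (ae_of_all _ fun p => ?_)
    simp [Matrix.inv_def, Ring.inverse_eq_inv']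
  have hqc : ∀ l, AEMeasurable (fun p => q p l) ν := fun l =>
    ((EuclideanSpace.proj (𝕜 := ℝ) l).continuous.measurable.comp_aemeasurable hq.aemeasurable)
  have hres : AEMeasurable (fun p => fun k => ∑ l, (κ p)⁻¹ k l * q p l) ν :=
    aemeasurable_pi_lambda _ fun k =>
      Finset.aemeasurable_fun_sum _ fun l _ => (hent k l).mul (hqc l)
  have h3 := (PiLp.continuous_toLp 2 fun _ : Fin d => ℝ).measurable.comp_aemeasurable hres
  refine (h3.aestronglyMeasurable).congr (ae_of_all _ fun p => ?_)
  ext k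
  simp [Matrix.toLpLin_apply, Matrix.mulVec, dotProduct]

end Matrix

theorem exists_ae_abs_le_of_memLp_top {α : Type*} [MeasurableSpace α] {ν : Measure α} {η : α → ℝ}
    (h : MemLp η ⊤ ν) : ∃ C, ∀ᵐ p ∂ν, |η p| ≤ C := by
  have h1 := h.2
  rw [eLpNorm_exponent_top] at h1
  refine ⟨(eLpNormEssSup η ν).toReal, ?_⟩
  filter_upwards [ae_le_eLpNormEssSup (f := η) (μ := ν)] with p hp
  have := ENNReal.toReal_mono h1.ne hp
  simpa using this

/-! ### Linearity of the forms of the method -/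

namespace PrismaticMesh

section Forms

variable {d N : ℕ} {Ω : Set (Space d)} {T : ℝ} (𝒯 : PrismaticMesh Ω T N)

theorem isOpen_elem (i : Fin N) : IsOpen (𝒯.elem i) :=
  (𝒯.isPolytope_base i).isOpen.prod isOpen_Ioo

theorem volume_elem_ne_top (i : Fin N) : volume (𝒯.elem i) ≠ ⊤ :=
  ((𝒯.isPolytope_base i).isBounded.prod (Metric.isBounded_Ioo _ _)).measure_lt_top.ne

theorem base_subset (i : Fin N) : 𝒯.base i ⊆ Ω := by
  intro x hx
  obtain ⟨t, ht⟩ := nonempty_Ioo.2 (𝒯.tbeg_lt_tend i)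
  exact (𝒯.elem_subset i (mk_mem_prod hx ht)).1

theorem time_subset (i : Fin N) : Ioo (𝒯.tbeg i) (𝒯.tend i) ⊆ Ioo 0 T := by
  intro t ht
  obtain ⟨x, hx⟩ := (𝒯.isPolytope_base i).isConnected.nonempty
  exact (𝒯.elem_subset i (mk_mem_prod hx ht)).2

/-- Surface measure on the lateral boundary of `K_i`. -/
noncomputable def lateralMeasure (i : Fin N) : Measure (SpaceTime d) :=
  ((μHE[d - 1] : Measure (Space d)).restrict (frontier (𝒯.base i))).prod
    (volume.restrict (Ioo (𝒯.tbeg i) (𝒯.tend i)))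

theorem timeFacetMeasure_le_left (i j : Fin N) : 𝒯.timeFacetMeasure i j ≤ 𝒯.lateralMeasure i :=
  Measure.prod_mono (Measure.restrict_mono inter_subset_left le_rfl)
    (Measure.restrict_mono inter_subset_left le_rfl)

theorem timeFacetMeasure_le_right (i j : Fin N) : 𝒯.timeFacetMeasure i j ≤ 𝒯.lateralMeasure j :=
  Measure.prod_mono (Measure.restrict_mono inter_subset_right le_rfl)
    (Measure.restrict_mono inter_subset_right le_rfl)

theorem dirichletFacetMeasure_le (i : Fin N) : 𝒯.dirichletFacetMeasure i ≤ 𝒯.lateralMeasure i :=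
  Measure.prod_mono (Measure.restrict_mono inter_subset_left le_rfl) le_rfl

theorem timeFacetMeasure_le_skeleton {i j : Fin N} (hij : i < j) :
    𝒯.timeFacetMeasure i j ≤ 𝒯.timeSkeletonMeasure := by
  refine le_trans ?_ (Finset.single_le_sum
    (f := fun i => ∑ j ∈ Finset.Ioi i, 𝒯.timeFacetMeasure i j)
    (fun _ _ => Measure.zero_le _) (Finset.mem_univ i))
  exact Finset.single_le_sum (f := fun j => 𝒯.timeFacetMeasure i j)
    (fun _ _ => Measure.zero_le _) (Finset.mem_Ioi.2 hij)

theorem dirichletFacetMeasure_le_skeleton (i : Fin N) :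
    𝒯.dirichletFacetMeasure i ≤ 𝒯.dirichletSkeletonMeasure :=
  Finset.single_le_sum (f := fun i => 𝒯.dirichletFacetMeasure i)
    (fun _ _ => Measure.zero_le _) (Finset.mem_univ i)

theorem aestronglyMeasurable_normal (i : Fin N) :
    AEStronglyMeasurable (𝒯.normal i) (𝒯.lateralMeasure i) :=
  (aestronglyMeasurable_outwardNormal (𝒯.isPolytope_base i)).comp_quasiMeasurePreserving
    Measure.quasiMeasurePreserving_fst

theorem aestronglyMeasurable_outwardNormal_domain (hΩ : IsPolytope Ω) (i : Fin N) :
    AEStronglyMeasurable (fun p : SpaceTime d => outwardNormal Ω p.1)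
      (𝒯.dirichletFacetMeasure i) :=
  ((aestronglyMeasurable_outwardNormal hΩ).mono_measure
    (Measure.restrict_mono inter_subset_right le_rfl)).comp_quasiMeasurePreserving
    Measure.quasiMeasurePreserving_fst

variable {V : ∀ i, Submodule ℝ (Lp ℝ 2 (volume.restrict (𝒯.elem i)))}
variable {M : ∀ i, Submodule ℝ (Lp (Space d) 2 (volume.restrict (𝒯.elem i)))}

variable {𝒯} in
/-- The broken function given by an element of the discrete space. -/
def toBroken (u : ∀ i, V i) : 𝒯.BrokenScalar := fun i => u i

variable {𝒯} in
/-- The broken vector field given by an element of the discrete space. -/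
def toBrokenV (r : ∀ i, M i) : 𝒯.BrokenVector := fun i => r i

section Scalar

variable (hV : ∀ i, ∀ v ∈ V i, MemH1 (𝒯.elem i) v)
include hV

theorem aelin_trS (i : Fin N) :
    AELin (𝒯.lateralMeasure i) fun u : ∀ i, V i => trS (toBroken u) i :=
  (AELin.trace (𝒯.volume_elem_ne_top i) fun w hw =>
    traceOn_lateral (𝒯.isPolytope_base i) (Lp.stronglyMeasurable w) (hV i w hw)).comp_linear
    (LinearMap.proj (R := ℝ) (φ := fun i => V i) i)

theorem aelin_trS_tbeg (i : Fin N) :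
    AELin (volume.restrict (𝒯.base i)) fun (u : ∀ i, V i) x =>
      trS (toBroken u) i (x, 𝒯.tbeg i) :=
  ((AELin.trace (𝒯.volume_elem_ne_top i) fun w hw =>
    (time_traces (𝒯.isPolytope_base i) (𝒯.tbeg_lt_tend i) (Lp.stronglyMeasurable w)
      (hV i w hw)).1).of_map (MeasurableEmbedding.prodMk_right MeasurableEmbedding.id _)).comp_linear
    (LinearMap.proj (R := ℝ) (φ := fun i => V i) i)

theorem aelin_trS_tend (i : Fin N) :
    AELin (volume.restrict (𝒯.base i)) fun (u : ∀ i, V i) x =>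
      trS (toBroken u) i (x, 𝒯.tend i) :=
  ((AELin.trace (𝒯.volume_elem_ne_top i) fun w hw =>
    (time_traces (𝒯.isPolytope_base i) (𝒯.tbeg_lt_tend i) (Lp.stronglyMeasurable w)
      (hV i w hw)).2.1).of_map
        (MeasurableEmbedding.prodMk_right MeasurableEmbedding.id _)).comp_linear
    (LinearMap.proj (R := ℝ) (φ := fun i => V i) i)

theorem aelin_derivT (i : Fin N) :
    AELin (volume.restrict (𝒯.elem i)) fun u : ∀ i, V i =>
      (derivT (𝒯.elem i) (toBroken u i) : SpaceTime d → ℝ) :=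
  (AELin.derivT (𝒯.isOpen_elem i) (𝒯.volume_elem_ne_top i) (hV i)).comp_linear
    (LinearMap.proj (R := ℝ) (φ := fun i => V i) i)

theorem aelin_gradX (i : Fin N) :
    AELin (volume.restrict (𝒯.elem i)) fun u : ∀ i, V i =>
      (gradX (𝒯.elem i) (toBroken u i) : SpaceTime d → Space d) :=
  (AELin.gradX (𝒯.isOpen_elem i) (𝒯.volume_elem_ne_top i) (hV i)).comp_linear
    (LinearMap.proj (R := ℝ) (φ := fun i => V i) i)

theorem aelin_jumpN (i j : Fin N) :
    AELin (𝒯.timeFacetMeasure i j) fun u : ∀ i, V i => jumpN (toBroken u) i j :=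
  (((𝒯.aelin_trS hV i).mono_measure (𝒯.timeFacetMeasure_le_left i j)).smul_vec
      ((𝒯.aestronglyMeasurable_normal i).mono_measure (𝒯.timeFacetMeasure_le_left i j))
      fun _ => norm_outwardNormal_le _ _).add
    (((𝒯.aelin_trS hV j).mono_measure (𝒯.timeFacetMeasure_le_right i j)).smul_vec
      ((𝒯.aestronglyMeasurable_normal j).mono_measure (𝒯.timeFacetMeasure_le_right i j))
      fun _ => norm_outwardNormal_le _ _)

end Scalar

theorem aelin_toBroken (i : Fin N) :
    AELin (volume.restrict (𝒯.elem i)) fun u : ∀ i, V i =>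
      (toBroken u i : SpaceTime d → ℝ) :=
  (AELin.coe (V i)).comp_linear (LinearMap.proj (R := ℝ) (φ := fun i => V i) i)

theorem aelin_toBrokenV (i : Fin N) :
    AELin (volume.restrict (𝒯.elem i)) fun r : ∀ i, M i =>
      (toBrokenV r i : SpaceTime d → Space d) :=
  (AELin.coe (M i)).comp_linear (LinearMap.proj (R := ℝ) (φ := fun i => M i) i)

section Vector

variable (hM : ∀ i, ∀ r ∈ M i, ∀ k : Fin d, MemH1 (𝒯.elem i) (fun p => r p k))
include hM

theorem aelin_trV (i : Fin N) :
    AELin (𝒯.lateralMeasure i) fun r : ∀ i, M i => trV (toBrokenV r) i := by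
  refine (AELin.trace (𝒯.volume_elem_ne_top i) fun w hw => ?_).comp_linear (LinearMap.proj (R := ℝ) (φ := fun i => M i) i)
  have : IsFiniteMeasure (volume.restrict (𝒯.elem i)) :=
    ⟨by simpa using (𝒯.volume_elem_ne_top i).lt_top⟩
  refine TraceOn.of_components ((Lp.memLp w).integrable one_le_two) fun k => ?_
  exact traceOn_lateral (𝒯.isPolytope_base i)
    ((EuclideanSpace.proj (𝕜 := ℝ) k).continuous.comp_stronglyMeasurable
      (Lp.stronglyMeasurable w)) (hM i w hw k)

theorem aelin_avgV {α : SpaceTime d → ℝ} (hα_meas : AEMeasurable α 𝒯.timeSkeletonMeasure)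
    (hα : ∀ᵐ p ∂𝒯.timeSkeletonMeasure, α p ∈ Icc (0 : ℝ) 1) {i j : Fin N} (hij : i < j) :
    AELin (𝒯.timeFacetMeasure i j) fun (r : ∀ i, M i) p =>
      avgV (1 - α p) (toBrokenV r) i j p := by
  have hle := 𝒯.timeFacetMeasure_le_skeleton hij
  have hm : AEMeasurable α (𝒯.timeFacetMeasure i j) := hα_meas.mono_measure hle
  refine AELin.add (((𝒯.aelin_trV hM i).mono_measure
    (𝒯.timeFacetMeasure_le_left i j)).mul_left (a := fun p => 1 - (1 - α p))
    ((hm.const_sub 1).const_sub 1).aestronglyMeasurable 1 ?_)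
    (((𝒯.aelin_trV hM j).mono_measure (𝒯.timeFacetMeasure_le_right i j)).mul_left
      (a := fun p => 1 - α p) (hm.const_sub 1).aestronglyMeasurable 1 ?_)
  · filter_upwards [ae_mono hle hα] with p hp
    rw [sub_sub_cancel, abs_le]
    exact ⟨by linarith [hp.1], hp.2⟩
  · filter_upwards [ae_mono hle hα] with p hp
    rw [abs_le]
    exact ⟨by linarith [hp.2], by linarith [hp.1]⟩

end Vector

theorem isBilin_mForm (hV : ∀ i, ∀ v ∈ V i, MemH1 (𝒯.elem i) v) :
    IsBilin fun u v : ∀ i, V i => mForm (toBroken u) (toBroken v) := by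
  refine IsBilin.add (IsBilin.sub ?_ ?_) ?_
  · exact IsBilin.sum fun i _ => (𝒯.aelin_derivT hV i).isBilin_mul (𝒯.aelin_toBroken i)
  · refine IsBilin.sum fun i _ => IsBilin.sum fun j hj => IsBilin.flip ?_
    have hij : 𝒯.tend i = 𝒯.tbeg j := (Finset.mem_filter.1 hj).2
    have h1 := (𝒯.aelin_trS_tbeg hV j).mono_measure (Measure.restrict_mono
      (inter_subset_right (s := 𝒯.base i)) le_rfl)
    have h2 := (𝒯.aelin_trS_tend hV i).mono_measure (Measure.restrict_mono
      (inter_subset_left (t := 𝒯.base j)) le_rfl)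
    rw [hij] at h2
    have h3 := h2.add (h1.mul_left (a := fun _ => -1) aestronglyMeasurable_const 1 (by simp))
    simpa [sub_eq_add_neg] using h1.isBilin_mul h3
  · refine IsBilin.sum fun i hi => ?_
    have h0 : 𝒯.tbeg i = 0 := (Finset.mem_filter.1 hi).2
    have h1 := 𝒯.aelin_trS_tbeg hV i
    rw [h0] at h1
    exact h1.isBilin_mul h1

theorem isBilin_dForm {κ : SpaceTime d → Matrix (Fin d) (Fin d) ℝ}
    (hκ_meas : ∀ k l, AEMeasurable (fun p => κ p k l) (volume.restrict (cylinder Ω T)))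
    {θ : ℝ} (hθ : 0 < θ)
    (hκ : ∀ᵐ p ∂(volume.restrict (cylinder Ω T)),
      ∀ y : Space d, θ * ‖y‖ ^ 2 ≤ inner ℝ y (Matrix.toEuclideanLin (κ p) y)) :
    IsBilin fun q r : ∀ i, M i => dForm κ (toBrokenV q) (toBrokenV r) := by
  refine IsBilin.sum fun i _ => AELin.isBilin_inner ?_ (𝒯.aelin_toBrokenV i)
  have hle : volume.restrict (𝒯.elem i) ≤ volume.restrict (cylinder Ω T) :=
    Measure.restrict_mono (𝒯.elem_subset i) le_rfl
  refine (𝒯.aelin_toBrokenV i).apply (fun p => Matrix.toEuclideanLin (κ p)⁻¹) θ⁻¹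
    (fun r => aestronglyMeasurable_inv_apply (fun k l => (hκ_meas k l).mono_measure hle)
      (Lp.memLp _).1) ?_
  filter_upwards [ae_mono hle hκ] with p hp y using norm_inv_le_of_coercive hθ hp y

theorem isBilin_bForm (hΩ : IsPolytope Ω) (hV : ∀ i, ∀ v ∈ V i, MemH1 (𝒯.elem i) v)
    (hM : ∀ i, ∀ r ∈ M i, ∀ k : Fin d, MemH1 (𝒯.elem i) (fun p => r p k))
    {α : SpaceTime d → ℝ} (hα_meas : AEMeasurable α 𝒯.timeSkeletonMeasure)
    (hα : ∀ᵐ p ∂𝒯.timeSkeletonMeasure, α p ∈ Icc (0 : ℝ) 1) :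
    IsBilin fun (u : ∀ i, V i) (r : ∀ i, M i) => bForm α (toBroken u) (toBrokenV r) := by
  refine IsBilin.sub (IsBilin.sub ?_ ?_) ?_
  · exact IsBilin.sum fun i _ => (𝒯.aelin_gradX hV i).isBilin_inner (𝒯.aelin_toBrokenV i)
  · exact IsBilin.sum fun i _ => IsBilin.sum fun j hj =>
      (𝒯.aelin_jumpN hV i j).isBilin_inner (𝒯.aelin_avgV hM hα_meas hα (Finset.mem_Ioi.1 hj))
  · exact IsBilin.sum fun i _ =>
      ((𝒯.aelin_trS hV i).mono_measure (𝒯.dirichletFacetMeasure_le i)).isBilin_mul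
      (((𝒯.aelin_trV hM i).mono_measure (𝒯.dirichletFacetMeasure_le i)).inner_vec
        (𝒯.aestronglyMeasurable_outwardNormal_domain hΩ i) fun _ => norm_outwardNormal_le _ _)

theorem isBilin_sForm (hV : ∀ i, ∀ v ∈ V i, MemH1 (𝒯.elem i) v) {η : SpaceTime d → ℝ}
    (hη : MemLp η ⊤ (𝒯.timeSkeletonMeasure + 𝒯.dirichletSkeletonMeasure)) :
    IsBilin fun u v : ∀ i, V i => sForm η (toBroken u) (toBroken v) := by
  obtain ⟨C, hC⟩ := exists_ae_abs_le_of_memLp_top hη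
  refine IsBilin.add ?_ ?_
  · refine IsBilin.sum fun i _ => IsBilin.sum fun j hj => ?_
    have hle := (𝒯.timeFacetMeasure_le_skeleton (Finset.mem_Ioi.1 hj)).trans
      (Measure.le_add_right (ν' := 𝒯.dirichletSkeletonMeasure) le_rfl)
    have := ((𝒯.aelin_jumpN hV i j).mul_left (hη.1.mono_measure hle) C
      (ae_mono hle hC)).isBilin_inner (𝒯.aelin_jumpN hV i j)
    simpa only [real_inner_smul_left] using this
  · refine IsBilin.sum fun i _ => ?_
    have hle := (𝒯.dirichletFacetMeasure_le_skeleton i).trans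
      (Measure.le_add_left (ν' := 𝒯.timeSkeletonMeasure) le_rfl)
    have h1 := (𝒯.aelin_trS hV i).mono_measure (𝒯.dirichletFacetMeasure_le i)
    have := (h1.mul_left (hη.1.mono_measure hle) C (ae_mono hle hC)).isBilin_mul h1
    simpa only [smul_eq_mul, mul_assoc] using this

theorem isLin_lqForm (hΩ : IsPolytope Ω)
    (hM : ∀ i, ∀ r ∈ M i, ∀ k : Fin d, MemH1 (𝒯.elem i) (fun p => r p k))
    {gD : SpaceTime d → ℝ} (hgD : MemLp gD 2 𝒯.dirichletSkeletonMeasure) :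
    IsLin fun r : ∀ i, M i => lqForm gD (toBrokenV r) :=
  IsLin.neg <| IsLin.sum fun i _ =>
    (((𝒯.aelin_trV hM i).mono_measure (𝒯.dirichletFacetMeasure_le i)).inner_vec
        (𝒯.aestronglyMeasurable_outwardNormal_domain hΩ i)
        fun _ => norm_outwardNormal_le _ _).isLin_mul
      (hgD.mono_measure (𝒯.dirichletFacetMeasure_le_skeleton i))

theorem isLin_luForm (hV : ∀ i, ∀ v ∈ V i, MemH1 (𝒯.elem i) v) {η f gD : SpaceTime d → ℝ}
    {u₀ : Space d → ℝ}
    (hη : MemLp η ⊤ (𝒯.timeSkeletonMeasure + 𝒯.dirichletSkeletonMeasure))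
    (hf : MemLp f 2 (volume.restrict (cylinder Ω T))) (hu₀ : MemLp u₀ 2 (volume.restrict Ω))
    (hgD : MemLp gD 2 𝒯.dirichletSkeletonMeasure) :
    IsLin fun v : ∀ i, V i => luForm η f u₀ gD (toBroken v) := by
  obtain ⟨C, hC⟩ := exists_ae_abs_le_of_memLp_top hη
  refine IsLin.add (IsLin.add ?_ ?_) ?_
  · exact IsLin.sum fun i _ => (𝒯.aelin_toBroken i).isLin_mul
      (hf.mono_measure (Measure.restrict_mono (𝒯.elem_subset i) le_rfl))
  · refine IsLin.sum fun i _ => ?_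
    have hle := (𝒯.dirichletFacetMeasure_le_skeleton i).trans
      (Measure.le_add_left (ν' := 𝒯.timeSkeletonMeasure) le_rfl)
    have h1 := (𝒯.aelin_trS hV i).mono_measure (𝒯.dirichletFacetMeasure_le i)
    have := (h1.mul_left (hη.1.mono_measure hle) C (ae_mono hle hC)).isLin_mul
      (hgD.mono_measure (𝒯.dirichletFacetMeasure_le_skeleton i))
    simpa only [smul_eq_mul, mul_left_comm] using this
  · refine IsLin.sum fun i hi => ?_
    have h0 : 𝒯.tbeg i = 0 := (Finset.mem_filter.1 hi).2
    have h1 := 𝒯.aelin_trS_tbeg hV i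
    rw [h0] at h1
    exact h1.isLin_mul (hu₀.mono_measure (Measure.restrict_mono (𝒯.base_subset i) le_rfl))

end Forms

end PrismaticMesh

/-! ### Nonnegativity of the time form -/

/-- The boundary lies in finitely many hyperplanes (`exists_arrangement`). -/
theorem IsPolytope.volume_frontier {d : ℕ} {P : Set (Space d)} (hP : IsPolytope P) :
    volume (frontier P) = 0 := by
  obtain ⟨ι, hι, A, hA⟩ := exists_arrangement (fun _ : Unit => P) fun _ => hP
  exact measure_mono_null (hA ()) (measure_iUnion_null fun k => A.volume_plane k)

namespace PrismaticMesh

section Time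

variable {d N : ℕ} {Ω : Set (Space d)} {T : ℝ} (𝒯 : PrismaticMesh Ω T N)

theorem disjoint_base {i j : Fin N} (hij : i ≠ j) {t : ℝ}
    (hi : t ∈ Ioo (𝒯.tbeg i) (𝒯.tend i)) (hj : t ∈ Ioo (𝒯.tbeg j) (𝒯.tend j)) :
    Disjoint (𝒯.base i) (𝒯.base j) := by
  rcases disjoint_prod.1 (𝒯.disjoint_elem i j hij) with h | h
  · exact h
  · exact absurd (mem_inter hi hj) (disjoint_iff_inter_eq_empty.1 h ▸ notMem_empty t)

/-- At every time, the closures of the elements that are active then cover the domain. -/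
theorem exists_mem_closure {x : Space d} (hx : x ∈ Ω) {t : ℝ} (ht : t ∈ Ioo 0 T) :
    ∃ i, x ∈ closure (𝒯.base i) ∧ t ∈ Icc (𝒯.tbeg i) (𝒯.tend i) := by
  obtain ⟨i, hi⟩ := mem_iUnion.1 (𝒯.cover (mk_mem_prod hx ht))
  rw [closure_prod_eq, closure_Ioo (𝒯.tbeg_lt_tend i).ne] at hi
  exact ⟨i, hi.1, hi.2⟩

theorem mem_base_of_mem_closure {x : Space d} {i : Fin N} (hx : x ∈ closure (𝒯.base i))
    (hx' : x ∉ frontier (𝒯.base i)) : x ∈ 𝒯.base i := by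
  by_contra h
  exact hx' ⟨hx, by rwa [(𝒯.isPolytope_base i).isOpen.interior_eq]⟩

theorem ae_notMem_frontier : ∀ᵐ x : Space d, ∀ i, x ∉ frontier (𝒯.base i) :=
  ae_all_iff.2 fun i => measure_eq_zero_iff_ae_notMem.1 (𝒯.isPolytope_base i).volume_frontier

theorem tbeg_nonneg (i : Fin N) : 0 ≤ 𝒯.tbeg i :=
  ((Ioo_subset_Ioo_iff (𝒯.tbeg_lt_tend i)).1 (𝒯.time_subset i)).1

theorem tend_le (i : Fin N) : 𝒯.tend i ≤ T :=
  ((Ioo_subset_Ioo_iff (𝒯.tbeg_lt_tend i)).1 (𝒯.time_subset i)).2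

theorem disjoint_base_of_tbeg_eq {i j : Fin N} (hij : i ≠ j) (h : 𝒯.tbeg i = 𝒯.tbeg j) :
    Disjoint (𝒯.base i) (𝒯.base j) := by
  obtain ⟨t, h1, h2⟩ := exists_between (lt_min (𝒯.tbeg_lt_tend i) (h ▸ 𝒯.tbeg_lt_tend j))
  rw [lt_min_iff] at h2
  exact 𝒯.disjoint_base hij ⟨h1, h2.1⟩ ⟨h ▸ h1, h2.2⟩

theorem disjoint_base_of_tend_eq {i j : Fin N} (hij : i ≠ j) (h : 𝒯.tend i = 𝒯.tend j) :
    Disjoint (𝒯.base i) (𝒯.base j) := by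
  obtain ⟨t, h1, h2⟩ := exists_between (max_lt (𝒯.tbeg_lt_tend i) (h ▸ 𝒯.tbeg_lt_tend j))
  rw [max_lt_iff] at h1
  exact 𝒯.disjoint_base hij ⟨h1.1, h2⟩ ⟨h1.2, h ▸ h2⟩

/-- Below almost every point of the bottom of an element that does not start at time zero there is
an element that ends there. -/
theorem exists_below {j : Fin N} (hj : 𝒯.tbeg j ≠ 0) {x : Space d} (hx : x ∈ 𝒯.base j)
    (hx' : ∀ i, x ∉ frontier (𝒯.base i)) : ∃ i, 𝒯.tend i = 𝒯.tbeg j ∧ x ∈ 𝒯.base i := by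
  have h0 : 0 < 𝒯.tbeg j := lt_of_le_of_ne (𝒯.tbeg_nonneg j) (Ne.symm hj)
  -- a time `s` just before the start of `K_j`, after the end of all elements that end before it
  have hev : ∀ᶠ s in 𝓝[<] (𝒯.tbeg j), s ∈ Ioo 0 (𝒯.tbeg j) ∧
      ∀ i, 𝒯.tend i < 𝒯.tbeg j → 𝒯.tend i < s := by
    refine Eventually.and (Ioo_mem_nhdsLT h0) (eventually_all.2 fun i => ?_)
    by_cases h : 𝒯.tend i < 𝒯.tbeg j
    · filter_upwards [Ioo_mem_nhdsLT h] with s hs _ using hs.1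
    · exact Eventually.of_forall fun s hs => absurd hs h
  obtain ⟨s, hs, hsi⟩ := hev.exists
  obtain ⟨i, hi, hit⟩ := 𝒯.exists_mem_closure (𝒯.base_subset j hx)
    ⟨hs.1, hs.2.trans ((𝒯.tbeg_lt_tend j).trans_le (𝒯.tend_le j))⟩
  have hxi := 𝒯.mem_base_of_mem_closure hi (hx' i)
  refine ⟨i, le_antisymm ?_ (not_lt.1 fun h => (hsi i h).not_ge hit.2), hxi⟩
  by_contra! hlt
  obtain ⟨t, h1, h2⟩ := exists_between (lt_min hlt (𝒯.tbeg_lt_tend j))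
  rw [lt_min_iff] at h2
  have hij : i ≠ j := by
    rintro rfl
    exact (hit.1.trans_lt hs.2).false
  exact disjoint_left.1 (𝒯.disjoint_base hij ⟨hit.1.trans_lt (hs.2.trans h1), h2.1⟩ ⟨h1, h2.2⟩)
    hxi hx

variable {V : ∀ i, Submodule ℝ (Lp ℝ 2 (volume.restrict (𝒯.elem i)))}

/-- Nonnegativity of `m_h(u, u)`. Integration by parts in time turns `∫ u ∂ₜu` into half the
difference of the squares at the top and at the bottom of each element; since the elements that end
at a given time tile the bottoms of those that start then (`exists_below`), these combine with the
jump terms into half the squares of the jumps, of the initial values and of the final values. -/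
theorem mForm_self_nonneg (hV : ∀ i, ∀ v ∈ V i, MemH1 (𝒯.elem i) v) (u : ∀ i, V i) :
    0 ≤ mForm (toBroken u) (toBroken u) := by
  set w := toBroken u with hw
  have hbase : ∀ i, MeasurableSet (𝒯.base i) := fun i =>
    (𝒯.isPolytope_base i).isOpen.measurableSet
  have hend : ∀ i, MemLp (fun x => trS w i (x, 𝒯.tend i)) 2 (volume.restrict (𝒯.base i)) :=
    fun i => (𝒯.aelin_trS_tend hV i).memLp u
  have hbeg : ∀ i, MemLp (fun x => trS w i (x, 𝒯.tbeg i)) 2 (volume.restrict (𝒯.base i)) :=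
    fun i => (𝒯.aelin_trS_tbeg hV i).memLp u
  set top : Fin N → ℝ := fun i => ∫ x in 𝒯.base i, trS w i (x, 𝒯.tend i) ^ 2 with htop
  set bot : Fin N → ℝ := fun i => ∫ x in 𝒯.base i, trS w i (x, 𝒯.tbeg i) ^ 2 with hbot
  have hbot0 : ∀ i, 0 ≤ bot i := fun i => integral_nonneg fun _ => sq_nonneg _
  have h1 : ∀ i, ∫ p in 𝒯.elem i, derivT (𝒯.elem i) (w i) p * w i p = top i / 2 - bot i / 2 :=
    fun i => (time_traces (𝒯.isPolytope_base i) (𝒯.tbeg_lt_tend i)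
      (Lp.stronglyMeasurable (w i)) (hV i _ (u i).2)).2.2
  have h2 : ∀ i j, 𝒯.tend i = 𝒯.tbeg j →
      ∫ x in 𝒯.base i ∩ 𝒯.base j,
        trS w j (x, 𝒯.tbeg j) * (trS w i (x, 𝒯.tbeg j) - trS w j (x, 𝒯.tbeg j))
      ≤ (∫ x in 𝒯.base i ∩ 𝒯.base j, trS w i (x, 𝒯.tend i) ^ 2) / 2
        - (∫ x in 𝒯.base i ∩ 𝒯.base j, trS w j (x, 𝒯.tbeg j) ^ 2) / 2 := by
    intro i j hij
    have m1 := (hend i).mono_measure (Measure.restrict_mono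
      (inter_subset_left (t := 𝒯.base j)) le_rfl)
    have m2 := (hbeg j).mono_measure (Measure.restrict_mono
      (inter_subset_right (s := 𝒯.base i)) le_rfl)
    rw [← integral_div, ← integral_div,
      ← integral_sub (m1.integrable_sq.div_const 2) (m2.integrable_sq.div_const 2)]
    refine integral_mono ?_ ((m1.integrable_sq.div_const 2).sub (m2.integrable_sq.div_const 2))
      fun x => ?_
    · rw [← hij] at m2 ⊢
      exact m2.integrable_mul (m1.sub m2)
    · simp only [hij]
      nlinarith [sq_nonneg (trS w i (x, 𝒯.tbeg j) - trS w j (x, 𝒯.tbeg j))]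
  have hA : ∀ i, ∑ j with 𝒯.tend i = 𝒯.tbeg j,
      ∫ x in 𝒯.base i ∩ 𝒯.base j, trS w i (x, 𝒯.tend i) ^ 2 ≤ top i := by
    intro i
    rw [← integral_biUnion_finset]
    · refine setIntegral_mono_set (hend i).integrable_sq (ae_of_all _ fun _ => sq_nonneg _)
        (ae_of_all _ ?_)
      exact iUnion₂_subset fun j _ => inter_subset_left
    · exact fun j _ => (hbase i).inter (hbase j)
    · intro j hj k hk hjk
      refine Disjoint.mono inter_subset_right inter_subset_right
        (𝒯.disjoint_base_of_tbeg_eq hjk ?_)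
      rw [← (Finset.mem_filter.1 hj).2, ← (Finset.mem_filter.1 hk).2]
    · exact fun j _ => (hend i).integrable_sq.mono_measure
        (Measure.restrict_mono inter_subset_left le_rfl)
  have hB : ∀ j, 𝒯.tbeg j ≠ 0 → bot j ≤ ∑ i with 𝒯.tend i = 𝒯.tbeg j,
      ∫ x in 𝒯.base i ∩ 𝒯.base j, trS w j (x, 𝒯.tbeg j) ^ 2 := by
    intro j hj
    have hi : ∀ S ⊆ 𝒯.base j, IntegrableOn (fun x => trS w j (x, 𝒯.tbeg j) ^ 2) S := fun S hS =>
      (hbeg j).integrable_sq.mono_measure (Measure.restrict_mono hS le_rfl)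
    rw [← integral_biUnion_finset]
    · refine setIntegral_mono_set (hi _ (iUnion₂_subset fun i _ => inter_subset_right))
        (ae_of_all _ fun _ => sq_nonneg _) ?_
      filter_upwards [𝒯.ae_notMem_frontier] with x hx hxj
      obtain ⟨i, h1, h2⟩ := 𝒯.exists_below hj hxj hx
      exact mem_iUnion₂.2 ⟨i, by simpa using h1, h2, hxj⟩
    · exact fun i _ => (hbase i).inter (hbase j)
    · intro i hi k hk hik
      refine Disjoint.mono inter_subset_left inter_subset_left
        (𝒯.disjoint_base_of_tend_eq hik ?_)
      rw [(Finset.mem_filter.1 hi).2, (Finset.mem_filter.1 hk).2]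
    · exact fun i _ => hi _ inter_subset_right
  have hB' : ∑ j, bot j ≤ (∑ j, ∑ i with 𝒯.tend i = 𝒯.tbeg j,
      ∫ x in 𝒯.base i ∩ 𝒯.base j, trS w j (x, 𝒯.tbeg j) ^ 2)
      + ∑ j with 𝒯.tbeg j = 0, bot j := by
    rw [Finset.sum_filter, ← Finset.sum_add_distrib]
    refine Finset.sum_le_sum fun j _ => ?_
    split_ifs with h
    · have : 0 ≤ ∑ i with 𝒯.tend i = 𝒯.tbeg j,
          ∫ x in 𝒯.base i ∩ 𝒯.base j, trS w j (x, 𝒯.tbeg j) ^ 2 :=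
        Finset.sum_nonneg fun i _ => integral_nonneg fun _ => sq_nonneg _
      linarith
    · simpa using hB j h
  have hswap : (∑ j, ∑ i with 𝒯.tend i = 𝒯.tbeg j,
      ∫ x in 𝒯.base i ∩ 𝒯.base j, trS w j (x, 𝒯.tbeg j) ^ 2)
      = ∑ i, ∑ j with 𝒯.tend i = 𝒯.tbeg j,
        ∫ x in 𝒯.base i ∩ 𝒯.base j, trS w j (x, 𝒯.tbeg j) ^ 2 := by
    simp only [Finset.sum_filter]
    exact Finset.sum_comm
  have hA' := Finset.sum_le_sum fun i (_ : i ∈ Finset.univ) => hA i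
  have h2' : (∑ i, ∑ j with 𝒯.tend i = 𝒯.tbeg j, ∫ x in 𝒯.base i ∩ 𝒯.base j,
      trS w j (x, 𝒯.tbeg j) * (trS w i (x, 𝒯.tbeg j) - trS w j (x, 𝒯.tbeg j)))
      ≤ (∑ i, ∑ j with 𝒯.tend i = 𝒯.tbeg j,
          ∫ x in 𝒯.base i ∩ 𝒯.base j, trS w i (x, 𝒯.tend i) ^ 2) / 2
        - (∑ i, ∑ j with 𝒯.tend i = 𝒯.tbeg j,
          ∫ x in 𝒯.base i ∩ 𝒯.base j, trS w j (x, 𝒯.tbeg j) ^ 2) / 2 := by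
    rw [Finset.sum_div, Finset.sum_div, ← Finset.sum_sub_distrib]
    refine Finset.sum_le_sum fun i _ => ?_
    rw [Finset.sum_div, Finset.sum_div, ← Finset.sum_sub_distrib]
    exact Finset.sum_le_sum fun j hj => h2 i j (Finset.mem_filter.1 hj).2
  have h3 : (∑ i with 𝒯.tbeg i = 0, ∫ x in 𝒯.base i, trS w i (x, 0) * trS w i (x, 0))
      = ∑ i with 𝒯.tbeg i = 0, bot i := by
    refine Finset.sum_congr rfl fun i hi => ?_
    simp only [hbot, (Finset.mem_filter.1 hi).2, sq]
  have h4 : 0 ≤ ∑ i with 𝒯.tbeg i = 0, bot i := Finset.sum_nonneg fun i _ => hbot0 i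
  rw [mForm, h3, Finset.sum_congr rfl fun i _ => h1 i, Finset.sum_sub_distrib, ← Finset.sum_div,
    ← Finset.sum_div]
  linarith

end Time

end PrismaticMesh

/-! ### Functions with vanishing spatial gradient -/

section Constancy

variable {d : ℕ} {P : Set (Space d)} {a b : ℝ} {u : SpaceTime d → ℝ}

/-- If the partial derivatives in space vanish, so do all directional ones. -/
theorem isWeakDeriv_zero_of_gradX {K : Set (SpaceTime d)} (hu : IntegrableOn u K)
    (h : ∀ k, IsWeakDeriv K (EuclideanSpace.single k 1, 0) u fun _ => 0) (w : Space d) :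
    IsWeakDeriv K (w, 0) u fun _ => 0 := by
  have key : ∀ s : Finset (Fin d), IsWeakDeriv K
      (∑ k ∈ s, w k • ((EuclideanSpace.single k 1, 0) : SpaceTime d)) u fun _ => 0 := by
    intro s
    induction s using Finset.induction_on with
    | empty =>
      intro φ _ _ _
      simp
    | insert k s hk ih =>
      rw [Finset.sum_insert hk]
      have := IsWeakDeriv.add hu (D := fun _ => w k * 0) (D' := fun _ => 0) (by simp) (by simp)
        ((h k).const_smul (w k)) ih
      simpa only [mul_zero, add_zero] using this
  convert key Finset.univ using 1
  refine Prod.ext ?_ ?_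
  · ext k
    simp [Prod.fst_sum, Finset.sum_apply, Pi.single_apply]
  · simp [Prod.snd_sum]

/-- On a product of a ball with a time interval, a function whose spatial derivatives vanish agrees
almost everywhere with its spatial averages. -/
theorem ae_eq_average_of_gradX_eq_zero (hP : IsOpen P) (hum : StronglyMeasurable u)
    (hu : IntegrableOn u (P ×ˢ Ioo a b))
    (h : ∀ w : Space d, IsWeakDeriv (P ×ˢ Ioo a b) (w, 0) u fun _ => 0)
    {x₀ : Space d} {r : ℝ} (hr : 0 < r) (hB : Metric.ball x₀ r ⊆ P) :
    ∀ᵐ p : SpaceTime d, p ∈ Metric.ball x₀ r ×ˢ Ioo a b →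
      u p = ⨍ y in Metric.ball x₀ r, u (y, p.2) := by
  set B := Metric.ball x₀ r with hBdef
  have hmeas : MeasurableSet {z : Space d × SpaceTime d | z.2 ∈ B ×ˢ Ioo a b → z.2.1 + z.1 ∈ B →
      u (z.2.1 + z.1, z.2.2) = u z.2} := by
    have hBm : MeasurableSet B := measurableSet_ball
    refine MeasurableSet.imp ((hBm.prod measurableSet_Ioo).preimage measurable_snd)
      (MeasurableSet.imp (hBm.preimage (by fun_prop)) ?_)
    exact measurableSet_eq_fun (hum.measurable.comp (by fun_prop))
      (hum.measurable.comp measurable_snd)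
  have h1 : ∀ᵐ z ∂(volume : Measure (Space d)).prod (volume : Measure (SpaceTime d)),
      z.2 ∈ B ×ˢ Ioo a b → z.2.1 + z.1 ∈ B → u (z.2.1 + z.1, z.2.2) = u z.2 := by
    refine (Measure.ae_prod_iff_ae_ae hmeas).2 (ae_of_all _ fun w => ?_)
    have hO : IsOpen ((B ∩ (fun x => x + w) ⁻¹' B) ×ˢ Ioo a b) :=
      (Metric.isOpen_ball.inter (Metric.isOpen_ball.preimage (by fun_prop))).prod isOpen_Ioo
    have := IsWeakDeriv.ae_sub_eq_integral (hP.measurableSet.prod measurableSet_Ioo) hO hu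
      (integrable_zero _ _ _) stronglyMeasurable_const (h w) (by
        rintro ⟨x, t⟩ ⟨⟨hx, hx'⟩, ht⟩ σ hσ
        refine ⟨hB ?_, by simpa using ht⟩
        have e : x + σ • w = (1 - σ) • x + σ • (x + w) := by module
        simp only [Prod.fst_add, Prod.smul_fst]
        rw [e]
        exact (convex_ball x₀ r) hx hx' (by linarith [hσ.2]) hσ.1 (by ring))
    filter_upwards [this] with p hp h1 h2
    have := hp ⟨⟨h1.1, h2⟩, h1.2⟩
    simp only [Pi.zero_apply, integral_zero] at this
    have e : p + (w, 0) = (p.1 + w, p.2) := Prod.ext rfl (by simp)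
    rw [e] at this
    linarith
  have h2 : ∀ᵐ p : SpaceTime d, ∀ᵐ w : Space d, p ∈ B ×ˢ Ioo a b → p.1 + w ∈ B →
      u (p.1 + w, p.2) = u p := by
    have h1' := (Measure.measurePreserving_swap (μ := (volume : Measure (SpaceTime d)))
      (ν := (volume : Measure (Space d)))).quasiMeasurePreserving.ae h1
    exact Measure.ae_ae_of_ae_prod h1'
  filter_upwards [h2] with p hp hpB
  have h3 : ∀ᵐ y : Space d, y ∈ B → u (y, p.2) = u p := by
    have := (measurePreserving_sub_right (volume : Measure (Space d)) p.1).quasiMeasurePreserving.ae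
      hp
    filter_upwards [this] with y hy hyB
    simpa using hy hpB (by simpa using hyB)
  have hB0 : volume B ≠ 0 := (Metric.measure_ball_pos _ _ hr).ne'
  have hBt : volume B ≠ ⊤ := measure_ball_lt_top.ne
  rw [setAverage_eq, setIntegral_congr_ae measurableSet_ball h3, setIntegral_const, smul_eq_mul,
    smul_eq_mul, ← mul_assoc, inv_mul_cancel₀, one_mul]
  exact (measureReal_ne_zero_iff hBt).2 hB0

/-- Two functions of time that agree almost everywhere on a prism agree at almost every time. -/
theorem ae_eq_of_ae_prod_eq {B : Set (Space d)} (hB : volume B ≠ 0) {c c' : ℝ → ℝ}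
    (h : ∀ᵐ p : SpaceTime d, p ∈ B ×ˢ Ioo a b → c p.2 = c' p.2) :
    ∀ᵐ t, t ∈ Ioo a b → c t = c' t := by
  have h1 : ∀ᵐ x : Space d, ∀ᵐ t : ℝ, (x, t) ∈ B ×ˢ Ioo a b → c t = c' t :=
    Measure.ae_ae_of_ae_prod h
  obtain ⟨x, hxB, hx⟩ : ∃ x ∈ B, ∀ᵐ t : ℝ, (x, t) ∈ B ×ˢ Ioo a b → c t = c' t := by
    by_contra hcon
    refine hB (measure_mono_null (fun x hx => ?_) (ae_iff.1 h1))
    exact fun hx' => hcon ⟨x, hx, hx'⟩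
  filter_upwards [hx] with t ht htI using ht ⟨hxB, htI⟩

/-- On a prism over a connected base, a function whose spatial derivatives vanish depends on time
only. -/
theorem exists_ae_eq_snd_of_gradX_eq_zero (hP : IsOpen P) (hPc : IsConnected P)
    (hum : StronglyMeasurable u) (hu : IntegrableOn u (P ×ˢ Ioo a b))
    (h : ∀ w : Space d, IsWeakDeriv (P ×ˢ Ioo a b) (w, 0) u fun _ => 0) :
    ∃ c : ℝ → ℝ, IntegrableOn c (Ioo a b) ∧
      ∀ᵐ p ∂volume.restrict (P ×ˢ Ioo a b), u p = c p.2 := by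
  obtain ⟨x₀, hx₀⟩ := hPc.nonempty
  obtain ⟨r₀, hr₀, hB₀⟩ := Metric.isOpen_iff.1 hP x₀ hx₀
  set c : ℝ → ℝ := fun t => ⨍ y in Metric.ball x₀ r₀, u (y, t) with hc
  have hprod : ∀ S : Set (Space d), volume.restrict (S ×ˢ Ioo a b)
      = (volume.restrict S).prod (volume.restrict (Ioo a b)) := fun S => by
    rw [Measure.prod_restrict]; rfl
  have hci : IntegrableOn c (Ioo a b) := by
    have h1 : Integrable u ((volume.restrict (Metric.ball x₀ r₀)).prod
        (volume.restrict (Ioo a b))) := by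
      rw [← hprod]
      exact hu.mono_set (prod_mono hB₀ le_rfl)
    simp only [hc, setAverage_eq]
    exact h1.integral_prod_right.const_mul _
  set S : Set (Space d) := {x | ∃ r > 0, Metric.ball x r ⊆ P ∧
    ∀ᵐ p : SpaceTime d, p ∈ Metric.ball x r ×ˢ Ioo a b → u p = c p.2} with hS
  have hSo : IsOpen S := by
    refine Metric.isOpen_iff.2 fun x ⟨r, hr, hrP, hae⟩ => ⟨r, hr, fun y hy => ?_⟩
    obtain ⟨ε, hε, hεr⟩ := Metric.isOpen_iff.1 Metric.isOpen_ball y hy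
    refine ⟨ε, hε, hεr.trans hrP, ?_⟩
    filter_upwards [hae] with p hp hpε using hp ⟨hεr hpε.1, hpε.2⟩
  have hloc : ∀ x ∈ P, ∃ r > 0, Metric.ball x r ⊆ P ∧
      ((Metric.ball x r ∩ S).Nonempty → x ∈ S) := by
    intro x hx
    obtain ⟨r, hr, hrP⟩ := Metric.isOpen_iff.1 hP x hx
    refine ⟨r, hr, hrP, fun ⟨y, hy, ρ, hρ, hρP, hae⟩ => ⟨r, hr, hrP, ?_⟩⟩
    have h1 := ae_eq_average_of_gradX_eq_zero hP hum hu h hr hrP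
    have h2 : ∀ᵐ t, t ∈ Ioo a b → (⨍ y in Metric.ball x r, u (y, t)) = c t := by
      refine ae_eq_of_ae_prod_eq (B := Metric.ball x r ∩ Metric.ball y ρ) ?_ ?_
      · exact (IsOpen.measure_pos _ (Metric.isOpen_ball.inter Metric.isOpen_ball)
          ⟨y, hy, Metric.mem_ball_self hρ⟩).ne'
      · filter_upwards [h1, hae] with p hp1 hp2 hp
        rw [← hp1 ⟨hp.1.1, hp.2⟩, hp2 ⟨hp.1.2, hp.2⟩]
    have h2' : ∀ᵐ p : SpaceTime d, p.2 ∈ Ioo a b →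
        (⨍ y in Metric.ball x r, u (y, p.2)) = c p.2 :=
      Measure.quasiMeasurePreserving_snd.ae h2
    filter_upwards [h1, h2'] with p hp1 hp2 hp
    rw [hp1 hp, hp2 hp.2]
  have hPS : P ⊆ S := by
    refine hPc.isPreconnected.subset_of_closure_inter_subset hSo ⟨x₀, hx₀, r₀, hr₀, hB₀,
      ae_eq_average_of_gradX_eq_zero hP hum hu h hr₀ hB₀⟩ ?_
    rintro x ⟨hxS, hxP⟩
    obtain ⟨r, hr, -, hxr⟩ := hloc x hxP
    obtain ⟨y, hyS, hy⟩ := Metric.mem_closure_iff.1 hxS r hr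
    exact hxr ⟨y, by rwa [Metric.mem_ball, dist_comm], hyS⟩
  refine ⟨c, hci, (ae_restrict_iff' (hP.measurableSet.prod measurableSet_Ioo)).2 ?_⟩
  rw [ae_iff]
  refine measure_null_of_locally_null _ fun p hp => ?_
  simp only [mem_ofPred_eq, Classical.not_imp] at hp
  obtain ⟨r, hr, -, hae⟩ := hPS hp.1.1
  refine ⟨{q | ¬(q ∈ P ×ˢ Ioo a b → u q = c q.2)} ∩ Metric.ball p.1 r ×ˢ Ioo a b, ?_, ?_⟩
  · refine inter_mem self_mem_nhdsWithin (mem_nhdsWithin_of_mem_nhds ?_)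
    exact (Metric.isOpen_ball.prod isOpen_Ioo).mem_nhds ⟨Metric.mem_ball_self hr, hp.1.2⟩
  · refine measure_mono_null (fun q hq => ?_) (ae_iff.1 hae)
    intro hcon
    exact hq.1 fun _ => hcon hq.2

/-- The trace of a function of time only, at every lateral point and almost every time. -/
theorem ae_hasTraceAt_of_ae_eq_snd (hP : IsOpen P) (hPb : Bornology.IsBounded P) {c : ℝ → ℝ}
    (hc : IntegrableOn c (Ioo a b))
    (h : ∀ᵐ p ∂volume.restrict (P ×ˢ Ioo a b), u p = c p.2) :
    ∀ᵐ t, t ∈ Ioo a b → ∀ x ∈ closure P, HasTraceAt (P ×ˢ Ioo a b) u (x, t) (c t) := by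
  have hc' : LocallyIntegrable ((Ioo a b).indicator c) :=
    ((integrable_indicator_iff measurableSet_Ioo).2 hc).locallyIntegrable
  filter_upwards [IsUnifLocDoublingMeasure.ae_tendsto_average (volume : Measure ℝ) hc' 1] with t hL
    ht x hx
  have hself : ∀ᶠ r in 𝓝[>] (0 : ℝ), t ∈ Metric.closedBall t (1 * r) := by
    filter_upwards [self_mem_nhdsWithin] with r hr
    exact Metric.mem_closedBall_self (by simpa using (mem_Ioi.1 hr).le)
  have h1 := hL (fun _ => t) (fun r : ℝ => r) tendsto_id hself
  rw [indicator_of_mem ht] at h1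
  refine HasTraceAt.congr_ae (w := fun p => c p.2) ?_ (by
    filter_upwards [h] with p hp using hp.symm)
  refine Tendsto.congr' ?_ h1
  obtain ⟨ε, hε, hεI⟩ := Metric.isOpen_iff.1 isOpen_Ioo t ht
  filter_upwards [Ioo_mem_nhdsGT hε] with r hr
  have hrI : Metric.ball t r ⊆ Ioo a b := (Metric.ball_subset_ball hr.2.le).trans hεI
  have hset : P ×ˢ Ioo a b ∩ Metric.ball (x, t) r = (P ∩ Metric.ball x r) ×ˢ Metric.ball t r := by
    rw [← ball_prod_same, prod_inter_prod, inter_eq_self_of_subset_right hrI]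
  have e1 : ⨍ s in Metric.closedBall t r, (Ioo a b).indicator c s = ⨍ s in Metric.ball t r, c s := by
    have hb : (Metric.ball t r : Set ℝ) =ᵐ[volume] Metric.closedBall t r := by
      rw [Real.ball_eq_Ioo, Real.closedBall_eq_Icc]
      exact Ioo_ae_eq_Icc
    rw [← setAverage_congr hb, setAverage_eq, setAverage_eq]
    congr 1
    exact setIntegral_congr_fun measurableSet_ball fun s hs => indicator_of_mem (hrI hs) _
  have hne : volume.real (P ∩ Metric.ball x r) ≠ 0 := by
    refine (measureReal_ne_zero_iff (((hPb.subset inter_subset_left).measure_lt_top).ne)).2 ?_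
    obtain ⟨y, hyP, hy⟩ := Metric.mem_closure_iff.1 hx r hr.1
    exact (IsOpen.measure_pos _ (hP.inter Metric.isOpen_ball)
      ⟨y, hyP, by rwa [Metric.mem_ball, dist_comm]⟩).ne'
  rw [e1, hset, setAverage_eq, setAverage_eq]
  have e2 := setIntegral_prod_mul (μ := (volume : Measure (Space d))) (ν := (volume : Measure ℝ))
    (fun _ => (1 : ℝ)) c (P ∩ Metric.ball x r) (Metric.ball t r)
  simp only [one_mul, setIntegral_const, smul_eq_mul, mul_one] at e2
  have e3 : (volume : Measure (SpaceTime d)).real ((P ∩ Metric.ball x r) ×ˢ Metric.ball t r)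
      = volume.real (P ∩ Metric.ball x r) * volume.real (Metric.ball t r) :=
    measureReal_prod_prod _ _
  have e4 : ∫ p in (P ∩ Metric.ball x r) ×ˢ Metric.ball t r, c p.2
      = volume.real (P ∩ Metric.ball x r) * ∫ s in Metric.ball t r, c s := e2
  rw [e3, e4, smul_eq_mul, smul_eq_mul, mul_inv]
  field_simp

end Constancy

/-! ### Walking through the cells of an arrangement -/

namespace Arrangement

variable {d : ℕ} {ι : Type} [Finite ι] [DecidableEq ι] (A : Arrangement d ι)

/-- A generic point of `U`: the segment from it to `y` meets no two hyperplanes at the same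
parameter, since the line through it and `y` avoids the pairwise intersections. -/
theorem exists_mem_forall_form_mul_ne {U : Set (Space d)} (hU : IsOpen U) (hne : U.Nonempty)
    {y : Space d} (hy : ∀ k, A.form k y ≠ 0) :
    ∃ x ∈ U, ∀ j k, j ≠ k → A.form k y * A.form j x - A.form j y * A.form k x ≠ 0 := by
  have hae : ∀ᵐ x : Space d, ∀ j k, j ≠ k →
      A.form k y * A.form j x - A.form j y * A.form k x ≠ 0 := by
    refine ae_all_iff.2 fun j => ae_all_iff.2 fun k => ?_
    by_cases hjk : j = k
    · exact ae_of_all _ fun x h => absurd hjk h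
    set n := A.form k y • A.normal j - A.form j y • A.normal k with hn
    set c := A.form k y * A.offset j - A.form j y * A.offset k with hc
    have e : ∀ x, A.form k y * A.form j x - A.form j y * A.form k x = inner ℝ n x - c := by
      intro x
      rw [hn, inner_sub_left, real_inner_smul_left, real_inner_smul_left, hc]
      simp only [form]
      ring
    have h0 : n ≠ 0 ∨ c ≠ 0 := by
      by_contra! hcon
      -- otherwise the two forms would be proportional, and the two planes would coincide
      have hz : ∀ x, A.form k y * A.form j x = A.form j y * A.form k x := fun x => by
        have := e x
        rw [hcon.1, hcon.2, inner_zero_left] at this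
        linarith
      refine hjk (A.injective (Set.ext fun x => ?_))
      have := hz x
      constructor
      · intro h
        have h : A.form j x = 0 := h
        rw [h, mul_zero] at this
        exact (mul_eq_zero.1 this.symm).resolve_left (hy j)
      · intro h
        have h : A.form k x = 0 := h
        rw [h, mul_zero] at this
        exact (mul_eq_zero.1 this).resolve_left (hy k)
    have := measure_eq_zero_iff_ae_notMem.1 (addHaar_hyperplane (volume : Measure (Space d)) h0)
    filter_upwards [this] with x hx _ hzero
    rw [e] at hzero
    exact hx (sub_eq_zero.1 hzero)
  by_contra! hcon
  refine (hU.measure_pos volume hne).ne' (measure_mono_null (fun x hx => ?_) (ae_iff.1 hae))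
  intro h
  obtain ⟨j, k, hjk, h'⟩ := hcon x hx
  exact h j k hjk h'

/-- The first hyperplane met on a generic segment from one cell to another is met in a facet of
the former cell. -/
theorem exists_face_nonempty {σ τ : ι → Bool} (hσ : (A.cell σ).Nonempty) (hτ : (A.cell τ).Nonempty)
    (hne : σ ≠ τ) : ∃ k, σ k ≠ τ k ∧ (A.face k σ).Nonempty := by
  obtain ⟨y, hy⟩ := hτ
  obtain ⟨x, hx, hgen⟩ := A.exists_mem_forall_form_mul_ne (A.isOpen_cell σ) hσ (y := y)
    fun k h => A.notMem_plane_of_mem_cell hy k h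
  have ha : ∀ j, 0 < sgn (σ j) * A.form j x := hx
  have hb : ∀ j, σ j ≠ τ j → 0 < -(sgn (σ j) * A.form j y) := by
    intro j hj
    have h1 := hy j
    have h2 : τ j = !σ j := by cases h : σ j <;> cases h' : τ j <;> simp_all
    rw [h2, sgn_not] at h1
    linarith
  have hb' : ∀ j, σ j = τ j → 0 < sgn (σ j) * A.form j y := fun j hj => by
    rw [hj]; exact hy j
  set s : ι → ℝ := fun j => A.form j x / (A.form j x - A.form j y) with hs
  have hs' : ∀ j, s j = sgn (σ j) * A.form j x /
      (sgn (σ j) * A.form j x + -(sgn (σ j) * A.form j y)) := by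
    intro j
    have h0 : sgn (σ j) ≠ 0 := fun h => by have := abs_sgn (σ j); simp [h] at this
    rw [hs, ← sub_eq_add_neg, ← mul_sub, mul_div_mul_left _ _ h0]
  obtain ⟨k, hk, hmin⟩ : ∃ k, σ k ≠ τ k ∧ ∀ j, σ j ≠ τ j → s k ≤ s j := by
    have hfin : {j | σ j ≠ τ j}.Finite := Set.toFinite _
    obtain ⟨j, hj⟩ := Function.ne_iff.1 hne
    exact hfin.exists_minimalFor s _ ⟨j, hj⟩ |>.imp fun k hk =>
      ⟨hk.1, fun j hj => (le_total (s k) (s j)).elim id fun h => hk.2 hj h⟩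
  have hden : 0 < sgn (σ k) * A.form k x + -(sgn (σ k) * A.form k y) := add_pos (ha k) (hb k hk)
  have hs0 : 0 < s k := by rw [hs']; exact div_pos (ha k) hden
  have hs1 : s k < 1 := by
    rw [hs', div_lt_one hden]
    linarith [hb k hk]
  refine ⟨k, hk, x + s k • (y - x), ?_, fun j hj => ?_⟩
  · rw [form_add_smul_sub]
    have h0 : A.form k x - A.form k y ≠ 0 := by
      intro h
      have : sgn (σ k) * A.form k x + -(sgn (σ k) * A.form k y)
        = sgn (σ k) * (A.form k x - A.form k y) := by ring
      rw [this, h, mul_zero] at hden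
      exact hden.false
    simp only [hs]
    field_simp
    ring
  · rw [form_add_smul_sub]
    have e : sgn (σ j) * ((1 - s k) * A.form j x + s k * A.form j y)
        = (1 - s k) * (sgn (σ j) * A.form j x) + s k * (sgn (σ j) * A.form j y) := by ring
    rw [e]
    by_cases hjτ : σ j = τ j
    · exact add_pos (mul_pos (by linarith) (ha j)) (mul_pos hs0 (hb' j hjτ))
    · have hdj := add_pos (ha j) (hb j hjτ)
      have hlt : s k < s j := by
        refine lt_of_le_of_ne (hmin j hjτ) fun heq => hgen j k hj ?_
        have hdk' : A.form k x - A.form k y ≠ 0 := fun h => by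
          rw [← sub_eq_add_neg, ← mul_sub, h, mul_zero] at hden
          exact hden.false
        have hdj' : A.form j x - A.form j y ≠ 0 := fun h => by
          rw [← sub_eq_add_neg, ← mul_sub, h, mul_zero] at hdj
          exact hdj.false
        simp only [hs] at heq
        rw [div_eq_div_iff hdk' hdj'] at heq
        linarith
      rw [hs' j, lt_div_iff₀ hdj] at hlt
      linarith

/-- A property that passes from a cell to its neighbours holds on all cells once it holds on one. -/
theorem cell_induction {τ : ι → Bool} (hτ : (A.cell τ).Nonempty) {Q : (ι → Bool) → Prop}
    (base : Q τ) (step : ∀ σ k, (A.face k σ).Nonempty → Q (flip σ k) → Q σ) {σ : ι → Bool}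
    (hσ : (A.cell σ).Nonempty) : Q σ := by
  have := Fintype.ofFinite ι
  induction hn : hammingDist σ τ using Nat.strong_induction_on generalizing σ with
  | _ n ih =>
    by_cases hne : σ = τ
    · rwa [hne]
    obtain ⟨k, hk, hface⟩ := A.exists_face_nonempty hσ hτ hne
    refine step σ k hface (ih (hammingDist (flip σ k) τ) ?_ ?_ rfl)
    · rw [← hn]
      refine Finset.card_lt_card (Finset.ssubset_iff_of_subset (fun j hj => ?_) |>.2 ⟨k, ?_, ?_⟩)
      · rw [Finset.mem_filter] at hj ⊢
        refine ⟨hj.1, fun h => ?_⟩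
        by_cases hjk : j = k
        · rw [hjk] at h
          exact hk h
        · rw [flip_of_ne σ hjk] at hj
          exact hj.2 h
      · simpa using hk
      · have : (!σ k) = τ k := by cases h : σ k <;> cases h' : τ k <;> simp_all
        simp [flip_self, this]
    · obtain ⟨x, hx⟩ := hface
      have hx' : x ∈ A.face k (flip σ k) := by rwa [face_flip]
      exact closure_nonempty_iff.1 ⟨x, A.mem_closure_of_mem_face hx'⟩

/-- Facets have positive surface measure. -/
theorem hausdorff_face_ne_zero {k : ι} {σ : ι → Bool} (h : (A.face k σ).Nonempty) :
    (μHE[d - 1] : Measure (Space d)) (A.face k σ) ≠ 0 := by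
  have e := A.map_param_restrict k (A.measurableSet_face k σ) (A.face_subset_plane k σ)
  have e' : (μHE[d - 1] : Measure (Space d)) (A.face k σ)
      = A.dirMeasure k (A.param k ⁻¹' A.face k σ) := by
    have := congrArg (fun ν => ν univ) e
    simp only [Measure.restrict_apply_univ] at this
    rw [← this, Measure.map_apply (A.isometry_param k).continuous.measurable MeasurableSet.univ]
    simp
  rw [e']
  refine ((A.isOpen_preimage_face k σ).measure_pos _ ?_).ne'
  obtain ⟨x, hx⟩ := h
  obtain ⟨w, rfl⟩ : x ∈ range (A.param k) := by
    rw [range_param]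
    exact A.face_subset_plane k σ hx
  exact ⟨w, hx⟩

/-- A property that holds almost everywhere on `S × J` holds, at some point of a given facet
contained in `S`, for almost every time, because facets have positive surface measure. -/
theorem exists_mem_face_of_ae_prod {k : ι} {σ : ι → Bool} (hne : (A.face k σ).Nonempty)
    {S : Set (Space d)} (hS : A.face k σ ⊆ S) {J : Set ℝ} {Q : SpaceTime d → Prop}
    (h : ∀ᵐ p ∂((μHE[d - 1] : Measure (Space d)).restrict S).prod (volume.restrict J), Q p) :
    ∃ x ∈ A.face k σ, ∀ᵐ t ∂volume.restrict J, Q (x, t) := by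
  have h1 : ∀ᵐ x ∂(μHE[d - 1] : Measure (Space d)).restrict (A.face k σ),
      ∀ᵐ t ∂volume.restrict J, Q (x, t) :=
    ae_restrict_of_ae_restrict_of_subset hS (Measure.ae_ae_of_ae_prod h)
  rw [ae_restrict_iff' (A.measurableSet_face k σ)] at h1
  by_contra hcon
  refine A.hausdorff_face_ne_zero hne (measure_mono_null (fun x hx => ?_) (ae_iff.1 h1))
  exact fun h => hcon ⟨x, hx, h hx⟩

end Arrangement

/-- A cell outside `Ω` exists, from which the zeros can propagate. For `d = 0` there is none. -/
theorem exists_notMem_closure_notMem_plane {d : ℕ} (hd : 1 ≤ d) {ι : Type} [Finite ι]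
    (A : Arrangement d ι) {Ω : Set (Space d)} (hΩ : IsPolytope Ω) :
    ∃ x ∉ closure Ω, ∀ k, x ∉ A.plane k := by
  have : Nonempty (Fin d) := ⟨⟨0, hd⟩⟩
  have : Nontrivial (Space d) := inferInstance
  have hne : (closure Ω)ᶜ.Nonempty := nonempty_compl.2 hΩ.isCompact_closure.ne_univ
  by_contra hcon
  refine (isClosed_closure.isOpen_compl.measure_pos volume hne).ne'
    (measure_mono_null (fun x hx => ?_) (measure_iUnion_null fun k => A.volume_plane k))
  rw [mem_iUnion]
  by_contra! h
  exact hcon ⟨x, hx, h⟩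

/-! ### Functions of time without jumps and with vanishing boundary values -/

namespace PrismaticMesh

variable {d N : ℕ} {Ω : Set (Space d)} {T : ℝ} (𝒯 : PrismaticMesh Ω T N)

theorem timeFacetMeasure_comm (i j : Fin N) :
    𝒯.timeFacetMeasure i j = 𝒯.timeFacetMeasure j i := by
  rw [timeFacetMeasure, timeFacetMeasure, inter_comm, inter_comm (Ioo _ _)]

variable {𝒯} in
theorem ae_jumpN_eq_zero_of_ne {u : 𝒯.BrokenScalar}
    (h : ∀ i j, i < j → ∀ᵐ p ∂𝒯.timeFacetMeasure i j, jumpN u i j p = 0) {i j : Fin N}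
    (hij : i ≠ j) : ∀ᵐ p ∂𝒯.timeFacetMeasure i j, jumpN u i j p = 0 := by
  rcases lt_or_gt_of_ne hij with hlt | hlt
  · exact h i j hlt
  · rw [timeFacetMeasure_comm]
    filter_upwards [h j i hlt] with p hp
    rwa [jumpN, add_comm]

/-- A broken function that depends on time only in each element, has no jumps across the time-like
facets and vanishes on the Dirichlet facets, is zero: its zeros propagate from cell to cell,
starting from the exterior of the domain. -/
theorem ae_eq_zero_of_jumpN_eq_zero (hd : 1 ≤ d) (hΩ : IsPolytope Ω) {u : 𝒯.BrokenScalar}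
    {c : Fin N → ℝ → ℝ}
    (hc : ∀ i, ∀ᵐ t, t ∈ Ioo (𝒯.tbeg i) (𝒯.tend i) → ∀ x ∈ closure (𝒯.base i),
      trS u i (x, t) = c i t)
    (hjump : ∀ i j, i < j → ∀ᵐ p ∂𝒯.timeFacetMeasure i j, jumpN u i j p = 0)
    (hdir : ∀ i, ∀ᵐ p ∂𝒯.dirichletFacetMeasure i, trS u i p = 0) (i : Fin N) :
    ∀ᵐ t, t ∈ Ioo (𝒯.tbeg i) (𝒯.tend i) → c i t = 0 := by
  classical
  obtain ⟨ι, hι, A, hA⟩ := exists_arrangement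
    (fun o : Option (Fin N) => o.elim Ω 𝒯.base) (by
      rintro (_ | j)
      · exact hΩ
      · exact 𝒯.isPolytope_base j)
  have hAΩ : frontier Ω ⊆ ⋃ k, A.plane k := hA none
  have hAb : ∀ j, frontier (𝒯.base j) ⊆ ⋃ k, A.plane k := fun j => hA (some j)
  have ho : ∀ j, IsOpen (𝒯.base j) := fun j => (𝒯.isPolytope_base j).isOpen
  obtain ⟨xs, hxs, hxsp⟩ := exists_notMem_closure_notMem_plane hd A hΩ
  obtain ⟨τ, hτ⟩ := A.exists_mem_cell hxsp
  have key : ∀ σ, (A.cell σ).Nonempty → ∀ i, A.cell σ ⊆ 𝒯.base i →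
      ∀ᵐ t, t ∈ Ioo (𝒯.tbeg i) (𝒯.tend i) → c i t = 0 := by
    intro σ hσ
    refine A.cell_induction ⟨xs, hτ⟩ (Q := fun σ => ∀ i, A.cell σ ⊆ 𝒯.base i →
      ∀ᵐ t, t ∈ Ioo (𝒯.tbeg i) (𝒯.tend i) → c i t = 0) ?_ ?_ hσ
    · intro i hi
      exact absurd (subset_closure (𝒯.base_subset i (hi hτ))) hxs
    intro σ k hface ih i hi
    rcases A.cell_subset_or_disjoint (hAb i) (Arrangement.flip σ k) with hi' | hi'
    · exact ih i hi'
    have hfi : A.IsFacet (𝒯.base i) k σ := ⟨hi, hi'.mono_right subset_closure⟩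
    have hfri := A.face_subset_frontier (ho i) hfi
    rcases A.cell_subset_or_disjoint hAΩ (Arrangement.flip σ k) with hΩ' | hΩ'
    · -- a facet inside the domain: every element on the other side is covered by the hypothesis
      have hflip : (A.cell (Arrangement.flip σ k)).Nonempty := by
        obtain ⟨x, hx⟩ := hface
        have hx' : x ∈ A.face k (Arrangement.flip σ k) := by rwa [A.face_flip]
        exact closure_nonempty_iff.1 ⟨x, A.mem_closure_of_mem_face hx'⟩
      have hnbr : ∀ j, A.cell (Arrangement.flip σ k) ⊆ 𝒯.base j → ∀ᵐ t,
          t ∈ Ioo (𝒯.tbeg i) (𝒯.tend i) ∩ Ioo (𝒯.tbeg j) (𝒯.tend j) → c i t = 0 := by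
        intro j hj
        have hij : i ≠ j := by
          rintro rfl
          obtain ⟨y, hy⟩ := hflip
          exact disjoint_left.1 hfi.2 hy (hj hy)
        by_cases hIJ : (Ioo (𝒯.tbeg i) (𝒯.tend i) ∩ Ioo (𝒯.tbeg j) (𝒯.tend j)).Nonempty
        swap
        · rw [not_nonempty_iff_eq_empty.1 hIJ]
          exact ae_of_all _ fun t ht => absurd ht (notMem_empty t)
        obtain ⟨t₀, ht₀, ht₀'⟩ := hIJ
        have hdisj := 𝒯.disjoint_base hij ht₀ ht₀'
        have hfj : A.IsFacet (𝒯.base j) k (Arrangement.flip σ k) :=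
          ⟨hj, by rw [Arrangement.flip_flip]; exact hdisj.mono_left hi⟩
        have hfrj := A.face_subset_frontier (ho j) hfj
        rw [A.face_flip] at hfrj
        obtain ⟨x, hx, hxt⟩ := A.exists_mem_face_of_ae_prod hface (subset_inter hfri hfrj)
          (ae_jumpN_eq_zero_of_ne hjump hij)
        rw [ae_restrict_iff' (measurableSet_Ioo.inter measurableSet_Ioo)] at hxt
        have hni := (A.isOutwardNormal_of_isFacet (ho i) hfi hx)
        have hnj := (A.isOutwardNormal_of_isFacet (ho j) hfj
          (by rwa [A.face_flip] : x ∈ A.face k (Arrangement.flip σ k))).outwardNormal_eq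
        rw [Arrangement.flip_self, sgn_not, neg_neg] at hnj
        filter_upwards [hxt, hc i, hc j, ih j hj] with t h1 h2 h3 h4 ht
        have h5 := h1 ht
        rw [jumpN, normal, normal, hni.outwardNormal_eq, hnj,
          h2 ht.1 x (frontier_subset_closure (hfri hx)),
          h3 ht.2 x (frontier_subset_closure (hfrj hx)), h4 ht.2, zero_smul, add_zero] at h5
        refine (smul_eq_zero.1 h5).resolve_right fun h => ?_
        have := hni.1
        rw [h, norm_zero] at this
        exact zero_ne_one this
      have hend : ∀ᵐ t : ℝ, ∀ j, t ≠ 𝒯.tbeg j ∧ t ≠ 𝒯.tend j := by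
        refine ae_all_iff.2 fun j => ?_
        filter_upwards [Measure.ae_ne volume (𝒯.tbeg j), Measure.ae_ne volume (𝒯.tend j)]
          with t h1 h2 using ⟨h1, h2⟩
      have hall : ∀ᵐ t, ∀ j, A.cell (Arrangement.flip σ k) ⊆ 𝒯.base j →
          t ∈ Ioo (𝒯.tbeg i) (𝒯.tend i) ∩ Ioo (𝒯.tbeg j) (𝒯.tend j) → c i t = 0 := by
        refine ae_all_iff.2 fun j => ?_
        by_cases hj : A.cell (Arrangement.flip σ k) ⊆ 𝒯.base j
        · filter_upwards [hnbr j hj] with t ht _ using ht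
        · exact ae_of_all _ fun t h => absurd h hj
      filter_upwards [hall, hend] with t h1 h2 ht
      obtain ⟨y, hy⟩ := hflip
      obtain ⟨j, hyj, htj⟩ := 𝒯.exists_mem_closure (hΩ' hy) (𝒯.time_subset i ht)
      refine h1 j ((A.cell_subset_or_disjoint (hAb j) (Arrangement.flip σ k)).resolve_right fun h =>
        disjoint_left.1 h hy hyj) ⟨ht, ?_⟩
      exact ⟨lt_of_le_of_ne htj.1 (h2 j).1.symm, lt_of_le_of_ne htj.2 (h2 j).2⟩
    · -- a facet on the boundary of the domain
      have hfΩ : A.IsFacet Ω k σ :=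
        ⟨hi.trans (𝒯.base_subset i), hΩ'.mono_right subset_closure⟩
      have hfrΩ := A.face_subset_frontier hΩ.isOpen hfΩ
      obtain ⟨x, hx, hxt⟩ := A.exists_mem_face_of_ae_prod hface (subset_inter hfri hfrΩ) (hdir i)
      rw [ae_restrict_iff' measurableSet_Ioo] at hxt
      filter_upwards [hxt, hc i] with t h1 h2 ht
      rw [← h2 ht x (frontier_subset_closure (hfri hx)), h1 ht]
  obtain ⟨x, hx, hxp⟩ : ∃ x ∈ 𝒯.base i, ∀ k, x ∉ A.plane k := by
    by_contra hcon
    refine ((ho i).measure_pos volume (𝒯.isPolytope_base i).isConnected.nonempty).ne'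
      (measure_mono_null (fun x hx => ?_) (measure_iUnion_null fun k => A.volume_plane k))
    rw [mem_iUnion]
    by_contra! h
    exact hcon ⟨x, hx, h⟩
  obtain ⟨σ, hσ⟩ := A.exists_mem_cell hxp
  exact key σ ⟨x, hσ⟩ i ((A.cell_subset_or_disjoint (hAb i) σ).resolve_right fun h =>
    disjoint_left.1 h hσ (subset_closure hx))

end PrismaticMesh

/-! ### Uniqueness of the discrete solution -/

/-- A square mixed system in finite dimension whose homogeneous version has only the zero solution
is uniquely solvable. -/
theorem existsUnique_mixed {U Q : Type*} [AddCommGroup U] [Module ℝ U] [AddCommGroup Q] [Module ℝ Q]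
    [FiniteDimensional ℝ U] [FiniteDimensional ℝ Q] {δ : Q → Q → ℝ} {β : U → Q → ℝ}
    {μ σ : U → U → ℝ} {l : Q → ℝ} {l' : U → ℝ} (hδ : IsBilin δ) (hβ : IsBilin β) (hμ : IsBilin μ)
    (hσ : IsBilin σ) (hl : IsLin l) (hl' : IsLin l')
    (h0 : ∀ u q, (∀ r, δ q r + β u r = 0) → (∀ v, μ u v - β v q + σ u v = 0) → u = 0 ∧ q = 0) :
    ∃! w : U × Q, (∀ r, δ w.2 r + β w.1 r = l r) ∧
      ∀ v, μ w.1 v - β v w.2 + σ w.1 v = l' v := by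
  obtain ⟨bd, hbd⟩ := hδ
  obtain ⟨bb, hbb⟩ := hβ
  obtain ⟨bm, hbm⟩ := hμ
  obtain ⟨bs, hbs⟩ := hσ
  obtain ⟨lq, hlq⟩ := hl
  obtain ⟨lu, hlu⟩ := hl'
  -- the operator of the system, with both equations added up
  let p₁ : U × Q →ₗ[ℝ] U := LinearMap.fst ℝ _ _
  let p₂ : U × Q →ₗ[ℝ] Q := LinearMap.snd ℝ _ _
  let L : U × Q →ₗ[ℝ] Module.Dual ℝ (U × Q) :=
    bd.compl₁₂ p₂ p₂ + bb.compl₁₂ p₁ p₂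
      + (bm.compl₁₂ p₁ p₁ - bb.flip.compl₁₂ p₂ p₁ + bs.compl₁₂ p₁ p₁)
  let F : Module.Dual ℝ (U × Q) := lq ∘ₗ p₂ + lu ∘ₗ p₁
  have hL : ∀ w z : U × Q, L w z = bd w.2 z.2 + bb w.1 z.2
      + (bm w.1 z.1 - bb z.1 w.2 + bs w.1 z.1) := fun _ _ => rfl
  have hF : ∀ z : U × Q, F z = lq z.2 + lu z.1 := fun _ => rfl
  have hinj : Function.Injective L := by
    refine (injective_iff_map_eq_zero L).2 fun w hw => ?_
    have hw0 : ∀ z, L w z = 0 := fun z => by rw [hw]; rfl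
    have h := h0 w.1 w.2 (fun r => ?_) (fun v => ?_)
    · exact Prod.ext h.1 h.2
    · have := hw0 (0, r)
      rw [hL] at this
      simpa only [map_zero, LinearMap.zero_apply, sub_zero, add_zero, hbd, hbb] using this
    · have := hw0 (v, 0)
      rw [hL] at this
      simp only [map_zero, zero_add] at this
      simpa only [hbm, hbb, hbs] using this
  have hsurj : Function.Surjective L :=
    (LinearMap.injective_iff_surjective_of_finrank_eq_finrank
      Subspace.dual_finrank_eq.symm).1 hinj
  have hiff : ∀ w, L w = F ↔ (∀ r, δ w.2 r + β w.1 r = l r) ∧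
      ∀ v, μ w.1 v - β v w.2 + σ w.1 v = l' v := by
    intro w
    constructor
    · intro h
      refine ⟨fun r => ?_, fun v => ?_⟩
      · have := LinearMap.congr_fun h (0, r)
        rw [hL, hF] at this
        simpa only [map_zero, LinearMap.zero_apply, sub_zero, add_zero, hbd, hbb, hlq] using this
      · have := LinearMap.congr_fun h (v, 0)
        rw [hL, hF] at this
        simp only [map_zero, zero_add] at this
        simpa only [hbm, hbb, hbs, hlu] using this
    · rintro ⟨h1, h2⟩
      refine LinearMap.ext fun z => ?_
      rw [hL, hF, hbd, hbb, hbm, hbb, hbs, hlq, hlu, h1, h2]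
  obtain ⟨w, hw⟩ := hsurj F
  exact ⟨w, (hiff w).1 hw, fun w' hw' => hinj (((hiff w').2 hw').trans hw.symm)⟩

theorem AELin.integrable_inner {X Y α F : Type*} [AddCommGroup X] [Module ℝ X] [AddCommGroup Y]
    [Module ℝ Y] [MeasurableSpace α] {ν : Measure α} [NormedAddCommGroup F]
    [InnerProductSpace ℝ F] {T : X → α → F} {S : Y → α → F} (hT : AELin ν T) (hS : AELin ν S)
    (x : X) (y : Y) : Integrable (fun p => (inner ℝ (T x p) (S y p) : ℝ)) ν := by
  refine (L2.integrable_inner (𝕜 := ℝ) (hT.toLin x) (hS.toLin y)).congr ?_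
  filter_upwards [hT.coe_toLin x, hS.coe_toLin y] with p h1 h2
  rw [h1, h2]

theorem Lp.eq_zero_of_integral_inner_self {α F : Type*} [MeasurableSpace α] {ν : Measure α}
    [NormedAddCommGroup F] [InnerProductSpace ℝ F] {f : Lp F 2 ν}
    (h : ∫ p, (inner ℝ (f p) (f p) : ℝ) ∂ν = 0) : f = 0 := by
  rw [← L2.inner_def] at h
  exact inner_self_eq_zero.1 h

namespace PrismaticMesh

variable {d N : ℕ} {Ω : Set (Space d)} {T : ℝ} (𝒯 : PrismaticMesh Ω T N)
variable {V : ∀ i, Submodule ℝ (Lp ℝ 2 (volume.restrict (𝒯.elem i)))}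
variable {M : ∀ i, Submodule ℝ (Lp (Space d) 2 (volume.restrict (𝒯.elem i)))}

/-- The diffusion form is nonnegative and definite. -/
theorem dForm_self {κ : SpaceTime d → Matrix (Fin d) (Fin d) ℝ}
    (hκ_meas : ∀ k l, AEMeasurable (fun p => κ p k l) (volume.restrict (cylinder Ω T)))
    {θ : ℝ} (hθ : 0 < θ)
    (hκ : ∀ᵐ p ∂(volume.restrict (cylinder Ω T)),
      ∀ y : Space d, θ * ‖y‖ ^ 2 ≤ inner ℝ y (Matrix.toEuclideanLin (κ p) y)) (q : ∀ i, M i) :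
    0 ≤ dForm κ (toBrokenV q) (toBrokenV q) ∧
      (dForm κ (toBrokenV q) (toBrokenV q) = 0 → q = 0) := by
  have hle : ∀ i, volume.restrict (𝒯.elem i) ≤ volume.restrict (cylinder Ω T) := fun i =>
    Measure.restrict_mono (𝒯.elem_subset i) le_rfl
  have hnn : ∀ i, ∀ᵐ p ∂volume.restrict (𝒯.elem i), θ *
      ‖Matrix.toEuclideanLin (κ p)⁻¹ (toBrokenV q i p)‖ ^ 2
      ≤ inner ℝ (Matrix.toEuclideanLin (κ p)⁻¹ (toBrokenV q i p)) (toBrokenV q i p) := by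
    intro i
    filter_upwards [ae_mono (hle i) hκ] with p hp using coercive_inv hθ hp _
  have hnn' : ∀ i, 0 ≤ᵐ[volume.restrict (𝒯.elem i)] fun p => (inner ℝ
      (Matrix.toEuclideanLin (κ p)⁻¹ (toBrokenV q i p)) (toBrokenV q i p) : ℝ) := by
    intro i
    filter_upwards [hnn i] with p hp using le_trans (by positivity) hp
  have h0 : ∀ i, 0 ≤ ∫ p in 𝒯.elem i, (inner ℝ
      (Matrix.toEuclideanLin (κ p)⁻¹ (toBrokenV q i p)) (toBrokenV q i p) : ℝ) :=
    fun i => integral_nonneg_of_ae (hnn' i)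
  refine ⟨Finset.sum_nonneg fun i _ => h0 i, fun h => ?_⟩
  have hz := (Finset.sum_eq_zero_iff_of_nonneg fun i _ => h0 i).1 h
  funext i
  have hT : AELin (volume.restrict (𝒯.elem i)) fun (r : ∀ i, M i) p =>
      Matrix.toEuclideanLin (κ p)⁻¹ (toBrokenV r i p) := by
    refine (𝒯.aelin_toBrokenV i).apply (fun p => Matrix.toEuclideanLin (κ p)⁻¹) θ⁻¹
      (fun r => aestronglyMeasurable_inv_apply (fun k l => (hκ_meas k l).mono_measure (hle i))
        (Lp.memLp _).1) ?_
    filter_upwards [ae_mono (hle i) hκ] with p hp y using norm_inv_le_of_coercive hθ hp y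
  have hint := hT.integrable_inner (𝒯.aelin_toBrokenV i) q q
  have hae := (integral_eq_zero_iff_of_nonneg_ae (hnn' i) hint).1 (hz i (Finset.mem_univ i))
  refine Subtype.ext (Lp.ext ?_)
  refine EventuallyEq.trans ?_ (Lp.coeFn_zero _ _ _).symm
  filter_upwards [hae, hnn i, ae_mono (hle i) hκ] with p h1 h2 h3
  rw [h1, Pi.zero_apply] at h2
  have h4 : Matrix.toEuclideanLin (κ p)⁻¹ (toBrokenV q i p) = 0 := by
    have : ‖Matrix.toEuclideanLin (κ p)⁻¹ (toBrokenV q i p)‖ ^ 2 ≤ 0 :=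
      nonpos_of_mul_nonpos_right h2 hθ
    exact norm_eq_zero.1 (pow_eq_zero_iff two_ne_zero |>.1 (le_antisymm this (by positivity)))
  have h5 := toEuclideanLin_mul_inv_of_coercive hθ h3 (toBrokenV q i p)
  rw [h4, map_zero] at h5
  exact h5.symm

/-- The stabilization form is nonnegative, and controls the jumps and the boundary values. -/
theorem sForm_self (hV : ∀ i, ∀ v ∈ V i, MemH1 (𝒯.elem i) v) {η : SpaceTime d → ℝ}
    (hη : MemLp η ⊤ (𝒯.timeSkeletonMeasure + 𝒯.dirichletSkeletonMeasure))
    (hη_pos : ∃ c > 0, ∀ᵐ p ∂(𝒯.timeSkeletonMeasure + 𝒯.dirichletSkeletonMeasure), c ≤ η p)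
    (u : ∀ i, V i) :
    0 ≤ sForm η (toBroken u) (toBroken u) ∧ (sForm η (toBroken u) (toBroken u) = 0 →
      (∀ i j, i < j → ∀ᵐ p ∂𝒯.timeFacetMeasure i j, jumpN (toBroken u) i j p = 0) ∧
      ∀ i, ∀ᵐ p ∂𝒯.dirichletFacetMeasure i, trS (toBroken u) i p = 0) := by
  obtain ⟨C, hC⟩ := exists_ae_abs_le_of_memLp_top hη
  obtain ⟨c, hc, hcη⟩ := hη_pos
  have hle1 : ∀ i j, i < j →
      𝒯.timeFacetMeasure i j ≤ 𝒯.timeSkeletonMeasure + 𝒯.dirichletSkeletonMeasure :=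
    fun i j hij => (𝒯.timeFacetMeasure_le_skeleton hij).trans (Measure.le_add_right le_rfl)
  have hle2 : ∀ i, 𝒯.dirichletFacetMeasure i
      ≤ 𝒯.timeSkeletonMeasure + 𝒯.dirichletSkeletonMeasure :=
    fun i => (𝒯.dirichletFacetMeasure_le_skeleton i).trans (Measure.le_add_left le_rfl)
  have hn1 : ∀ i j, i < j → 0 ≤ᵐ[𝒯.timeFacetMeasure i j] fun p =>
      η p * (inner ℝ (jumpN (toBroken u) i j p) (jumpN (toBroken u) i j p) : ℝ) := by
    intro i j hij
    filter_upwards [ae_mono (hle1 i j hij) hcη] with p hp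
    exact mul_nonneg (hc.le.trans hp) real_inner_self_nonneg
  have hn2 : ∀ i, 0 ≤ᵐ[𝒯.dirichletFacetMeasure i] fun p =>
      η p * (trS (toBroken u) i p * trS (toBroken u) i p) := by
    intro i
    filter_upwards [ae_mono (hle2 i) hcη] with p hp
    exact mul_nonneg (hc.le.trans hp) (mul_self_nonneg _)
  have hs1 : ∀ i, 0 ≤ ∑ j ∈ Finset.Ioi i, ∫ p, η p *
      (inner ℝ (jumpN (toBroken u) i j p) (jumpN (toBroken u) i j p) : ℝ)
        ∂𝒯.timeFacetMeasure i j := fun i =>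
    Finset.sum_nonneg fun j hj => integral_nonneg_of_ae (hn1 i j (Finset.mem_Ioi.1 hj))
  have hs2 : ∀ i, 0 ≤ ∫ p, η p * (trS (toBroken u) i p * trS (toBroken u) i p)
      ∂𝒯.dirichletFacetMeasure i := fun i => integral_nonneg_of_ae (hn2 i)
  have hS1 := Finset.sum_nonneg fun i (_ : i ∈ Finset.univ) => hs1 i
  have hS2 := Finset.sum_nonneg fun i (_ : i ∈ Finset.univ) => hs2 i
  refine ⟨add_nonneg hS1 hS2, fun h => ?_⟩
  obtain ⟨hz1, hz2⟩ := (add_eq_zero_iff_of_nonneg hS1 hS2).1 h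
  have hz1 := (Finset.sum_eq_zero_iff_of_nonneg fun i _ => hs1 i).1 hz1
  have hz2 := (Finset.sum_eq_zero_iff_of_nonneg fun i _ => hs2 i).1 hz2
  refine ⟨fun i j hij => ?_, fun i => ?_⟩
  · have hz := (Finset.sum_eq_zero_iff_of_nonneg fun j hj =>
      integral_nonneg_of_ae (hn1 i j (Finset.mem_Ioi.1 hj))).1 (hz1 i (Finset.mem_univ i)) j
      (Finset.mem_Ioi.2 hij)
    have hint := ((𝒯.aelin_jumpN hV i j).mul_left (hη.1.mono_measure (hle1 i j hij)) C
      (ae_mono (hle1 i j hij) hC)).integrable_inner (𝒯.aelin_jumpN hV i j) u u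
    simp only [real_inner_smul_left] at hint
    have hae := (integral_eq_zero_iff_of_nonneg_ae (hn1 i j hij) hint).1 hz
    filter_upwards [hae, ae_mono (hle1 i j hij) hcη] with p h1 h2
    exact inner_self_eq_zero.1 ((mul_eq_zero.1 h1).resolve_left (hc.trans_le h2).ne')
  · have h1 := (𝒯.aelin_trS hV i).mono_measure (𝒯.dirichletFacetMeasure_le i)
    have hint := (h1.mul_left (hη.1.mono_measure (hle2 i)) C
      (ae_mono (hle2 i) hC)).integrable_inner h1 u u
    simp only [real_inner_smul_left] at hint
    have hae := (integral_eq_zero_iff_of_nonneg_ae (hn2 i) hint).1 (hz2 i (Finset.mem_univ i))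
    filter_upwards [hae, ae_mono (hle2 i) hcη] with p h1 h2
    exact mul_self_eq_zero.1 ((mul_eq_zero.1 h1).resolve_left (hc.trans_le h2).ne')

/-- A discrete function without jumps across the time-like facets and vanishing on the Dirichlet
facets whose spatial gradient vanishes is zero. -/
theorem eq_zero_of_gradX_eq_zero (hd : 1 ≤ d) (hΩ : IsPolytope Ω)
    (hV : ∀ i, ∀ v ∈ V i, MemH1 (𝒯.elem i) v) {u : ∀ i, V i}
    (hg : ∀ i, gradX (𝒯.elem i) (toBroken u i) = 0)
    (hjump : ∀ i j, i < j → ∀ᵐ p ∂𝒯.timeFacetMeasure i j, jumpN (toBroken u) i j p = 0)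
    (hdir : ∀ i, ∀ᵐ p ∂𝒯.dirichletFacetMeasure i, trS (toBroken u) i p = 0) : u = 0 := by
  have hui : ∀ i, IntegrableOn (toBroken u i) (𝒯.elem i) := fun i => by
    have : IsFiniteMeasure (volume.restrict (𝒯.elem i)) :=
      ⟨by simpa using (𝒯.volume_elem_ne_top i).lt_top⟩
    exact (Lp.memLp _).integrable one_le_two
  have hweak : ∀ i k, IsWeakDeriv (𝒯.elem i) (EuclideanSpace.single k 1, 0) (toBroken u i)
      fun _ => 0 := by
    intro i k φ h1 h2 h3
    have := (hV i _ (u i).2).exists_gradX k φ h1 h2 h3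
    refine this.trans ?_
    congr 1
    refine integral_congr_ae ?_
    have h0 : gradX (𝒯.elem i) ((u i : Lp ℝ 2 (volume.restrict (𝒯.elem i))) : SpaceTime d → ℝ) = 0 :=
      hg i
    rw [h0]
    filter_upwards [Lp.coeFn_zero (Space d) 2 (volume.restrict (𝒯.elem i))] with p hp
    rw [hp]
    simp
  have hex := fun i => exists_ae_eq_snd_of_gradX_eq_zero (𝒯.isPolytope_base i).isOpen
    (𝒯.isPolytope_base i).isConnected (Lp.stronglyMeasurable (toBroken u i)) (hui i)
    (isWeakDeriv_zero_of_gradX (hui i) (hweak i))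
  choose c hci hc using hex
  have htr : ∀ i, ∀ᵐ t, t ∈ Ioo (𝒯.tbeg i) (𝒯.tend i) → ∀ x ∈ closure (𝒯.base i),
      trS (toBroken u) i (x, t) = c i t := by
    intro i
    filter_upwards [ae_hasTraceAt_of_ae_eq_snd (𝒯.isPolytope_base i).isOpen
      (𝒯.isPolytope_base i).isBounded (hci i) (hc i)] with t ht htI x hx
    exact (ht htI x hx).trace_eq
  have hzero := 𝒯.ae_eq_zero_of_jumpN_eq_zero hd hΩ htr hjump hdir
  funext i
  refine Subtype.ext (Lp.ext ?_)
  refine EventuallyEq.trans ?_ (Lp.coeFn_zero _ _ _).symm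
  have h2 : ∀ᵐ p : SpaceTime d, p.2 ∈ Ioo (𝒯.tbeg i) (𝒯.tend i) → c i p.2 = 0 :=
    Measure.quasiMeasurePreserving_snd.ae (hzero i)
  filter_upwards [hc i, ae_restrict_of_ae h2, ae_restrict_mem (𝒯.isOpen_elem i).measurableSet]
    with p h3 h4 h5
  exact h3.trans (h4 h5.2)

/-- For a function without jumps and with vanishing boundary values, `b_h` reduces to the integral
of the gradient, which can be tested with itself by the compatibility condition. -/
theorem gradX_eq_zero_of_bForm_eq_zero {α : SpaceTime d → ℝ}
    (hVM : ∀ i, ∀ v ∈ V i, gradX (𝒯.elem i) v ∈ M i) {u : ∀ i, V i}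
    (hb : ∀ r : ∀ i, M i, bForm α (toBroken u) (toBrokenV r) = 0)
    (hjump : ∀ i j, i < j → ∀ᵐ p ∂𝒯.timeFacetMeasure i j, jumpN (toBroken u) i j p = 0)
    (hdir : ∀ i, ∀ᵐ p ∂𝒯.dirichletFacetMeasure i, trS (toBroken u) i p = 0) (i : Fin N) :
    gradX (𝒯.elem i) (toBroken u i) = 0 := by
  obtain ⟨G, hG⟩ : ∃ G : ∀ i, M i, ∀ i, toBrokenV G i = gradX (𝒯.elem i) (toBroken u i) :=
    ⟨fun i => ⟨gradX (𝒯.elem i) (toBroken u i), hVM i _ (u i).2⟩, fun _ => rfl⟩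
  have e3 := hb G
  have ej : (∑ i, ∑ j ∈ Finset.Ioi i, ∫ p, (inner ℝ (jumpN (toBroken u) i j p)
      (avgV (1 - α p) (toBrokenV G) i j p) : ℝ) ∂(𝒯.timeFacetMeasure i j)) = 0 := by
    refine Finset.sum_eq_zero fun i _ => Finset.sum_eq_zero fun j hj => ?_
    refine integral_eq_zero_of_ae ?_
    filter_upwards [hjump i j (Finset.mem_Ioi.1 hj)] with p hp
    rw [hp, inner_zero_left, Pi.zero_apply]
  have eD : (∑ i, ∫ p, trS (toBroken u) i p * (inner ℝ (trV (toBrokenV G) i p)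
      (outwardNormal Ω p.1) : ℝ) ∂(𝒯.dirichletFacetMeasure i)) = 0 := by
    refine Finset.sum_eq_zero fun i _ => integral_eq_zero_of_ae ?_
    filter_upwards [hdir i] with p hp
    rw [hp, zero_mul, Pi.zero_apply]
  rw [bForm, ej, eD, sub_zero, sub_zero] at e3
  have e4 : ∑ i, ∫ p in 𝒯.elem i, (inner ℝ (gradX (𝒯.elem i) (toBroken u i) p)
      (gradX (𝒯.elem i) (toBroken u i) p) : ℝ) = 0 := by
    rw [← e3]
    exact Finset.sum_congr rfl fun i _ => by rw [hG]
  refine Lp.eq_zero_of_integral_inner_self ?_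
  exact (Finset.sum_eq_zero_iff_of_nonneg fun i _ =>
    integral_nonneg fun p => real_inner_self_nonneg).1 e4 i (Finset.mem_univ i)

/-- The homogeneous discrete problem has only the trivial solution. -/
theorem eq_zero_of_homogeneous (hd : 1 ≤ d) (hΩ : IsPolytope Ω)
    {κ : SpaceTime d → Matrix (Fin d) (Fin d) ℝ}
    (hκ_meas : ∀ k l, AEMeasurable (fun p => κ p k l) (volume.restrict (cylinder Ω T)))
    {θ : ℝ} (hθ : 0 < θ)
    (hκ : ∀ᵐ p ∂(volume.restrict (cylinder Ω T)),
      ∀ y : Space d, θ * ‖y‖ ^ 2 ≤ inner ℝ y (Matrix.toEuclideanLin (κ p) y))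
    {α η : SpaceTime d → ℝ}
    (hη : MemLp η ⊤ (𝒯.timeSkeletonMeasure + 𝒯.dirichletSkeletonMeasure))
    (hη_pos : ∃ c > 0, ∀ᵐ p ∂(𝒯.timeSkeletonMeasure + 𝒯.dirichletSkeletonMeasure), c ≤ η p)
    (hV : ∀ i, ∀ v ∈ V i, MemH1 (𝒯.elem i) v)
    (hVM : ∀ i, ∀ v ∈ V i, gradX (𝒯.elem i) v ∈ M i) {u : ∀ i, V i} {q : ∀ i, M i}
    (h1 : ∀ r : ∀ i, M i, dForm κ (toBrokenV q) (toBrokenV r)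
      + bForm α (toBroken u) (toBrokenV r) = 0)
    (h2 : ∀ v : ∀ i, V i, mForm (toBroken u) (toBroken v) - bForm α (toBroken v) (toBrokenV q)
      + sForm η (toBroken u) (toBroken v) = 0) : u = 0 ∧ q = 0 := by
  obtain ⟨hd0, hdz⟩ := 𝒯.dForm_self hκ_meas hθ hκ q
  obtain ⟨hs0, hsz⟩ := 𝒯.sForm_self hV hη hη_pos u
  have hm0 := 𝒯.mForm_self_nonneg hV u
  -- testing with the solution itself cancels the two terms with `b_h`
  have e1 := h1 q
  have e2 := h2 u
  have hq : q = 0 := hdz (by linarith)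
  obtain ⟨hjump, hdir⟩ := hsz (by linarith)
  have hb : ∀ r : ∀ i, M i, bForm α (toBroken u) (toBrokenV r) = 0 := by
    intro r
    obtain ⟨b, hb⟩ := 𝒯.isBilin_dForm (M := M) hκ_meas hθ hκ
    beta_reduce at hb
    have e3 := h1 r
    rwa [← hb, hq, map_zero, LinearMap.zero_apply, zero_add] at e3
  exact ⟨𝒯.eq_zero_of_gradX_eq_zero hd hΩ hV
    (𝒯.gradX_eq_zero_of_bForm_eq_zero hVM hb hjump hdir) hjump hdir, hq⟩

end PrismaticMesh

end SpaceTimeLDG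

theorem mainTheorem2 {d N : ℕ} (hd : 1 ≤ d)
    {Ω : Set (SpaceTimeLDG.Space d)} (hΩ : SpaceTimeLDG.IsPolytope Ω)
    {T : ℝ} (hT : 0 < T) (𝒯 : SpaceTimeLDG.PrismaticMesh Ω T N)
    -- diffusion tensor
    (κ : SpaceTimeLDG.SpaceTime d → Matrix (Fin d) (Fin d) ℝ)
    (hκ_meas : ∀ k l, AEMeasurable (fun p => κ p k l)
      (volume.restrict (SpaceTimeLDG.cylinder Ω T)))
    (θ : ℝ) (hθ : 0 < θ)
    (hκ : ∀ᵐ p ∂(volume.restrict (SpaceTimeLDG.cylinder Ω T)), (κ p).IsSymm ∧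
      ∀ y : SpaceTimeLDG.Space d, θ * ‖y‖ ^ 2 ≤ inner ℝ y (Matrix.toEuclideanLin (κ p) y))
    -- data
    (f : SpaceTimeLDG.SpaceTime d → ℝ)
    (hf : MemLp f 2 (volume.restrict (SpaceTimeLDG.cylinder Ω T)))
    (u₀ : SpaceTimeLDG.Space d → ℝ) (hu₀ : MemLp u₀ 2 (volume.restrict Ω))
    (gD : SpaceTimeLDG.SpaceTime d → ℝ) (hgD : MemLp gD 2 𝒯.dirichletSkeletonMeasure)
    -- averaging weights and stabilization function on the time-like facets
    (α : SpaceTimeLDG.SpaceTime d → ℝ) (hα_meas : AEMeasurable α 𝒯.timeSkeletonMeasure)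
    (hα : ∀ᵐ p ∂𝒯.timeSkeletonMeasure, α p ∈ Icc (0 : ℝ) 1)
    (η : SpaceTimeLDG.SpaceTime d → ℝ)
    (hη : MemLp η ∞ (𝒯.timeSkeletonMeasure + 𝒯.dirichletSkeletonMeasure))
    (hη_pos : ∃ c > 0, ∀ᵐ p ∂(𝒯.timeSkeletonMeasure + 𝒯.dirichletSkeletonMeasure), c ≤ η p)
    -- local discrete spaces: finite-dimensional subspaces of `H¹(K)` and of `H¹(K)^d`
    (V : ∀ i, Submodule ℝ (Lp ℝ 2 (volume.restrict (𝒯.elem i))))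
    (M : ∀ i, Submodule ℝ (Lp (SpaceTimeLDG.Space d) 2 (volume.restrict (𝒯.elem i))))
    (hV_fin : ∀ i, FiniteDimensional ℝ (V i)) (hM_fin : ∀ i, FiniteDimensional ℝ (M i))
    (hV : ∀ i, ∀ v ∈ V i, SpaceTimeLDG.MemH1 (𝒯.elem i) v)
    (hM : ∀ i, ∀ r ∈ M i, ∀ k : Fin d, SpaceTimeLDG.MemH1 (𝒯.elem i) (fun p => r p k))
    -- local compatibility condition
    (hVM : ∀ i, ∀ v ∈ V i, SpaceTimeLDG.gradX (𝒯.elem i) v ∈ M i) :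
    ∃! w : (∀ i, V i) × (∀ i, M i),
      SpaceTimeLDG.IsLDGSolution 𝒯 V M κ α η f u₀ gD w.1 w.2 := by
  have hκ' : ∀ᵐ p ∂(volume.restrict (SpaceTimeLDG.cylinder Ω T)),
      ∀ y : SpaceTimeLDG.Space d, θ * ‖y‖ ^ 2 ≤ inner ℝ y (Matrix.toEuclideanLin (κ p) y) :=
    hκ.mono fun p hp => hp.2
  exact SpaceTimeLDG.existsUnique_mixed (𝒯.isBilin_dForm hκ_meas hθ hκ')
    (𝒯.isBilin_bForm hΩ hV hM hα_meas hα) (𝒯.isBilin_mForm hV) (𝒯.isBilin_sForm hV hη)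
    (𝒯.isLin_lqForm hΩ hM hgD) (𝒯.isLin_luForm hV hη hf hu₀ hgD)
    fun u q h1 h2 => 𝒯.eq_zero_of_homogeneous hd hΩ hκ_meas hθ hκ' hη hη_pos hV hVM h1 h2
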